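/- For positive integers $k_1,\dots,k_d$ with $k_d\ge 2$ let $$\zeta(k_1,\dots,k_d)=\sum_{0<m_1<\cdots<m_d}\frac1{m_1^{k_1}\cdots m_d^{k_d}},\qquad \zeta(\emptyset)=1.$$ Let $\zeta^*$ be the stuffle regularization of these values: the unique real-valued function on all finite sequences of positive integers which agrees with $\zeta$ on the empty sequence and on the sequences with last entry at least $2$, satisfies $\zeta^*(1)=0$, and, extended linearly to formal sums of sequences, is multiplicative for the stuffle (harmonic) product, the bilinear product with unit $\emptyset$ given by $(a,u)*(b,v)=(a,u*(b,v))+(b,(a,u)*v)+(a+b,u*v)$ for positive integers $a,b$ and sequences $u,v$. For positive integers $k_1,\dots,k_d$ $(d\ge 0)$ and $a\ge 0$ put $$\zeta^{\star,*}(k_1,\dots,k_d)=\sum_{\square_1,\dots,\square_{d-1}\in\{\,\text{``,''}\,,\,\text{``+''}\,\}}\zeta^*(k_1\,\square_1\cdots\square_{d-1}\,k_d),\qquad \zeta^{\star,*}(\emptyset)=1,$$ $$\zeta_a^*(k_1,\dots,k_d)=(-1)^a\sum_{\substack{a_1+\cdots+a_d=a\\ a_1,\dots,a_d\ge 0}}\zeta^*(k_1+a_1,\dots,k_d+a_d)\prod_{j=1}^d\binom{k_j-1+a_j}{a_j}$$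 (so $\zeta_0^*(\emptyset)=1$ and $\zeta_a^*(\emptyset)=0$ for $a>0$). When $k_d\ge2$, or when the sequence is empty, write $\zeta^\star$ and $\zeta_a$ for $\zeta^{\star,*}$ and $\zeta_a^*$. Let $B_n$ denote the Bernoulli numbers. **Theorem.** Let $d\ge1$ and let $k_1,\dots,k_d$ be positive integers with $k_d\ge 2$ and $k_1+\cdots+k_d\not\equiv d \pmod 2$. Then $$\begin{aligned}\zeta(k_1,\dots,k_d)={}&\frac{\zeta(k_1,\dots,k_d)-\zeta^\star(k_1,\dots,k_d)}2\\&-\sum_{0\le i<j\le d}\ \sum_{\substack{a+2m+b=k_j\\ a,b,m\ge0}}(-1)^{m+i+b+k_1+\cdots+k_j}\,\frac{(2\pi)^{2m}B_{2m}}{2\,(2m)!}\\&\qquad\times\zeta^{\star,*}(k_1,\dots,k_i)\,\zeta_a^*(k_{j-1},\dots,k_{i+1})\,\zeta_b(k_{j+1},\dots,k_d).\end{aligned}$$ -/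

import Mathlib

namespace MZV

noncomputable section

open Filter Topology Finset

/-! Finite sequences of positive integers are represented by lists `[k₁, …, k_d]` of natural
numbers with positive entries. -/

/-- All entries are at least `1`. -/
def IsIndex (k : List ℕ) : Prop := ∀ x ∈ k, 1 ≤ x

/-- The sequence is empty, or its last entry `k_d` is at least `2`. -/
def IsAdmissible (k : List ℕ) : Prop := IsIndex k ∧ ∀ x ∈ k.getLast?, 2 ≤ x

/-- The multiple zeta value
`ζ(k₁, …, k_d) = ∑_{0 < m₁ < ⋯ < m_d} 1 / (m₁ ^ k₁ ⋯ m_d ^ k_d)`, convergent for admissible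
sequences. In particular `ζ(∅) = 1`. -/
def zeta (k : List ℕ) : ℝ :=
  ∑' m : {m : Fin k.length → ℕ // StrictMono m ∧ ∀ i, 0 < m i},
    ∏ i, 1 / ((m.1 i : ℝ) ^ k.get i)

/-- The stuffle (harmonic) product of two sequences, as a list of sequences with repetitions:
`(a, u) * (b, v) = (a, u * (b, v)) + (b, (a, u) * v) + (a + b, u * v)`. -/
def stuffle : List ℕ → List ℕ → List (List ℕ)
  | [], v => [v]
  | a :: u, [] => [a :: u]
  | a :: u, b :: v =>
      (stuffle u (b :: v)).map (a :: ·) ++ (stuffle (a :: u) v).map (b :: ·) ++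
        (stuffle u v).map ((a + b) :: ·)
termination_by u v => u.length + v.length

/-- `Z` is the stuffle regularization of the multiple zeta values: it extends `ζ` from admissible
sequences to all sequences of positive integers, is multiplicative for the stuffle product, and
takes the value `0` at the sequence `(1)`. -/
structure IsStuffleRegularization (Z : List ℕ → ℝ) : Prop where
  eq_zeta : ∀ k, IsAdmissible k → Z k = zeta k
  one : Z [1] = 0
  mul : ∀ u v, IsIndex u → IsIndex v → Z u * Z v = ((stuffle u v).map Z).sum

/-! ### Existence and uniqueness of the stuffle regularization -/

/-- Number of trailing ones. -/
def trail : List ℕ → ℕ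
  | [] => 0
  | a :: l => if ∀ x ∈ a :: l, x = 1 then l.length + 1 else trail l

theorem trail_le : ∀ l : List ℕ, trail l ≤ l.length
  | [] => by simp [trail]
  | a :: l => by
      have := trail_le l
      unfold trail
      split_ifs
      · simp
      · simp only [List.length_cons]
        omega

theorem trail_all : ∀ {l : List ℕ}, (∀ x ∈ l, x = 1) → trail l = l.length
  | [], _ => by simp [trail]
  | a :: l, h => by simp only [trail, if_pos h, List.length_cons]

theorem all_of_trail : ∀ {l : List ℕ}, trail l = l.length → ∀ x ∈ l, x = 1
  | [], _ => by simp
  | a :: l, h => by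
      unfold trail at h
      split_ifs at h with h1
      · exact h1
      · have := trail_le l
        simp at h
        omega

theorem trail_cons_ge (a : ℕ) (l : List ℕ) : trail l ≤ trail (a :: l) := by
  have := trail_le l
  conv_rhs => unfold trail
  split_ifs <;> omega

theorem trail_append_one : ∀ l : List ℕ, trail (l ++ [1]) = trail l + 1
  | [] => by simp [trail]
  | a :: l => by
      have ih := trail_append_one l
      rw [List.cons_append]
      unfold trail
      by_cases h : ∀ x ∈ a :: l, x = 1
      · rw [if_pos h, if_pos]
        · simp
        · intro x hx
          simp at hx h
          grind
      · rw [if_neg h, if_neg, ih]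
        intro h'
        apply h
        intro x hx
        apply h'
        simp at hx ⊢
        tauto

theorem stuffle_one_cons (b : ℕ) (v : List ℕ) : stuffle [1] (b :: v) =
    [1 :: b :: v] ++ (stuffle [1] v).map (b :: ·) ++ [(1 + b) :: v] := by
  rw [stuffle]
  simp [stuffle]

theorem stuffle_nil_right (u : List ℕ) : stuffle u [] = [u] := by
  cases u <;> simp [stuffle]

theorem mem_stuffle_one : ∀ v : List ℕ, v ++ [1] ∈ stuffle [1] v
  | [] => by simp [stuffle]
  | b :: v => by
      rw [stuffle_one_cons]
      simp [mem_stuffle_one v]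

theorem length_stuffle_one : ∀ (v x : List ℕ), x ∈ stuffle [1] v → v.length ≤ x.length
  | [], x, _ => by simp
  | b :: v, x, h => by
      rw [stuffle_one_cons] at h
      simp at h
      rcases h with rfl | ⟨y, hy, rfl⟩ | rfl
      · simp
      · simpa using length_stuffle_one v y hy
      · simp

theorem eq_of_all_one {l l' : List ℕ} (h : ∀ x ∈ l, x = 1) (h' : ∀ x ∈ l', x = 1)
    (hl : l.length = l'.length) : l = l' := by
  rw [List.eq_replicate_of_mem h, List.eq_replicate_of_mem h', hl]

theorem trail_stuffle_one : ∀ (v x : List ℕ), IsIndex v → x ∈ stuffle [1] v →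
    x = v ++ [1] ∨ trail x ≤ trail v
  | [], x, _, h => by simp [stuffle] at h; simp [h]
  | b :: v, x, hv, h => by
      have hv' : IsIndex v := fun y hy => hv y (List.mem_cons_of_mem _ hy)
      have hb : 1 ≤ b := hv b (by simp)
      rw [stuffle_one_cons] at h
      simp at h
      rcases h with rfl | ⟨y, hy, rfl⟩ | rfl
      · by_cases h1 : ∀ x ∈ b :: v, x = 1
        · left
          apply eq_of_all_one
          · intro x hx
            rcases List.mem_cons.1 hx with rfl | hx
            · rfl
            · exact h1 x hx
          · intro x hx
            rcases List.mem_append.1 hx with hx | hx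
            · exact h1 x hx
            · simpa using hx
          · simp
        · right
          rw [trail, if_neg]
          intro h'
          exact h1 fun x hx => h' x (List.mem_cons_of_mem _ hx)
      · rcases trail_stuffle_one v y hv' hy with rfl | h2
        · left; simp
        · right
          have hl := length_stuffle_one v y hy
          have hl' := trail_le v
          by_cases h1 : ∀ x ∈ b :: y, x = 1
          · have hy1 : trail y = y.length :=
              trail_all fun x hx => h1 x (List.mem_cons_of_mem _ hx)
            have hv1 := all_of_trail (l := v) (by omega)
            have hbv : ∀ x ∈ b :: v, x = 1 := by
              intro x hx
              rcases List.mem_cons.1 hx with rfl | hx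
              · exact h1 _ (by simp)
              · exact hv1 x hx
            rw [trail_all h1, trail_all hbv]
            simp
            omega
          · rw [trail, if_neg h1]
            exact h2.trans (trail_cons_ge b v)
      · right
        rw [trail, if_neg]
        · exact trail_cons_ge b v
        · intro h'
          have := h' (1 + b) (by simp)
          omega

theorem isIndex_stuffle : ∀ (u v x : List ℕ), IsIndex u → IsIndex v → x ∈ stuffle u v → IsIndex x
  | [], v, x, _, hv, h => by simp [stuffle] at h; rwa [h]
  | a :: u, [], x, hu, _, h => by simp [stuffle] at h; rwa [h]
  | a :: u, b :: v, x, hu, hv, h => by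
      have hu' : IsIndex u := fun y hy => hu y (List.mem_cons_of_mem _ hy)
      have hv' : IsIndex v := fun y hy => hv y (List.mem_cons_of_mem _ hy)
      have hcons : ∀ (c : ℕ) (y : List ℕ), 1 ≤ c → IsIndex y → IsIndex (c :: y) := by
        intro c y hc hy z hz
        rcases List.mem_cons.1 hz with rfl | hz
        · exact hc
        · exact hy z hz
      have ha : 1 ≤ a := hu a (by simp)
      have hb : 1 ≤ b := hv b (by simp)
      rw [stuffle] at h
      simp only [List.mem_append, List.mem_map] at h
      rcases h with (⟨y, hy, rfl⟩ | ⟨y, hy, rfl⟩) | ⟨y, hy, rfl⟩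
      · exact hcons _ _ ha (isIndex_stuffle u (b :: v) y hu' hv hy)
      · exact hcons _ _ hb (isIndex_stuffle (a :: u) v y hu hv' hy)
      · exact hcons _ _ (by omega) (isIndex_stuffle u v y hu' hv' hy)
termination_by u v => u.length + v.length

theorem admissible_or {k : List ℕ} (hk : IsIndex k) :
    IsAdmissible k ∨ ∃ v, IsIndex v ∧ k = v ++ [1] := by
  rcases List.eq_nil_or_concat k with rfl | ⟨v, a, rfl⟩
  · left; exact ⟨hk, by simp⟩
  · by_cases ha : a = 1
    · right
      exact ⟨v, fun x hx => hk x (by simp [hx]), by simp [ha]⟩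
    · left
      refine ⟨hk, ?_⟩
      have := hk a (by simp)
      simp
      omega

theorem sum_stuffle_one (f : List ℕ → ℝ) (v : List ℕ) :
    ((stuffle [1] v).map f).sum = ((stuffle [1] v).count (v ++ [1]) : ℝ) * f (v ++ [1]) +
      (((stuffle [1] v).filter (· ≠ v ++ [1])).map f).sum := by
  generalize stuffle [1] v = L
  generalize v ++ [1] = w
  induction L with
  | nil => simp
  | cons x L ih =>
    by_cases h : x = w
    · subst h
      simp [ih]
      ring
    · simp [h, ih]
      ring

theorem induction_trail {P : List ℕ → Prop} (h0 : ∀ k, IsAdmissible k → P k)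
    (h1 : ∀ v, IsIndex v → P v → (∀ x ∈ (stuffle [1] v).filter (· ≠ v ++ [1]), P x) → P (v ++ [1]))
    (k : List ℕ) (hk : IsIndex k) : P k := by
  induction hn : trail k using Nat.strong_induction_on generalizing k with
  | _ n ih =>
    subst hn
    rcases admissible_or hk with h | ⟨v, hv, rfl⟩
    · exact h0 k h
    · have ht := trail_append_one v
      refine h1 v hv (ih _ (by omega) v hv rfl) ?_
      intro x hx
      simp only [List.mem_filter, decide_eq_true_eq] at hx
      rcases trail_stuffle_one v x hv hx.1 with h | h
      · exact absurd h hx.2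
      · exact ih _ (by omega) x
          (isIndex_stuffle [1] v x (by intro y hy; simp at hy; omega) hv hx.1) rfl

theorem isIndex_one : IsIndex [1] := by intro y hy; simp at hy; omega

theorem IsStuffleRegularization.unique {Z Z' : List ℕ → ℝ} (h : IsStuffleRegularization Z)
    (h' : IsStuffleRegularization Z') (k : List ℕ) (hk : IsIndex k) : Z k = Z' k := by
  refine induction_trail (P := fun k => Z k = Z' k) ?_ ?_ k hk
  · intro k hk
    rw [h.eq_zeta k hk, h'.eq_zeta k hk]
  · intro v hv _ hx
    have e := h.mul [1] v isIndex_one hv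
    have e' := h'.mul [1] v isIndex_one hv
    rw [h.one, zero_mul, sum_stuffle_one] at e
    rw [h'.one, zero_mul, sum_stuffle_one] at e'
    have hm : ((stuffle [1] v).filter (· ≠ v ++ [1])).map Z =
        ((stuffle [1] v).filter (· ≠ v ++ [1])).map Z' := List.map_congr_left hx
    rw [hm] at e
    have hc : ((stuffle [1] v).count (v ++ [1]) : ℝ) ≠ 0 := by
      have := List.count_pos_iff.2 (mem_stuffle_one v)
      positivity
    apply mul_left_cancel₀ hc
    linarith

/-- The truncated sum over `M < m₁ < ⋯ < m_d ≤ M + g`. -/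
def trunc : ℕ → ℕ → List ℕ → ℝ
  | _, _, [] => 1
  | 0, _, _ :: _ => 0
  | g + 1, M, a :: l => trunc g (M + 1) (a :: l) + 1 / ((M + 1 : ℕ) : ℝ) ^ a * trunc g (M + 1) l

theorem trunc_nil (g M : ℕ) : trunc g M [] = 1 := by cases g <;> rfl

theorem trunc_nonneg : ∀ (g M : ℕ) (l : List ℕ), 0 ≤ trunc g M l
  | g, M, [] => by rw [trunc_nil]; norm_num
  | 0, M, _ :: _ => by simp [trunc]
  | g + 1, M, a :: l => by
      have h1 := trunc_nonneg g (M + 1) (a :: l)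
      have h2 := trunc_nonneg g (M + 1) l
      rw [trunc]
      positivity

theorem trunc_mul : ∀ (u v : List ℕ) (g M : ℕ),
    trunc g M u * trunc g M v = ((stuffle u v).map (trunc g M)).sum := by
  intro u v g
  induction g generalizing u v with
  | zero =>
    intro M
    rcases u with _ | ⟨a, u⟩ <;> rcases v with _ | ⟨b, v⟩ <;>
      simp [stuffle, trunc, Function.comp_def]
  | succ g ih =>
    intro M
    rcases u with _ | ⟨a, u⟩ <;> rcases v with _ | ⟨b, v⟩
    · simp [stuffle, trunc]
    · simp [stuffle, trunc]
    · simp [stuffle, trunc]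
    · have e1 := ih (a :: u) (b :: v) (M + 1)
      have e2 := ih u (b :: v) (M + 1)
      have e3 := ih (a :: u) v (M + 1)
      have e4 := ih u v (M + 1)
      rw [stuffle] at e1 ⊢
      simp only [List.map_append, List.map_map, List.sum_append, Function.comp_def, trunc,
        List.sum_map_add, List.sum_map_mul_left] at e1 ⊢
      rw [← e2, ← e3, ← e4, pow_add]
      have e5 : 1 / (((M + 1 : ℕ) : ℝ) ^ a * ((M + 1 : ℕ) : ℝ) ^ b) =
        1 / ((M + 1 : ℕ) : ℝ) ^ a * (1 / ((M + 1 : ℕ) : ℝ) ^ b) := by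
        rw [div_mul_div_comm, one_mul]
      rw [e5]
      linear_combination e1

theorem trunc_le : ∀ (g M : ℕ) (l : List ℕ), IsIndex l →
    trunc g M l ≤ trunc g M [1] ^ l.length := by
  intro g
  induction g with
  | zero =>
    intro M l _
    rcases l with _ | ⟨a, l⟩ <;> simp [trunc]
  | succ g ih =>
    intro M l hl
    rcases l with _ | ⟨a, l⟩
    · simp [trunc]
    · have ha : 1 ≤ a := hl a (by simp)
      have h1 := ih (M + 1) (a :: l) hl
      have h2 := ih (M + 1) l (fun y hy => hl y (List.mem_cons_of_mem _ hy))
      have h3 := trunc_nonneg g (M + 1) [1]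
      simp only [trunc, trunc_nil, List.length_cons, pow_one, mul_one] at h1 h2 ⊢
      set H := trunc g (M + 1) [1]
      set x : ℝ := ((M + 1 : ℕ) : ℝ)
      have hx : 1 ≤ x := by simp [x]
      have hxa : 1 / x ^ a ≤ 1 / x := by
        apply one_div_le_one_div_of_le (by linarith)
        exact le_self_pow₀ hx (by omega)
      have hx0 : 0 ≤ 1 / x := by positivity
      calc trunc g (M + 1) (a :: l) + 1 / x ^ a * trunc g (M + 1) l
          ≤ H ^ (l.length + 1) + 1 / x * H ^ l.length := by
            gcongr
            exact trunc_nonneg _ _ _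
        _ = (H + 1 / x) * H ^ l.length := by ring
        _ ≤ (H + 1 / x) * (H + 1 / x) ^ l.length := by
            gcongr
            linarith
        _ = (H + 1 / x) ^ (l.length + 1) := by ring

theorem trunc_succ_append : ∀ (g M : ℕ) (l : List ℕ) (a : ℕ),
    trunc (g + 1) M (l ++ [a]) =
      trunc g M (l ++ [a]) + 1 / ((M + g + 1 : ℕ) : ℝ) ^ a * trunc g M l := by
  intro g
  induction g with
  | zero =>
    intro M l a
    rcases l with _ | ⟨b, l⟩
    · simp [trunc]
    · rcases l with _ | ⟨c, l⟩ <;> simp [trunc]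
  | succ g ih =>
    intro M l a
    rcases l with _ | ⟨b, l⟩
    · have e := ih (M + 1) [] a
      simp only [List.nil_append] at e ⊢
      conv_lhs => rw [trunc, e]
      conv_rhs => enter [1]; rw [trunc]
      simp only [trunc_nil]
      rw [show M + 1 + g + 1 = M + (g + 1) + 1 by ring]
      ring
    · have e1 := ih (M + 1) (b :: l) a
      have e2 := ih (M + 1) l a
      simp only [List.cons_append] at e1 ⊢
      rw [trunc, e1, e2]
      conv_rhs => rw [trunc, trunc]
      rw [show M + 1 + g + 1 = M + (g + 1) + 1 by ring]
      ring

/-- Tuples with `M < m₁ < ⋯ < m_d ≤ M + g`. -/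
def tuples (d g M : ℕ) : Finset (Fin d → ℕ) :=
  (Fintype.piFinset fun _ => Finset.Ioc M (M + g)).filter StrictMono

theorem mem_tuples {d g M : ℕ} {m : Fin d → ℕ} :
    m ∈ tuples d g M ↔ (∀ i, M < m i ∧ m i ≤ M + g) ∧ StrictMono m := by
  simp [tuples]

theorem trunc_eq_sum : ∀ (g M : ℕ) (l : List ℕ),
    trunc g M l = ∑ m ∈ tuples l.length g M, ∏ i, 1 / ((m i : ℝ) ^ l.get i) := by
  intro g
  induction g with
  | zero =>
    intro M l
    rcases l with _ | ⟨a, l⟩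
    · have : tuples 0 0 M = Finset.univ := by
        ext m
        simp only [mem_tuples, Finset.mem_univ, iff_true]
        exact ⟨fun i => i.elim0, fun i => i.elim0⟩
      simp only [List.length_nil]
      rw [this, trunc]
      simp
    · rw [trunc, Finset.sum_eq_zero]
      intro m hm
      have := (mem_tuples.1 hm).1 ⟨0, by simp⟩
      omega
  | succ g ih =>
    intro M l
    rcases l with _ | ⟨a, l⟩
    · have : tuples 0 (g + 1) M = Finset.univ := by
        ext m
        simp only [mem_tuples, Finset.mem_univ, iff_true]
        exact ⟨fun i => i.elim0, fun i => i.elim0⟩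
      simp only [List.length_nil]
      rw [this, trunc]
      simp
    · rw [trunc, ih, ih]
      have hsplit : tuples (l.length + 1) (g + 1) M = tuples (l.length + 1) g (M + 1) ∪
          (tuples l.length g (M + 1)).image
            (fun m => (Fin.cons (M + 1) m : Fin (l.length + 1) → ℕ)) := by
        ext m
        simp only [Finset.mem_union, Finset.mem_image, mem_tuples]
        constructor
        · rintro ⟨h1, h2⟩
          by_cases h0 : m 0 = M + 1
          · right
            refine ⟨Fin.tail m, ⟨fun i => ?_, fun i j hij => h2 (Fin.succ_lt_succ_iff.2 hij)⟩, ?_⟩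
            · have := h1 i.succ
              have h3 := h2 (Fin.succ_pos i)
              simp only [Fin.tail]
              omega
            · rw [← h0]
              exact Fin.cons_self_tail m
          · left
            refine ⟨fun i => ?_, h2⟩
            have h3 := h1 i
            have h4 := h1 0
            have h5 := h2.monotone (Fin.zero_le i)
            omega
        · rintro (⟨h1, h2⟩ | ⟨t, ⟨h1, h2⟩, rfl⟩)
          · refine ⟨fun i => ?_, h2⟩
            have := h1 i
            omega
          · refine ⟨fun i => ?_, ?_⟩
            · refine Fin.cases ?_ (fun i => ?_) i
              · simp
              · have := h1 i
                simp only [Fin.cons_succ]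
                omega
            · intro i j
              refine Fin.cases ?_ (fun i => ?_) i
              · refine Fin.cases ?_ (fun j => ?_) j
                · simp
                · intro _
                  simpa using (h1 j).1
              · refine Fin.cases ?_ (fun j => ?_) j
                · simp
                · intro hij
                  simpa using h2 (Fin.succ_lt_succ_iff.1 hij)
      have hdisj : Disjoint (tuples (l.length + 1) g (M + 1))
          ((tuples l.length g (M + 1)).image
            (fun m => (Fin.cons (M + 1) m : Fin (l.length + 1) → ℕ))) := by
        rw [Finset.disjoint_left]
        rintro m hm hm'
        obtain ⟨t, -, rfl⟩ := Finset.mem_image.1 hm'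
        have := (mem_tuples.1 hm).1 0
        simp at this
      simp only [List.length_cons]
      rw [hsplit, Finset.sum_union hdisj, Finset.sum_image]
      · rw [Finset.mul_sum]
        congr 1
        apply Finset.sum_congr rfl
        intro m _
        rw [Fin.prod_univ_succ]
        simp
      · intro x _ y _ h
        exact (Fin.cons_injective2 h).2

theorem trunc_one_eq (N : ℕ) : trunc N 0 [1] = (harmonic N : ℝ) := by
  induction N with
  | zero => simp [trunc]
  | succ N ih =>
    have := trunc_succ_append N 0 [] 1
    simp only [List.nil_append] at this
    rw [this, ih, harmonic_succ, trunc_nil]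
    push_cast
    simp

theorem summable_harmonic (p : ℕ) :
    Summable fun n : ℕ => 1 / ((n + 1 : ℕ) : ℝ) ^ 2 * (harmonic n : ℝ) ^ p := by
  have hlog : (fun x : ℝ => (1 + Real.log x) ^ p) =o[atTop] fun x : ℝ => x ^ (1 / 2 : ℝ) := by
    have h1 : (fun x : ℝ => 1 + Real.log x) =O[atTop] Real.log := by
      apply Asymptotics.IsBigO.add
      · exact (Real.isLittleO_const_log_atTop (c := 1)).isBigO
      · exact Asymptotics.isBigO_refl _ _
    refine (h1.pow p).trans_isLittleO ?_
    have := isLittleO_log_rpow_rpow_atTop (p : ℝ) (show (0 : ℝ) < 1 / 2 by norm_num)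
    simpa using this
  have hb := (hlog.comp_tendsto (tendsto_natCast_atTop_atTop (R := ℝ))).isBigO
  have hs : Summable fun n : ℕ => 1 / (n : ℝ) ^ (3 / 2 : ℝ) :=
    Real.summable_one_div_nat_rpow.2 (by norm_num)
  refine summable_of_isBigO_nat hs ?_
  obtain ⟨C, hC⟩ := hb.bound
  refine Asymptotics.IsBigO.of_bound C ?_
  filter_upwards [hC, eventually_ge_atTop 1] with n hn hn1
  have hn0 : (0 : ℝ) < n := by exact_mod_cast hn1
  have hh0 : (0 : ℝ) ≤ harmonic n := by
    rw [← trunc_one_eq]; exact trunc_nonneg _ _ _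
  have hh : (harmonic n : ℝ) ≤ 1 + Real.log n := harmonic_le_one_add_log n
  simp only [Function.comp_apply, Real.norm_eq_abs] at hn
  rw [abs_of_nonneg (pow_nonneg (hh0.trans hh) p), abs_of_nonneg (by positivity)] at hn
  rw [Real.norm_of_nonneg (by positivity), Real.norm_of_nonneg (by positivity)]
  calc 1 / ((n + 1 : ℕ) : ℝ) ^ 2 * (harmonic n : ℝ) ^ p
      ≤ 1 / (n : ℝ) ^ 2 * (C * (n : ℝ) ^ (1 / 2 : ℝ)) := by
        gcongr
        · simp
        · exact (pow_le_pow_left₀ hh0 hh p).trans hn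
    _ = C * (1 / (n : ℝ) ^ (3 / 2 : ℝ)) := by
        have : (n : ℝ) ^ 2 = (n : ℝ) ^ (3 / 2 : ℝ) * (n : ℝ) ^ (1 / 2 : ℝ) := by
          rw [← Real.rpow_add hn0, ← Real.rpow_natCast]
          norm_num
        rw [this]
        have h1 : (n : ℝ) ^ (1 / 2 : ℝ) ≠ 0 := by positivity
        have h2 : (n : ℝ) ^ (3 / 2 : ℝ) ≠ 0 := by positivity
        field_simp

/-- `x` agrees with the polynomial `P` in the harmonic numbers, up to a very small error. -/
def Asymp (x : ℕ → ℝ) (P : Polynomial ℝ) : Prop :=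
  ∀ J : ℕ, Tendsto (fun N => (harmonic N : ℝ) ^ J * (x N - P.eval (harmonic N : ℝ))) atTop (𝓝 0)

theorem tendsto_harmonic : Tendsto (fun N => (harmonic N : ℝ)) atTop atTop := by
  refine tendsto_atTop_mono (fun n => log_add_one_le_harmonic n) ?_
  exact Real.tendsto_log_atTop.comp
    (tendsto_natCast_atTop_atTop.comp (tendsto_add_atTop_nat 1))

theorem Asymp.unique {x : ℕ → ℝ} {P Q : Polynomial ℝ} (hP : Asymp x P) (hQ : Asymp x Q) :
    P = Q := by
  have h : Tendsto (fun N => (P - Q).eval (harmonic N : ℝ)) atTop (𝓝 0) := by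
    have := (hQ 0).sub (hP 0)
    simpa using this
  by_contra hne
  have hne' : P - Q ≠ 0 := sub_ne_zero.2 hne
  by_cases hd : 0 < (P - Q).degree
  · have h1 := (Polynomial.abs_tendsto_atTop (P - Q) hd).comp tendsto_harmonic
    have h2 := h.abs
    exact not_tendsto_nhds_of_tendsto_atTop h1 _ h2
  · have h1 := Polynomial.eq_C_of_degree_le_zero (not_lt.1 hd)
    rw [h1] at h
    simp only [Polynomial.eval_C] at h
    have h2 := tendsto_nhds_unique h tendsto_const_nhds
    apply hne'
    rw [h1, ← h2, Polynomial.C_0]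

theorem Asymp.add {x y : ℕ → ℝ} {P Q : Polynomial ℝ} (hP : Asymp x P) (hQ : Asymp y Q) :
    Asymp (fun N => x N + y N) (P + Q) := by
  intro J
  have := (hP J).add (hQ J)
  rw [add_zero] at this
  refine this.congr fun N => ?_
  rw [Polynomial.eval_add]
  ring

theorem Asymp.const_mul {x : ℕ → ℝ} {P : Polynomial ℝ} (hP : Asymp x P) (c : ℝ) :
    Asymp (fun N => c * x N) (Polynomial.C c * P) := by
  intro J
  have := (hP J).const_mul c
  rw [mul_zero] at this
  refine this.congr fun N => ?_
  rw [Polynomial.eval_mul, Polynomial.eval_C]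
  ring

theorem Asymp.poly_mul {x : ℕ → ℝ} {P : Polynomial ℝ} (hP : Asymp x P) (Q : Polynomial ℝ) (J : ℕ) :
    Tendsto (fun N => (harmonic N : ℝ) ^ J * (Q.eval (harmonic N : ℝ) *
      (x N - P.eval (harmonic N : ℝ)))) atTop (𝓝 0) := by
  induction Q using Polynomial.induction_on' with
  | add Q R h1 h2 =>
    have := h1.add h2
    rw [add_zero] at this
    refine this.congr fun N => ?_
    rw [Polynomial.eval_add]
    ring
  | monomial n a =>
    have := (hP (J + n)).const_mul a
    rw [mul_zero] at this
    refine this.congr fun N => ?_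
    rw [Polynomial.eval_monomial, pow_add]
    ring

theorem Asymp.mul {x y : ℕ → ℝ} {P Q : Polynomial ℝ} (hP : Asymp x P) (hQ : Asymp y Q) :
    Asymp (fun N => x N * y N) (P * Q) := by
  intro J
  have h1 := (hP J).mul (hQ 0)
  have h2 := (hP.poly_mul Q J).add (hQ.poly_mul P J)
  have := h1.add h2
  simp only [mul_zero, add_zero] at this
  refine this.congr fun N => ?_
  rw [Polynomial.eval_mul]
  ring

theorem Asymp.list_sum {L : List (List ℕ)} {f : List ℕ → ℕ → ℝ} {P : List ℕ → Polynomial ℝ}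
    (h : ∀ k ∈ L, Asymp (f k) (P k)) :
    Asymp (fun N => (L.map fun k => f k N).sum) (L.map P).sum := by
  induction L with
  | nil => intro J; simp
  | cons k L ih =>
    simp only [List.map_cons, List.sum_cons]
    exact (h k (by simp)).add (ih fun k hk => h k (List.mem_cons_of_mem _ hk))

theorem asymp_one : Asymp (fun N => trunc N 0 [1]) Polynomial.X := by
  intro J
  simp [trunc_one_eq]

theorem admissible_cases {k : List ℕ} (hk : IsAdmissible k) :
    k = [] ∨ ∃ l a, k = l ++ [a] ∧ IsIndex l ∧ 2 ≤ a := by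
  rcases List.eq_nil_or_concat k with rfl | ⟨v, a, rfl⟩
  · left; rfl
  · right
    refine ⟨v, a, by simp, fun x hx => hk.1 x (by simp [hx]), hk.2 a (by simp)⟩

theorem tail_admissible {l : List ℕ} {a : ℕ} (hl : IsIndex l) (ha : 2 ≤ a) (n : ℕ) :
    trunc (n + 1) 0 (l ++ [a]) - trunc n 0 (l ++ [a]) ≤
      1 / ((n + 1 : ℕ) : ℝ) ^ 2 * (harmonic n : ℝ) ^ l.length := by
  rw [trunc_succ_append, add_sub_cancel_left, zero_add]
  have h1 := trunc_le n 0 l hl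
  rw [trunc_one_eq] at h1
  gcongr
  · exact trunc_nonneg _ _ _
  · simp

theorem tail_nonneg (l : List ℕ) (a n : ℕ) :
    0 ≤ trunc (n + 1) 0 (l ++ [a]) - trunc n 0 (l ++ [a]) := by
  rw [trunc_succ_append, add_sub_cancel_left]
  have := trunc_nonneg n 0 l
  positivity

theorem summable_tail {l : List ℕ} {a : ℕ} (hl : IsIndex l) (ha : 2 ≤ a) :
    Summable fun n => trunc (n + 1) 0 (l ++ [a]) - trunc n 0 (l ++ [a]) :=
  Summable.of_nonneg_of_le (tail_nonneg l a) (tail_admissible hl ha)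
    (summable_harmonic _)

theorem sum_tail (l : List ℕ) (a N : ℕ) :
    ∑ n ∈ Finset.range N, (trunc (n + 1) 0 (l ++ [a]) - trunc n 0 (l ++ [a])) =
      trunc N 0 (l ++ [a]) := by
  rw [Finset.sum_range_sub fun n => trunc n 0 (l ++ [a])]
  have : trunc 0 0 (l ++ [a]) = 0 := by cases l <;> simp [trunc]
  rw [this, sub_zero]

theorem trunc_bounded {k : List ℕ} (hk : IsAdmissible k) : ∃ C, ∀ N, trunc N 0 k ≤ C := by
  rcases admissible_cases hk with rfl | ⟨l, a, rfl, hl, ha⟩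
  · exact ⟨1, fun N => by rw [trunc_nil]⟩
  · refine ⟨∑' n, (trunc (n + 1) 0 (l ++ [a]) - trunc n 0 (l ++ [a])), fun N => ?_⟩
    rw [← sum_tail]
    exact (summable_tail hl ha).sum_le_tsum _ (fun n _ => tail_nonneg l a n)

/-- The tuples of `tuples d N 0`, as elements of the index set of the series. -/
def posTuples (d N : ℕ) : Finset {m : Fin d → ℕ // StrictMono m ∧ ∀ i, 0 < m i} :=
  (tuples d N 0).subtype _

theorem trunc_eq_sum_posTuples (N : ℕ) (k : List ℕ) :
    trunc N 0 k = ∑ m ∈ posTuples k.length N, ∏ i, 1 / ((m.1 i : ℝ) ^ k.get i) := by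
  rw [trunc_eq_sum, posTuples]
  refine (Finset.sum_subtype_of_mem (p := fun m : Fin k.length → ℕ => StrictMono m ∧ ∀ i, 0 < m i)
    (fun m : Fin k.length → ℕ => ∏ i, 1 / ((m i : ℝ) ^ k.get i)) ?_).symm
  intro m hm
  have := mem_tuples.1 hm
  exact ⟨this.2, fun i => (this.1 i).1⟩

theorem tendsto_posTuples (d : ℕ) : Tendsto (posTuples d) atTop atTop := by
  apply tendsto_atTop_finset_of_monotone
  · intro N N' h m hm
    simp only [posTuples, Finset.mem_subtype, mem_tuples] at hm ⊢
    exact ⟨fun i => ⟨(hm.1 i).1, by have := (hm.1 i).2; omega⟩, hm.2⟩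
  · intro m
    refine ⟨∑ i, m.1 i, ?_⟩
    simp only [posTuples, Finset.mem_subtype, mem_tuples]
    refine ⟨fun i => ⟨m.2.2 i, ?_⟩, m.2.1⟩
    rw [zero_add]
    exact Finset.single_le_sum (f := m.1) (fun _ _ => Nat.zero_le _) (Finset.mem_univ i)

/-- The series defining `ζ(k)` converges for admissible `k`. -/
theorem summable_zeta {k : List ℕ} (hk : IsAdmissible k) :
    Summable fun m : {m : Fin k.length → ℕ // StrictMono m ∧ ∀ i, 0 < m i} =>
      ∏ i, 1 / ((m.1 i : ℝ) ^ k.get i) := by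
  obtain ⟨C, hC⟩ := trunc_bounded hk
  refine summable_of_sum_le (c := C) (fun m => Finset.prod_nonneg fun i _ => by positivity) ?_
  intro s
  obtain ⟨N, hN⟩ := ((tendsto_posTuples k.length).eventually_ge_atTop s).exists
  refine le_trans ?_ (hC N)
  rw [trunc_eq_sum_posTuples]
  exact Finset.sum_le_sum_of_subset_of_nonneg hN
    fun m _ _ => Finset.prod_nonneg fun i _ => by positivity

theorem tendsto_trunc {k : List ℕ} (hk : IsAdmissible k) :
    Tendsto (fun N => trunc N 0 k) atTop (𝓝 (zeta k)) := by
  have := (summable_zeta hk).hasSum.comp (tendsto_posTuples k.length)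
  refine this.congr fun N => ?_
  rw [trunc_eq_sum_posTuples]
  rfl

theorem asymp_admissible {k : List ℕ} (hk : IsAdmissible k) :
    Asymp (fun N => trunc N 0 k) (Polynomial.C (zeta k)) := by
  have ht := tendsto_trunc hk
  rcases admissible_cases hk with rfl | ⟨l, a, rfl, hl, ha⟩
  · have : zeta [] = 1 := by
      refine tendsto_nhds_unique ht ?_
      simp [trunc_nil]
    intro J
    simp [this, trunc_nil]
  · intro J
    set δ : ℕ → ℝ := fun n => trunc (n + 1) 0 (l ++ [a]) - trunc n 0 (l ++ [a]) with hδ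
    have hs : Summable δ := summable_tail hl ha
    have hz : zeta (l ++ [a]) = ∑' n, δ n := by
      refine tendsto_nhds_unique ht ?_
      refine hs.hasSum.tendsto_sum_nat.congr fun N => ?_
      exact sum_tail l a N
    have hg := summable_harmonic (J + l.length)
    set G : ℕ → ℝ := fun n => 1 / ((n + 1 : ℕ) : ℝ) ^ 2 * (harmonic n : ℝ) ^ (J + l.length) with hG
    have hG0 : Tendsto (fun N => ∑' n, G (n + N)) atTop (𝓝 0) := tendsto_sum_nat_add G
    have hh0 : ∀ n, (0 : ℝ) ≤ harmonic n := fun n => by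
      rw [← trunc_one_eq]; exact trunc_nonneg _ _ _
    have hmono : Monotone fun n => (harmonic n : ℝ) := by
      apply monotone_nat_of_le_succ
      intro n
      rw [harmonic_succ]
      push_cast
      have : (0 : ℝ) ≤ ((n : ℝ) + 1)⁻¹ := by positivity
      linarith
    rw [tendsto_zero_iff_abs_tendsto_zero]
    refine squeeze_zero (fun _ => abs_nonneg _) ?_ hG0
    intro N
    have hsplit := hs.sum_add_tsum_nat_add N
    have hsum : ∑ n ∈ Finset.range N, δ n = trunc N 0 (l ++ [a]) := sum_tail l a N
    have hdiff : trunc N 0 (l ++ [a]) - zeta (l ++ [a]) = -∑' n, δ (n + N) := by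
      rw [hz, ← hsplit, hsum]
      ring
    have hd0 : 0 ≤ ∑' n, δ (n + N) := tsum_nonneg fun n => tail_nonneg l a _
    simp only [Function.comp_apply, Polynomial.eval_C]
    rw [hdiff, abs_mul, abs_neg, abs_of_nonneg hd0, abs_of_nonneg (pow_nonneg (hh0 N) J),
      ← tsum_mul_left]
    refine Summable.tsum_le_tsum (fun n => ?_)
      (((summable_nat_add_iff N).2 hs).mul_left _) ((summable_nat_add_iff N).2 hg)
    have h1 : δ (n + N) ≤ _ := tail_admissible hl ha (n + N)
    have h2 : (harmonic N : ℝ) ^ J ≤ (harmonic (n + N) : ℝ) ^ J :=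
      pow_le_pow_left₀ (hh0 N) (hmono (by omega)) J
    calc (harmonic N : ℝ) ^ J * δ (n + N)
        ≤ (harmonic (n + N) : ℝ) ^ J *
          (1 / ((n + N + 1 : ℕ) : ℝ) ^ 2 * (harmonic (n + N) : ℝ) ^ l.length) := by
          apply mul_le_mul h2 h1 (tail_nonneg l a _) (pow_nonneg (hh0 _) J)
      _ = G (n + N) := by
          simp only [hG]
          ring

theorem exists_asymp (k : List ℕ) (hk : IsIndex k) :
    ∃ P : Polynomial ℝ, Asymp (fun N => trunc N 0 k) P := by
  refine induction_trail (P := fun k => ∃ P : Polynomial ℝ, Asymp (fun N => trunc N 0 k) P)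
    (fun k hk => ⟨_, asymp_admissible hk⟩) ?_ k hk
  rintro v hv ⟨P, hP⟩ hx
  choose! Q hQ using hx
  have hc : ((stuffle [1] v).count (v ++ [1]) : ℝ) ≠ 0 := by
    have := List.count_pos_iff.2 (mem_stuffle_one v)
    positivity
  have h := ((asymp_one.mul hP).add ((Asymp.list_sum hQ).const_mul (-1))).const_mul
    ((stuffle [1] v).count (v ++ [1]) : ℝ)⁻¹
  have e : ∀ N, ((stuffle [1] v).count (v ++ [1]) : ℝ)⁻¹ * (trunc N 0 [1] * trunc N 0 v +
      -1 * (((stuffle [1] v).filter (· ≠ v ++ [1])).map fun k => trunc N 0 k).sum) =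
      trunc N 0 (v ++ [1]) := by
    intro N
    rw [trunc_mul, sum_stuffle_one]
    field_simp
    ring
  exact ⟨_, (funext e) ▸ h⟩

theorem exists_stuffleRegularization : ∃ Z, IsStuffleRegularization Z := by
  choose! P hP using exists_asymp
  refine ⟨fun k => (P k).eval 0, ⟨?_, ?_, ?_⟩⟩
  · intro k hk
    rw [(hP k hk.1).unique (asymp_admissible hk), Polynomial.eval_C]
  · rw [(hP [1] isIndex_one).unique asymp_one, Polynomial.eval_X]
  · intro u v hu hv
    have h1 := (hP u hu).mul (hP v hv)
    have h2 : Asymp (fun N => ((stuffle u v).map fun k => trunc N 0 k).sum)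
        ((stuffle u v).map P).sum :=
      Asymp.list_sum (f := fun k N => trunc N 0 k)
        fun k hk => hP k (isIndex_stuffle u v k hu hv hk)
    have h3 : P u * P v = ((stuffle u v).map P).sum := by
      refine Asymp.unique h1 ?_
      intro J
      refine (h2 J).congr fun N => ?_
      simp only [trunc_mul]
    have h4 := congrArg (Polynomial.evalRingHom (0 : ℝ)) h3
    rw [map_mul, map_list_sum, List.map_map] at h4
    exact h4

/-! ### Regularized values -/

/-- The stuffle regularized multiple zeta value `ζ^*(k₁, …, k_d)`: the value of the unique stuffle
regularization. -/
def zetaReg : List ℕ → ℝ := Classical.choose exists_stuffleRegularization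

theorem isStuffleRegularization_zetaReg : IsStuffleRegularization zetaReg :=
  Classical.choose_spec exists_stuffleRegularization

/-- The sequences obtained from `(k, l₁, l₂, …)` by replacing each comma by a comma or a plus. -/
def mergingsAux : ℕ → List ℕ → List (List ℕ)
  | k, [] => [[k]]
  | k, l :: ls => (mergingsAux l ls).map (k :: ·) ++ mergingsAux (k + l) ls

/-- The sequences `k₁ □₁ ⋯ □_{d-1} k_d`, with each `□_j` a comma or a plus
(only the empty sequence if `d = 0`). -/
def mergings : List ℕ → List (List ℕ)
  | [] => [[]]
  | k :: l => mergingsAux k l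

/-- The stuffle regularized multiple zeta star value `ζ^{⋆,*}(k₁, …, k_d)`. -/
def zetaStarReg (k : List ℕ) : ℝ := ((mergings k).map zetaReg).sum

/-- `ζ_a^*(k₁, …, k_d) = (-1)^a ∑_{a₁ + ⋯ + a_d = a} ζ^*(k₁ + a₁, …, k_d + a_d)
∏_j binom(k_j - 1 + a_j, a_j)`. -/
def zetaRegCoeff (a : ℕ) (k : List ℕ) : ℝ :=
  (-1) ^ a * ∑ v ∈ Finset.piAntidiag (Finset.univ : Finset (Fin k.length)) a,
    zetaReg (List.ofFn fun t => k.get t + v t) *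
      ∏ t, (Nat.choose (k.get t - 1 + v t) (v t) : ℝ)

/-- The segment `(k_p, k_{p+1}, …, k_q)` of a sequence, empty if `q < p`. -/
def seg (k : ℕ → ℕ) (p q : ℕ) : List ℕ := (List.range' p (q + 1 - p)).map k

end

end MZV

/-! The source of the formula is the partial fraction expansion of the rational function of z given
by the nested sum of ∏ (z + μ_j)^(-k_j) over 0 ≤ μ_1 < ⋯ < μ_d < M. Its poles are the points -ν with
ν < M. Near z = -ν the summation points become negative, zero or positive. If no variable sits at
zero, one gets a product of a reversed signed sum over a prefix of k with a sum over the
complementary suffix. If the j-th variable sits at zero, one gets a pole of order k_j times Taylor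
series of the sums on either side (`coeff_wsum_pole`). A proper rational function is the sum of its
principal parts, so its constant term at the middle pole -N, for M = 2N + 1, is the sum of the other
principal parts evaluated there (`conv_add_polar_zero`).

Now let N tend to infinity. The suffix sums converge because k is admissible; the reversed prefix
sums may diverge like powers of the harmonic number. Functions on words form an algebra under
`conv`, and multiplication by the exponential `expOne` of a harmonic number turns truncated sums
into approximations of the stuffle regularized values (`regTrunc_sub_zetaReg_le`). The coefficients
at -ν then tend to limits independent of ν (`zetaPolar`). Summing (ν - N)^(-n) symmetrically over ν
≠ N leaves 2ζ(n) for even n, hence Bernoulli numbers and powers of π, and nothing for odd n. Simple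
poles would spoil the error estimate, but their limiting coefficients vanish because all residues
sum to zero (`zetaPolar_one_eq_zero`). The outcome is `conv_add_sum_cotCoeff`, a relation for the
convolution product of Y and ζ^*, where Y is ζ^* reversed with the sign of the weight.

The factor Y is removed by inverting it. The antipode of the stuffle algebra (`sum_zetaStarReg_mul`)
says that the convolution inverse of Y is ζ^{⋆,*} with sign (-1)^(depth + weight). Multiplying by it
isolates ζ(k) on one side and (-1)^(d + weight) ζ^⋆(k) plus products on the other
(`zetaReg_parity`). For odd d + weight the sign is -1, and averaging with ζ(k) = ζ(k) gives the
theorem. -/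

namespace MZV

open Filter Topology Finset
open scoped LaurentSeries

/-! ### Convolution of functions on words -/

section Conv

variable {K : Type*} [CommRing K]

/-- The convolution product dual to deconcatenation. -/
def conv (f g : List ℕ → K) (k : List ℕ) : K :=
  ∑ p ∈ range (k.length + 1), f (k.take p) * g (k.drop p)

theorem conv_nil (f g : List ℕ → K) : conv f g [] = f [] * g [] := by simp [conv]

theorem conv_cons (f g : List ℕ → K) (a : ℕ) (l : List ℕ) :
    conv f g (a :: l) = f [] * g (a :: l) + conv (fun w => f (a :: w)) g l := by
  rw [conv, List.length_cons, sum_range_succ']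
  simp [conv, add_comm]

theorem conv_add_left (f f' g : List ℕ → K) (k : List ℕ) :
    conv (fun w => f w + f' w) g k = conv f g k + conv f' g k := by
  simp [conv, add_mul, sum_add_distrib]

theorem conv_mul_left (c : K) (f g : List ℕ → K) (k : List ℕ) :
    conv (fun w => c * f w) g k = c * conv f g k := by
  simp only [conv, mul_sum, mul_assoc]

theorem conv_congr_left {f f' : List ℕ → K} (g : List ℕ → K) (k : List ℕ)
    (h : ∀ p, f (k.take p) = f' (k.take p)) : conv f g k = conv f' g k := by
  simp only [conv, h]

theorem conv_congr_right (f : List ℕ → K) {g g' : List ℕ → K} (k : List ℕ)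
    (h : ∀ p, g (k.drop p) = g' (k.drop p)) : conv f g k = conv f g' k := by
  simp only [conv, h]

theorem conv_zero_left (g : List ℕ → K) (k : List ℕ) : conv (fun _ => 0) g k = 0 := by
  simp [conv]

/-- Both sides sum over the ways to cut the word into three consecutive pieces. The induction peels
the first letter, which is why `f` and `g` are generalized. -/
theorem conv_assoc (f g h : List ℕ → K) (k : List ℕ) :
    conv (conv f g) h k = conv f (conv g h) k := by
  induction k generalizing f g with
  | nil => simp only [conv_nil, mul_assoc]
  | cons a l ih =>
    have e : (fun w => conv f g (a :: w)) =
        fun w => f [] * g (a :: w) + conv (fun w => f (a :: w)) g w :=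
      funext fun w => conv_cons f g a w
    rw [conv_cons, e, conv_add_left, conv_mul_left, conv_cons f, conv_cons g, ih, conv_nil]
    ring

theorem conv_snoc (f g : List ℕ → K) (l : List ℕ) (a : ℕ) :
    conv f g (l ++ [a]) = conv f (fun w => g (w ++ [a])) l + f (l ++ [a]) * g [] := by
  simp only [conv, List.length_append, List.length_singleton]
  rw [sum_range_succ]
  congr 1
  · refine sum_congr rfl fun p hp => ?_
    have hp' : p ≤ l.length := by simpa [Nat.lt_succ_iff] using hp
    rw [List.take_append_of_le_length hp', List.drop_append_of_le_length hp']
  · rw [List.take_of_length_le (by simp), List.drop_eq_nil_of_le (by simp)]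

/-- Reversal exchanges prefixes and suffixes, so it is an anti-automorphism. -/
theorem conv_comp_reverse (f g : List ℕ → K) (k : List ℕ) :
    conv f g k.reverse = conv (fun w => g w.reverse) (fun w => f w.reverse) k := by
  induction k generalizing f g with
  | nil => simp [conv_nil, mul_comm]
  | cons a l ih =>
    rw [List.reverse_cons, conv_snoc, ih, conv_cons]
    simp [add_comm, mul_comm]

/-! ### Nested sums over lists of points -/

/-- The nested sum over increasing subsequences of a list of points, each point `x` being given by
the weights `a ↦ x ^ (-a)`. -/
def wsum : List (ℕ → K) → List ℕ → K
  | _, [] => 1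
  | [], _ :: _ => 0
  | φ :: φs, a :: l => wsum φs (a :: l) + φ a * wsum φs l

theorem wsum_nil (φs : List (ℕ → K)) : wsum φs [] = 1 := by cases φs <;> rfl

theorem wsum_cons (φ : ℕ → K) (φs : List (ℕ → K)) (a : ℕ) (l : List ℕ) :
    wsum (φ :: φs) (a :: l) = wsum φs (a :: l) + φ a * wsum φs l := rfl

theorem wsum_empty (a : ℕ) (l : List ℕ) : wsum ([] : List (ℕ → K)) (a :: l) = 0 := rfl

/-- A single point carries at most one summation variable, so `wsum [φ]` vanishes on words of length
at least two and only two terms of the convolution survive. -/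
theorem wsum_cons_eq_conv (φ : ℕ → K) (φs : List (ℕ → K)) (k : List ℕ) :
    wsum (φ :: φs) k = conv (wsum [φ]) (wsum φs) k := by
  rcases k with _ | ⟨a, l⟩
  · simp [conv_nil, wsum_nil]
  · rw [conv_cons, wsum_nil, one_mul, wsum_cons]
    congr 1
    rcases l with _ | ⟨b, l⟩
    · simp [conv_nil, wsum_nil, wsum_cons, wsum_empty]
    · have : (fun w => wsum [φ] (a :: b :: w)) = fun _ => (0 : K) := by
        funext w
        simp [wsum_cons, wsum_empty]
      rw [conv_cons, this, conv_zero_left]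
      simp [wsum_cons, wsum_empty, wsum_nil]

/-- An increasing subsequence of a concatenated list first runs through the left part and then
through the right part, which cuts the word once. -/
theorem wsum_append (φs ψs : List (ℕ → K)) (k : List ℕ) :
    wsum (φs ++ ψs) k = conv (wsum φs) (wsum ψs) k := by
  induction φs generalizing k with
  | nil =>
    rcases k with _ | ⟨a, l⟩
    · simp [conv_nil, wsum_nil]
    · rw [conv_cons, wsum_nil, one_mul]
      simp only [wsum_empty, conv_zero_left, add_zero, List.nil_append]
  | cons φ φs ih =>
    have e : wsum (φ :: φs) = conv (wsum [φ]) (wsum φs) := funext (wsum_cons_eq_conv φ φs)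
    rw [List.cons_append, wsum_cons_eq_conv, e, conv_assoc]
    exact conv_congr_right _ _ fun p => ih _

theorem map_wsum {L : Type*} [CommRing L] (F : K →+* L) (φs : List (ℕ → K)) (k : List ℕ) :
    F (wsum φs k) = wsum (φs.map fun φ a => F (φ a)) k := by
  induction φs generalizing k with
  | nil => rcases k with _ | ⟨a, l⟩ <;> simp [wsum]
  | cons φ φs ih =>
    rcases k with _ | ⟨a, l⟩
    · simp [wsum]
    · simp [wsum_cons, ih]

theorem wsum_single_conv (φ : ℕ → K) (g : List ℕ → K) (k : List ℕ) :
    conv (wsum [φ]) g k = g k + if k = [] then 0 else φ (k.getD 0 0) * g (k.drop 1) := by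
  rcases k with _ | ⟨a, l⟩
  · simp [conv_nil, wsum_nil]
  · rw [conv_cons, wsum_nil, one_mul]
    congr 1
    rcases l with _ | ⟨b, l⟩
    · simp [conv_nil, wsum_nil, wsum_cons, wsum_empty]
    · have : (fun w => wsum [φ] (a :: b :: w)) = fun _ => (0 : K) := by
        funext w
        simp [wsum_cons, wsum_empty]
      rw [conv_cons, this, conv_zero_left]
      simp [wsum_cons, wsum_empty, wsum_nil]

/-- Splitting a nested sum at a point. -/
theorem wsum_split (φs ψs : List (ℕ → K)) (φ : ℕ → K) (k : List ℕ) :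
    wsum (φs ++ φ :: ψs) k = conv (wsum φs) (wsum ψs) k +
      ∑ j ∈ range k.length, wsum φs (k.take j) * φ (k.getD j 0) * wsum ψs (k.drop (j + 1)) := by
  have e : wsum (φ :: ψs) = conv (wsum [φ]) (wsum ψs) := funext (wsum_cons_eq_conv φ ψs)
  rw [wsum_append, e]
  have e' : ∀ p ∈ range (k.length + 1), wsum φs (k.take p) * conv (wsum [φ]) (wsum ψs) (k.drop p) =
      wsum φs (k.take p) * wsum ψs (k.drop p) + if p = k.length then 0 else
        wsum φs (k.take p) * φ (k.getD p 0) * wsum ψs (k.drop (p + 1)) := by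
    intro p hp
    rw [mem_range] at hp
    rw [wsum_single_conv, mul_add]
    congr 1
    by_cases h : p = k.length
    · simp [h]
    · rw [if_neg (by simp; omega), if_neg h]
      simp [mul_assoc]
  rw [conv, sum_congr rfl e', sum_add_distrib, conv]
  congr 1
  rw [sum_range_succ, if_pos rfl, add_zero]
  refine sum_congr rfl fun j hj => ?_
  rw [if_neg (mem_range.1 hj).ne]

end Conv

theorem trunc_eq_wsum (g M : ℕ) (k : List ℕ) : trunc g M k =
    wsum ((List.range g).map fun (i a : ℕ) => ((((M + 1 + i : ℕ) : ℝ)) ^ a)⁻¹) k := by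
  induction g generalizing M k with
  | zero => rcases k with _ | ⟨a, l⟩ <;> simp [trunc, wsum]
  | succ g ih =>
    rcases k with _ | ⟨a, l⟩
    · simp [trunc, wsum_nil]
    · rw [trunc, ih, ih, List.range_succ_eq_map, List.map_cons, wsum_cons, List.map_map]
      have : ((fun (i a : ℕ) => ((((M + 1 + i : ℕ) : ℝ)) ^ a)⁻¹) ∘ Nat.succ) =
          fun (i a : ℕ) => ((((M + 1 + 1 + i : ℕ) : ℝ)) ^ a)⁻¹ := by
        funext i a
        simp only [Function.comp_apply]
        congr 3
        omega
      rw [this]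
      simp

/-- The anti-automorphism of the convolution algebra given by reversal and sign change. -/
noncomputable def signRev (f : List ℕ → ℝ) (k : List ℕ) : ℝ := (-1) ^ k.sum * f k.reverse

theorem signRev_conv (f g : List ℕ → ℝ) (k : List ℕ) :
    signRev (conv f g) k = conv (signRev g) (signRev f) k := by
  rw [signRev, conv_comp_reverse, conv, conv, mul_sum]
  refine sum_congr rfl fun p _ => ?_
  have h : k.sum = (k.take p).sum + (k.drop p).sum := by rw [List.sum_take_add_sum_drop]
  rw [signRev, signRev, h, pow_add]
  ring

/-- The points are -A, …, -1. Negating them reverses their order and contributes the sign of the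
weight. In the induction the first point -(A + 1) corresponds to the largest summation index, which
`trunc_succ_append` splits off. -/
theorem wsum_neg_eq_signRev (A : ℕ) (k : List ℕ) :
    wsum ((List.range A).map fun (i a : ℕ) => (((i : ℝ) - A) ^ a)⁻¹) k =
      signRev (trunc A 0) k := by
  induction A generalizing k with
  | zero =>
    rcases k with _ | ⟨a, l⟩
    · simp [signRev, wsum_nil, trunc]
    · rw [signRev]
      have : trunc 0 0 (a :: l).reverse = 0 := by
        rw [List.reverse_cons]
        cases l.reverse <;> simp [trunc]
      rw [this]; simp [wsum]
  | succ A ih =>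
    rcases k with _ | ⟨a, l⟩
    · simp [signRev, wsum_nil, trunc_nil]
    · rw [List.range_succ_eq_map, List.map_cons, wsum_cons, List.map_map]
      have : ((fun (i a : ℕ) => (((i : ℝ) - (A + 1 : ℕ)) ^ a)⁻¹) ∘ Nat.succ) =
          fun (i a : ℕ) => (((i : ℝ) - A) ^ a)⁻¹ := by
        funext i a
        simp
      rw [this, ih, ih, signRev, signRev, signRev, List.reverse_cons, trunc_succ_append,
        List.sum_cons]
      have h : (((0 : ℕ) : ℝ) - (A + 1 : ℕ)) ^ a = (-1) ^ a * (((0 + A + 1 : ℕ)) : ℝ) ^ a := by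
        rw [← mul_pow]
        congr 1
        push_cast
        ring
      have h2 : ((-1 : ℝ) ^ a)⁻¹ = (-1) ^ a := by rw [← inv_pow]; norm_num
      rw [h, mul_inv, h2, pow_add]
      ring

/-! ### Truncated sums over all-ones words -/

/-- The exponential of `h` times the dual of the letter `1`. -/
noncomputable def expOne (h : ℝ) (k : List ℕ) : ℝ :=
  if ∀ x ∈ k, x = 1 then h ^ k.length / (k.length.factorial : ℝ) else 0

theorem expOne_nil (h : ℝ) : expOne h [] = 1 := by simp [expOne]

theorem expOne_ne (h : ℝ) {k : List ℕ} (hk : ∃ x ∈ k, x ≠ 1) : expOne h k = 0 := by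
  rw [expOne, if_neg]
  push Not
  exact hk

theorem expOne_replicate (h : ℝ) (n : ℕ) :
    expOne h (List.replicate n 1) = h ^ n / (n.factorial : ℝ) := by
  rw [expOne, if_pos (by simp)]
  simp

theorem exists_ne_or_eq_replicate (k : List ℕ) :
    (∃ x ∈ k, x ≠ 1) ∨ k = List.replicate k.length 1 := by
  by_cases h : ∀ x ∈ k, x = 1
  · right; exact List.eq_replicate_of_mem h
  · left; push Not at h; exact h

/-- On words of ones this is the binomial theorem; any other word has a bad letter in one of its two
pieces. -/
theorem conv_expOne (x y : ℝ) (k : List ℕ) :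
    conv (expOne x) (expOne y) k = expOne (x + y) k := by
  rcases exists_ne_or_eq_replicate k with h | h
  · rw [expOne_ne _ h, conv]
    refine sum_eq_zero fun p _ => ?_
    obtain ⟨z, hz, hz1⟩ := h
    rw [← List.take_append_drop p k] at hz
    rcases List.mem_append.1 hz with hz | hz
    · rw [expOne_ne x ⟨z, hz, hz1⟩, zero_mul]
    · rw [expOne_ne y ⟨z, hz, hz1⟩, mul_zero]
  · rw [h, expOne_replicate, add_pow, conv, List.length_replicate, sum_div]
    refine sum_congr rfl fun p hp => ?_
    have hp' : p ≤ k.length := by simpa [Nat.lt_succ_iff] using hp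
    rw [List.take_replicate, List.drop_replicate, min_eq_left hp', expOne_replicate,
      expOne_replicate, Nat.cast_choose ℝ hp']
    have := Nat.factorial_ne_zero k.length
    field_simp

theorem signRev_expOne (h : ℝ) (k : List ℕ) : signRev (expOne h) k = expOne (-h) k := by
  rcases exists_ne_or_eq_replicate k with hk | hk
  · rw [signRev, expOne_ne _ (by simpa using hk), expOne_ne _ hk, mul_zero]
  · rw [signRev, hk, List.reverse_replicate, expOne_replicate, expOne_replicate, neg_pow h]
    simp
    ring

theorem conv_expOne_zero (g : List ℕ → ℝ) (k : List ℕ) : conv (expOne 0) g k = g k := by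
  rw [conv, sum_range_succ']
  simp only [List.take_zero, expOne_nil, List.drop_zero, one_mul]
  rw [sum_eq_zero, zero_add]
  intro p hp
  rw [mem_range] at hp
  rw [expOne]
  split_ifs
  · rw [zero_pow (by simp; intro h; subst h; simp at hp)]
    simp
  · simp

/-! ### Harmonically regularized truncated sums -/

/-- The sum of `f` over the stuffle product with the letter `1`. -/
noncomputable def insertOne (f : List ℕ → ℝ) (v : List ℕ) : ℝ := ((stuffle [1] v).map f).sum

theorem insertOne_nil (f : List ℕ → ℝ) : insertOne f [] = f [1] := by simp [insertOne, stuffle]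

theorem insertOne_cons (f : List ℕ → ℝ) (b : ℕ) (v : List ℕ) :
    insertOne f (b :: v) =
      f (1 :: b :: v) + insertOne (fun w => f (b :: w)) v + f ((1 + b) :: v) := by
  simp [insertOne, stuffle_one_cons, Function.comp_def, add_assoc]

theorem insertOne_add (f g : List ℕ → ℝ) (v : List ℕ) :
    insertOne (fun w => f w + g w) v = insertOne f v + insertOne g v := by
  simp [insertOne, List.sum_map_add]

theorem insertOne_mul_left (c : ℝ) (g : List ℕ → ℝ) (v : List ℕ) :
    insertOne (fun w => c * g w) v = c * insertOne g v := by
  simp [insertOne, List.sum_map_mul_left]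

/-- The letter 1 is primitive for deconcatenation, so the transpose of stuffling with it is a
derivation of the convolution algebra: in each cut of the word, the inserted letter lands in one of
the two pieces. -/
theorem insertOne_conv (f g : List ℕ → ℝ) (v : List ℕ) :
    insertOne (conv f g) v = conv (insertOne f) g v + conv f (insertOne g) v := by
  induction v generalizing f with
  | nil => simp [insertOne_nil, conv_cons, conv_nil]; ring
  | cons b v ih =>
    have e : (fun w => conv f g (b :: w)) =
        fun w => f [] * g (b :: w) + conv (fun w => f (b :: w)) g w :=
      funext fun w => conv_cons f g b w
    have e2 : (fun w => insertOne f (b :: w)) = fun w => f (1 :: b :: w) +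
        insertOne (fun w => f (b :: w)) w + f ((1 + b) :: w) :=
      funext fun w => insertOne_cons f b w
    rw [insertOne_cons, e, insertOne_add, insertOne_mul_left, ih, conv_cons f, conv_cons _ _ b v,
      conv_cons f _ (1 + b), conv_cons (insertOne f), e2, conv_add_left, conv_add_left,
      conv_cons f, insertOne_cons, insertOne_nil]
    ring

theorem insertOne_trunc (N : ℕ) (v : List ℕ) :
    insertOne (trunc N 0) v = (harmonic N : ℝ) * trunc N 0 v := by
  rw [insertOne, ← trunc_mul, trunc_one_eq]

/-- The letter 1 can be inserted into n ones in n + 1 ways, all giving the same word; mergers create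
a letter 2 and contribute nothing. The factor n + 1 cancels against (n + 1)!, making `expOne h` an
eigenfunction. -/
theorem insertOne_expOne (h : ℝ) {v : List ℕ} (hv : IsIndex v) :
    insertOne (expOne h) v = h * expOne h v := by
  -- A prefix of ones is carried along so that the induction hypothesis applies after a leading
  -- letter 1 has been moved into it.
  have key : ∀ (n : ℕ) (v : List ℕ), IsIndex v →
      insertOne (fun w => expOne h (List.replicate n 1 ++ w)) v =
        if ∀ x ∈ v, x = 1 then (v.length + 1) * (h ^ (n + v.length + 1) /
          ((n + v.length + 1).factorial : ℝ)) else 0 := by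
    intro n v
    induction v generalizing n with
    | nil =>
      intro _
      have : List.replicate n 1 ++ [1] = List.replicate (n + 1) 1 := by
        rw [List.replicate_succ']
      simp [insertOne_nil, this, expOne_replicate]
    | cons b v ih =>
      intro hv
      have hb : 1 ≤ b := hv b (by simp)
      rw [insertOne_cons, expOne_ne h (k := List.replicate n 1 ++ (1 + b) :: v)
        ⟨1 + b, by simp, by omega⟩]
      by_cases hb1 : b = 1
      · subst hb1
        have e : ∀ w : List ℕ, List.replicate n 1 ++ 1 :: w = List.replicate (n + 1) 1 ++ w := by
          intro w
          rw [List.replicate_succ']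
          simp
        simp only [e]
        rw [ih (n + 1) fun x hx => hv x (by simp [hx])]
        rcases exists_ne_or_eq_replicate v with hk | hk
        · have : ¬ ∀ x ∈ v, x = 1 := by push Not; exact hk
          rw [if_neg this, if_neg (by simpa using hk), expOne_ne _]
          · simp
          · obtain ⟨x, hx, hx1⟩ := hk
            exact ⟨x, by simp [hx], hx1⟩
        · have h1 : ∀ x ∈ v, x = 1 := by rw [hk]; simp
          rw [if_pos h1, if_pos (by simpa using h1), hk, ← List.replicate_succ,
            List.replicate_append_replicate, expOne_replicate]
          simp only [List.length_replicate]
          rw [show n + 1 + (v.length + 1) = n + (v.length + 1) + 1 by ring,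
            show n + 1 + v.length + 1 = n + (v.length + 1) + 1 by ring]
          push_cast
          ring
      · rw [if_neg (by simp [hb1]), expOne_ne h ⟨b, by simp, hb1⟩, zero_add, add_zero]
        rw [insertOne, List.sum_eq_zero]
        intro x hx
        obtain ⟨w, _, rfl⟩ := List.mem_map.1 hx
        exact expOne_ne h ⟨b, by simp, hb1⟩
  have := key 0 v hv
  simp only [List.replicate_zero, List.nil_append] at this
  rw [this, expOne]
  split_ifs
  · rw [zero_add, pow_succ, Nat.factorial_succ]
    push_cast
    have h1 : ((v.length : ℝ) + 1) ≠ 0 := by positivity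
    have h2 : (v.length.factorial : ℝ) ≠ 0 := by positivity
    field_simp
  · simp

theorem IsIndex.take {k : List ℕ} (hk : IsIndex k) (p : ℕ) : IsIndex (k.take p) :=
  fun x hx => hk x (List.mem_of_mem_take hx)

theorem IsIndex.drop {k : List ℕ} (hk : IsIndex k) (p : ℕ) : IsIndex (k.drop p) :=
  fun x hx => hk x (List.mem_of_mem_drop hx)

theorem IsIndex.reverse {k : List ℕ} (hk : IsIndex k) : IsIndex k.reverse :=
  fun x hx => hk x (List.mem_reverse.1 hx)

theorem IsIndex.of_cons {a : ℕ} {l : List ℕ} (h : IsIndex (a :: l)) : IsIndex l :=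
  fun x hx => h x (by simp [hx])

theorem IsAdmissible.drop {k : List ℕ} (hk : IsAdmissible k) (p : ℕ) : IsAdmissible (k.drop p) := by
  refine ⟨hk.1.drop p, fun x hx => hk.2 x ?_⟩
  rw [List.getLast?_drop] at hx
  split_ifs at hx
  · simp at hx
  · exact hx

/-- The truncated sum, regularized so that it vanishes at the word `1`. -/
noncomputable def regTrunc (N : ℕ) : List ℕ → ℝ :=
  conv (trunc N 0) (expOne (-(harmonic N : ℝ)))

/-- The two factors of `regTrunc` have eigenvalues H_N and -H_N under the derivation `insertOne`, so
they cancel. This is the exact finite counterpart of ζ^*(1) ζ^*(v) = 0, and it is what lets the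
recursion for ζ^* be copied. -/
theorem insertOne_regTrunc (N : ℕ) {v : List ℕ} (hv : IsIndex v) :
    insertOne (regTrunc N) v = 0 := by
  have e : insertOne (trunc N 0) = fun w => (harmonic N : ℝ) * trunc N 0 w :=
    funext (insertOne_trunc N)
  have e2 : conv (trunc N 0) (insertOne (expOne (-(harmonic N : ℝ)))) v =
      conv (trunc N 0) (fun w => -(harmonic N : ℝ) * expOne (-(harmonic N : ℝ)) w) v :=
    conv_congr_right _ _ fun p => insertOne_expOne _ (hv.drop p)
  rw [regTrunc, insertOne_conv, e, conv_mul_left, e2]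
  simp only [conv, mul_sum, ← sum_add_distrib]
  exact sum_eq_zero fun p _ => by ring

/-- Every nonempty suffix of an admissible word contains its last letter, which is at least 2, so
`expOne` sees only the empty suffix. -/
theorem regTrunc_admissible (N : ℕ) {k : List ℕ} (hk : IsAdmissible k) :
    regTrunc N k = trunc N 0 k := by
  rcases admissible_cases hk with rfl | ⟨l, a, rfl, hl, ha⟩
  · simp [regTrunc, conv_nil, expOne_nil]
  · rw [regTrunc, conv_snoc, expOne_nil, mul_one, conv, sum_eq_zero, zero_add]
    intro p _
    rw [expOne_ne _ ⟨a, by simp, by omega⟩, mul_zero]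

/-! ### Rate of convergence to the stuffle regularized values -/

theorem pow_one_add_harmonic_le (p : ℕ) :
    ∃ C : ℝ, 0 < C ∧ ∀ n : ℕ, (1 + (harmonic n : ℝ)) ^ p ≤ C * ((n : ℝ) + 1) ^ (1 / 4 : ℝ) := by
  have hlog : (fun x : ℝ => (2 + Real.log x) ^ p) =o[atTop] fun x : ℝ => x ^ (1 / 4 : ℝ) := by
    have h1 : (fun x : ℝ => 2 + Real.log x) =O[atTop] Real.log := by
      apply Asymptotics.IsBigO.add
      · exact (Real.isLittleO_const_log_atTop (c := 2)).isBigO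
      · exact Asymptotics.isBigO_refl _ _
    refine (h1.pow p).trans_isLittleO ?_
    have := isLittleO_log_rpow_rpow_atTop (p : ℝ) (show (0 : ℝ) < 1 / 4 by norm_num)
    simpa using this
  have hb := (hlog.comp_tendsto ((tendsto_natCast_atTop_atTop (R := ℝ)).comp
    (tendsto_add_atTop_nat 1))).isBigO
  obtain ⟨C, hC0, hC⟩ := Asymptotics.bound_of_isBigO_nat_atTop hb
  refine ⟨C, hC0, fun n => ?_⟩
  have hn : (0 : ℝ) < (n : ℝ) + 1 := by positivity
  have h := @hC n (by simp only [Function.comp_apply]; push_cast; positivity)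
  have hh0 : (0 : ℝ) ≤ harmonic n := by
    rw [← trunc_one_eq]; exact trunc_nonneg _ _ _
  have hh : (harmonic n : ℝ) ≤ 1 + Real.log n := harmonic_le_one_add_log n
  have hl : Real.log n ≤ Real.log ((n : ℝ) + 1) := by
    rcases Nat.eq_zero_or_pos n with rfl | hn
    · simp
    · exact Real.log_le_log (by exact_mod_cast hn) (by linarith)
  have hl0 : 0 ≤ Real.log ((n : ℝ) + 1) := Real.log_nonneg (by linarith [n.cast_nonneg (α := ℝ)])
  simp only [Function.comp_apply, Real.norm_eq_abs] at h
  push_cast at h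
  rw [abs_of_nonneg (by positivity), abs_of_nonneg (by positivity)] at h
  exact (pow_le_pow_left₀ (by linarith) (by linarith) p).trans h

/-- Powers of harmonic numbers cost at most n^(1/4), which leaves the exponent 2 - 1/2 - 1/4 = 5/4 >
1. -/
theorem summable_sqrt_harmonic (p : ℕ) :
    Summable fun n : ℕ => √((n : ℝ) + 1) * (1 / ((n + 1 : ℕ) : ℝ) ^ 2 * (harmonic n : ℝ) ^ p) := by
  obtain ⟨C, hC0, hC⟩ := pow_one_add_harmonic_le p
  have hs : Summable fun n : ℕ => C * (1 / ((n + 1 : ℕ) : ℝ) ^ (5 / 4 : ℝ)) :=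
    (((summable_nat_add_iff 1).2 (Real.summable_one_div_nat_rpow.2 (by norm_num)))).mul_left C
  have hh0 : ∀ n, (0 : ℝ) ≤ harmonic n := fun n => by
    rw [← trunc_one_eq]; exact trunc_nonneg _ _ _
  refine Summable.of_nonneg_of_le (fun n => ?_) (fun n => ?_) hs
  · have := hh0 n
    positivity
  · have hn : (0 : ℝ) < (n : ℝ) + 1 := by positivity
    have h1 : (harmonic n : ℝ) ^ p ≤ C * ((n : ℝ) + 1) ^ (1 / 4 : ℝ) :=
      (pow_le_pow_left₀ (hh0 n) (by linarith) p).trans (hC n)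
    push_cast
    have h2 : ((n : ℝ) + 1) ^ 2 =
        ((n : ℝ) + 1) ^ (5 / 4 : ℝ) * (((n : ℝ) + 1) ^ (1 / 4 : ℝ) * √((n : ℝ) + 1)) := by
      rw [Real.sqrt_eq_rpow, ← Real.rpow_add hn, ← Real.rpow_add hn, ← Real.rpow_natCast]
      norm_num
    calc √((n : ℝ) + 1) * (1 / ((n : ℝ) + 1) ^ 2 * (harmonic n : ℝ) ^ p)
        ≤ √((n : ℝ) + 1) * (1 / ((n : ℝ) + 1) ^ 2 * (C * ((n : ℝ) + 1) ^ (1 / 4 : ℝ))) := by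
          gcongr
      _ = C * (1 / ((n : ℝ) + 1) ^ (5 / 4 : ℝ)) := by
          rw [h2]
          have : √((n : ℝ) + 1) ≠ 0 := by positivity
          field_simp

/-- The difference is a tail of a series of nonnegative terms. Inside the tail √(N + 1) is at most
√(n + 1), so multiplying by it still leaves a bound by a fixed convergent series. -/
theorem trunc_sub_zeta_le {k : List ℕ} (hk : IsAdmissible k) :
    ∃ C, ∀ N : ℕ, |trunc N 0 k - zeta k| ≤ C / √((N : ℝ) + 1) := by
  have ht := tendsto_trunc hk
  rcases admissible_cases hk with rfl | ⟨l, a, rfl, hl, ha⟩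
  · have : zeta [] = 1 := by
      refine tendsto_nhds_unique ht ?_
      simp [trunc_nil]
    exact ⟨0, fun N => by simp [trunc_nil, this]⟩
  · set δ : ℕ → ℝ := fun n => trunc (n + 1) 0 (l ++ [a]) - trunc n 0 (l ++ [a]) with hδ
    have hs : Summable δ := summable_tail hl ha
    have hz : zeta (l ++ [a]) = ∑' n, δ n := by
      refine tendsto_nhds_unique ht ?_
      refine hs.hasSum.tendsto_sum_nat.congr fun N => ?_
      exact sum_tail l a N
    have hg := summable_sqrt_harmonic l.length
    set G : ℕ → ℝ := fun n : ℕ =>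
      √((n : ℝ) + 1) * (1 / ((n + 1 : ℕ) : ℝ) ^ 2 * (harmonic n : ℝ) ^ l.length) with hG
    refine ⟨∑' n, G n, fun N => ?_⟩
    have hsplit := hs.sum_add_tsum_nat_add N
    have hsum : ∑ n ∈ Finset.range N, δ n = trunc N 0 (l ++ [a]) := sum_tail l a N
    have hdiff : trunc N 0 (l ++ [a]) - zeta (l ++ [a]) = -∑' n, δ (n + N) := by
      rw [hz, ← hsplit, hsum]
      ring
    have hd0 : 0 ≤ ∑' n, δ (n + N) := tsum_nonneg fun n => tail_nonneg l a _
    have hh0 : ∀ n, (0 : ℝ) ≤ harmonic n := fun n => by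
      rw [← trunc_one_eq]; exact trunc_nonneg _ _ _
    rw [hdiff, abs_neg, abs_of_nonneg hd0, le_div_iff₀ (by positivity), ← tsum_mul_right]
    have hG0 : 0 ≤ ∑ n ∈ range N, G n := sum_nonneg fun n _ => by
      have := hh0 n
      positivity
    have hle : ∑' n, G (n + N) ≤ ∑' n, G n := by linarith [hg.sum_add_tsum_nat_add N]
    refine le_trans ?_ hle
    refine Summable.tsum_le_tsum (fun n => ?_)
      (((summable_nat_add_iff N).2 hs).mul_right _) ((summable_nat_add_iff N).2 hg)
    have h1 : δ (n + N) ≤ _ := tail_admissible hl ha (n + N)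
    rw [mul_comm]
    apply mul_le_mul _ h1 (tail_nonneg l a _) (by positivity)
    apply Real.sqrt_le_sqrt
    push_cast
    linarith [n.cast_nonneg (α := ℝ)]

/-- The regularized truncated sums converge to the stuffle regularized values. -/
theorem regTrunc_sub_zetaReg_le {k : List ℕ} (hk : IsIndex k) :
    ∃ C, ∀ N : ℕ, |regTrunc N k - zetaReg k| ≤ C / √((N : ℝ) + 1) := by
  refine induction_trail (P := fun k => ∃ C, ∀ N : ℕ,
    |regTrunc N k - zetaReg k| ≤ C / √((N : ℝ) + 1)) ?_ ?_ k hk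
  · intro k hk
    obtain ⟨C, hC⟩ := trunc_sub_zeta_le hk
    refine ⟨C, fun N => ?_⟩
    rw [regTrunc_admissible N hk, isStuffleRegularization_zetaReg.eq_zeta k hk]
    exact hC N
  · intro v hv _ hx
    have hsum : ∀ L : List (List ℕ), (∀ x ∈ L, ∃ C, ∀ N : ℕ,
        |regTrunc N x - zetaReg x| ≤ C / √((N : ℝ) + 1)) →
        ∃ C, ∀ N : ℕ, |(L.map (regTrunc N)).sum - (L.map zetaReg).sum| ≤ C / √((N : ℝ) + 1) := by
      intro L
      induction L with
      | nil => intro _; exact ⟨0, fun N => by simp⟩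
      | cons x L ih =>
        intro h
        obtain ⟨C, hC⟩ := ih fun y hy => h y (by simp [hy])
        obtain ⟨D, hD⟩ := h x (by simp)
        refine ⟨D + C, fun N => ?_⟩
        rw [List.map_cons, List.map_cons, List.sum_cons, List.sum_cons, add_div]
        rw [add_sub_add_comm]
        exact (abs_add_le _ _).trans (add_le_add (hD N) (hC N))
    obtain ⟨C, hC⟩ := hsum _ hx
    refine ⟨C, fun N => ?_⟩
    have e := isStuffleRegularization_zetaReg.mul [1] v isIndex_one hv
    have e' := insertOne_regTrunc N hv
    rw [isStuffleRegularization_zetaReg.one, zero_mul, sum_stuffle_one] at e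
    rw [insertOne, sum_stuffle_one] at e'
    -- The word v followed by 1 occurs with positive multiplicity c, so its own error is at most c
    -- times that error, which the recursion controls.
    have hc : (1 : ℝ) ≤ ((stuffle [1] v).count (v ++ [1]) : ℝ) := by
      have := List.count_pos_iff.2 (mem_stuffle_one v)
      exact_mod_cast this
    set c : ℝ := ((stuffle [1] v).count (v ++ [1]) : ℝ)
    refine le_trans ?_ (hC N)
    have : (((stuffle [1] v).filter (· ≠ v ++ [1])).map (regTrunc N)).sum -
        (((stuffle [1] v).filter (· ≠ v ++ [1])).map zetaReg).sum =
        -(c * (regTrunc N (v ++ [1]) - zetaReg (v ++ [1]))) := by linarith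
    rw [this, abs_neg, abs_mul, abs_of_nonneg (zero_le_one.trans hc)]
    exact le_mul_of_one_le_left (abs_nonneg _) hc

/-! ### Taylor coefficients of shifted sums -/

/-- The coefficient of `z ^ a` obtained from `f(k₁, …, k_d)` by replacing each `m ^ (-k_j)` with the
Taylor series of `(m + z) ^ (-k_j)`. -/
noncomputable def shiftCoeff : List ℕ → (List ℕ → ℝ) → ℕ → ℝ
  | [], f, a => if a = 0 then f [] else 0
  | k :: l, f, a => ∑ p ∈ antidiagonal a, (-1) ^ p.1 * (Nat.choose (k - 1 + p.1) p.1 : ℝ) *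
      shiftCoeff l (fun w => f ((k + p.1) :: w)) p.2

theorem shiftCoeff_cons (k : ℕ) (l : List ℕ) (f : List ℕ → ℝ) (a : ℕ) :
    shiftCoeff (k :: l) f a = ∑ p ∈ antidiagonal a,
      (-1) ^ p.1 * (Nat.choose (k - 1 + p.1) p.1 : ℝ) *
        shiftCoeff l (fun w => f ((k + p.1) :: w)) p.2 := rfl

theorem shiftCoeff_add (k : List ℕ) (f g : List ℕ → ℝ) (a : ℕ) :
    shiftCoeff k (fun w => f w + g w) a = shiftCoeff k f a + shiftCoeff k g a := by
  induction k generalizing f g a with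
  | nil => simp only [shiftCoeff]; split_ifs <;> simp
  | cons k l ih =>
    simp only [shiftCoeff_cons, ← sum_add_distrib]
    refine sum_congr rfl fun p _ => ?_
    rw [ih]
    ring

theorem shiftCoeff_mul_left (k : List ℕ) (c : ℝ) (g : List ℕ → ℝ) (a : ℕ) :
    shiftCoeff k (fun w => c * g w) a = c * shiftCoeff k g a := by
  induction k generalizing g a with
  | nil => simp only [shiftCoeff]; split_ifs <;> simp
  | cons k l ih =>
    simp only [shiftCoeff_cons, mul_sum]
    refine sum_congr rfl fun p _ => ?_
    rw [ih]
    ring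

theorem shiftCoeff_zero (k : List ℕ) (a : ℕ) : shiftCoeff k (fun _ => 0) a = 0 := by
  simpa using shiftCoeff_mul_left k 0 (fun _ => 0) a

theorem shiftCoeff_zero_right (k : List ℕ) (f : List ℕ → ℝ) : shiftCoeff k f 0 = f k := by
  induction k generalizing f with
  | nil => simp [shiftCoeff]
  | cons k l ih => simp [shiftCoeff_cons, ih]

/-- `shiftCoeff` is a finite linear combination of values at words that dominate `k` letter by
letter, so a common rate at these words passes to it. -/
theorem shiftCoeff_sub_le (k : List ℕ) (f : ℕ → List ℕ → ℝ) (g : List ℕ → ℝ) (a : ℕ)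
    (h : ∀ w, List.Forall₂ (· ≤ ·) k w →
      ∃ C, ∀ N : ℕ, |f N w - g w| ≤ C / √((N : ℝ) + 1)) :
    ∃ C, ∀ N : ℕ, |shiftCoeff k (f N) a - shiftCoeff k g a| ≤ C / √((N : ℝ) + 1) := by
  induction k generalizing f g a with
  | nil =>
    obtain ⟨C, hC⟩ := h [] List.Forall₂.nil
    simp only [shiftCoeff]
    split_ifs
    · exact ⟨C, hC⟩
    · exact ⟨0, by simp⟩
  | cons k l ih =>
    have h' : ∀ p : ℕ × ℕ, ∃ C, ∀ N : ℕ, |shiftCoeff l (fun w => f N ((k + p.1) :: w)) p.2 -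
        shiftCoeff l (fun w => g ((k + p.1) :: w)) p.2| ≤ C / √((N : ℝ) + 1) := fun p =>
      ih (fun N w => f N ((k + p.1) :: w)) (fun w => g ((k + p.1) :: w)) p.2
        fun w hw => h _ (List.Forall₂.cons (by omega) hw)
    choose C hC using h'
    refine ⟨∑ p ∈ antidiagonal a, (Nat.choose (k - 1 + p.1) p.1 : ℝ) * C p, fun N => ?_⟩
    rw [shiftCoeff_cons, shiftCoeff_cons, ← sum_sub_distrib, sum_div]
    refine (abs_sum_le_sum_abs _ _).trans (sum_le_sum fun p _ => ?_)
    rw [← mul_sub, abs_mul, abs_mul, abs_pow, abs_neg, abs_one, one_pow, one_mul, Nat.abs_cast,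
      mul_div_assoc]
    exact mul_le_mul_of_nonneg_left (hC p N) (Nat.cast_nonneg _)

theorem IsIndex.of_forall₂ {k w : List ℕ} (hk : IsIndex k) (h : List.Forall₂ (· ≤ ·) k w) :
    IsIndex w := by
  induction h with
  | nil => exact hk
  | cons hab _ ih =>
    intro x hx
    rcases List.mem_cons.1 hx with rfl | hx
    · exact (hk _ (by simp)).trans hab
    · exact ih hk.of_cons x hx

theorem IsAdmissible.of_forall₂ {k w : List ℕ} (hk : IsAdmissible k)
    (h : List.Forall₂ (· ≤ ·) k w) : IsAdmissible w := by
  refine ⟨hk.1.of_forall₂ h, ?_⟩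
  have h2 := hk.2
  clear hk
  induction h with
  | nil => exact h2
  | @cons a b l m hab hlm ih =>
    cases hlm with
    | nil => simp at h2 ⊢; omega
    | cons h3 h4 => simpa using ih (by simpa using h2)

/-- Convolution with a function supported on words of ones. -/
theorem shiftCoeff_conv {f : List ℕ → ℝ} (hf : ∀ w, (∃ x ∈ w, x ≠ 1) → f w = 0)
    (g : List ℕ → ℝ) {k : List ℕ} (hk : IsIndex k) (a : ℕ) :
    shiftCoeff k (conv f g) a = conv f (fun w => shiftCoeff w g a) k := by
  induction k generalizing f a with
  | nil => simp only [shiftCoeff, conv_nil]; split_ifs <;> simp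
  | cons b l ih =>
    have e : ∀ c, (fun w => conv f g (c :: w)) =
        fun w => f [] * g (c :: w) + conv (fun w => f (c :: w)) g w :=
      fun c => funext fun w => conv_cons f g c w
    rw [conv_cons, shiftCoeff_cons, shiftCoeff_cons]
    simp only [e, shiftCoeff_add, shiftCoeff_mul_left, mul_add, sum_add_distrib]
    congr 1
    · rw [mul_sum]
      exact sum_congr rfl fun p _ => by ring
    -- A Taylor shift p ≥ 1 raises the letter b ≥ 1 above 1, where `f` vanishes; hence the letters
    -- consumed by `f` are never shifted.
    · rw [sum_eq_single (0, a)]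
      · simp only [add_zero, pow_zero, Nat.choose_zero_right, Nat.cast_one, one_mul]
        exact ih (fun w ⟨x, hx, hx1⟩ => hf _ ⟨x, by simp [hx], hx1⟩) hk.of_cons a
      · intro p hp hp0
        have hp1 : p.1 ≠ 0 := by
          intro h0
          apply hp0
          rw [HasAntidiagonal.mem_antidiagonal, h0, zero_add] at hp
          exact Prod.ext h0 hp
        have hb : 1 ≤ b := hk b (by simp)
        have : (fun w => f ((b + p.1) :: w)) = fun _ => 0 :=
          funext fun w => hf _ ⟨b + p.1, by simp, by omega⟩
        rw [this, show conv (fun _ => (0 : ℝ)) g = fun _ => 0 from funext (conv_zero_left g),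
          shiftCoeff_zero, mul_zero]
      · intro h
        exact absurd (HasAntidiagonal.mem_antidiagonal.2 (show (0, a).1 + (0, a).2 = a by simp)) h

/-- The Taylor expansions in the different letters are independent, so the last letter can be
expanded first. -/
theorem shiftCoeff_snoc (k : List ℕ) (b : ℕ) (f : List ℕ → ℝ) (a : ℕ) :
    shiftCoeff (k ++ [b]) f a = ∑ p ∈ antidiagonal a,
      (-1) ^ p.1 * (Nat.choose (b - 1 + p.1) p.1 : ℝ) *
        shiftCoeff k (fun w => f (w ++ [b + p.1])) p.2 := by
  induction k generalizing f a with
  | nil =>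
    rw [List.nil_append, shiftCoeff_cons]
    rfl
  | cons c l ih =>
    rw [List.cons_append, shiftCoeff_cons]
    simp only [ih, shiftCoeff_cons, mul_sum]
    rw [sum_sigma', sum_sigma']
    refine sum_bij' (fun x _ => ⟨(x.2.1, x.1.1 + x.2.2), (x.1.1, x.2.2)⟩)
      (fun x _ => ⟨(x.2.1, x.1.1 + x.2.2), (x.1.1, x.2.2)⟩) ?_ ?_ ?_ ?_ ?_
    · rintro ⟨⟨p, q⟩, ⟨r, s⟩⟩ h
      simp only [mem_sigma, HasAntidiagonal.mem_antidiagonal] at h ⊢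
      exact ⟨by omega, trivial⟩
    · rintro ⟨⟨p, q⟩, ⟨r, s⟩⟩ h
      simp only [mem_sigma, HasAntidiagonal.mem_antidiagonal] at h ⊢
      exact ⟨by omega, trivial⟩
    · rintro ⟨⟨p, q⟩, ⟨r, s⟩⟩ h
      simp only [mem_sigma, HasAntidiagonal.mem_antidiagonal] at h ⊢
      rw [h.2]
    · rintro ⟨⟨p, q⟩, ⟨r, s⟩⟩ h
      simp only [mem_sigma, HasAntidiagonal.mem_antidiagonal] at h ⊢
      rw [h.2]
    · rintro ⟨⟨p, q⟩, ⟨r, s⟩⟩ h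
      simp only [List.cons_append]
      ring

theorem shiftCoeff_comp_reverse (k : List ℕ) (f : List ℕ → ℝ) (a : ℕ) :
    shiftCoeff k (fun w => f w.reverse) a = shiftCoeff k.reverse f a := by
  induction k generalizing f a with
  | nil => simp [shiftCoeff]
  | cons b l ih =>
    rw [List.reverse_cons, shiftCoeff_snoc, shiftCoeff_cons]
    refine sum_congr rfl fun p _ => ?_
    rw [← ih]
    simp

theorem shiftCoeff_sign (k : List ℕ) (f : List ℕ → ℝ) (a : ℕ) :
    shiftCoeff k (fun w => (-1) ^ w.sum * f w) a = (-1) ^ (k.sum + a) * shiftCoeff k f a := by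
  induction k generalizing f a with
  | nil => simp only [shiftCoeff]; split_ifs with h <;> simp [h]
  | cons b l ih =>
    rw [shiftCoeff_cons, shiftCoeff_cons, mul_sum]
    refine sum_congr rfl fun p hp => ?_
    have e : (fun w : List ℕ => (-1 : ℝ) ^ ((b + p.1) :: w).sum * f ((b + p.1) :: w)) =
        fun w => (-1) ^ (b + p.1) * ((-1) ^ w.sum * f ((b + p.1) :: w)) := by
      funext w
      rw [List.sum_cons, pow_add]
      ring
    rw [e, shiftCoeff_mul_left, ih, ← HasAntidiagonal.mem_antidiagonal.1 hp, List.sum_cons]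
    ring

theorem shiftCoeff_signRev (k : List ℕ) (f : List ℕ → ℝ) (a : ℕ) :
    shiftCoeff k (signRev f) a = (-1) ^ (k.sum + a) * shiftCoeff k.reverse f a := by
  rw [← shiftCoeff_comp_reverse, ← shiftCoeff_sign]
  rfl

theorem shiftCoeff_eq_sum (k : List ℕ) (f : List ℕ → ℝ) (a : ℕ) :
    shiftCoeff k f a = (-1) ^ a * ∑ v ∈ piAntidiag (univ : Finset (Fin k.length)) a,
      f (List.ofFn fun t => k.get t + v t) *
        ∏ t, (Nat.choose (k.get t - 1 + v t) (v t) : ℝ) := by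
  induction k generalizing f a with
  | nil =>
    simp only [shiftCoeff]
    rcases Nat.eq_zero_or_pos a with rfl | ha
    · simp
    · rw [if_neg ha.ne', sum_eq_zero, mul_zero]
      intro v hv
      rw [mem_piAntidiag] at hv
      simp at hv
      omega
  | cons b l ih =>
    rw [shiftCoeff_cons]
    simp only [ih, mul_sum]
    rw [sum_sigma']
    refine sum_bij' (fun x _ => (Fin.cons x.1.1 x.2 : Fin (l.length + 1) → ℕ))
      (fun v _ => ⟨(v 0, a - v 0), Fin.tail v⟩) ?_ ?_ ?_ ?_ ?_
    · rintro ⟨⟨p, q⟩, v⟩ h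
      simp only [mem_sigma, HasAntidiagonal.mem_antidiagonal, mem_piAntidiag] at h ⊢
      refine ⟨?_, fun _ _ => mem_univ _⟩
      simp only [List.length_cons]
      rw [Fin.sum_univ_succ]
      simp [h.2.1, h.1]
    · intro v h
      simp only [List.length_cons] at v h
      simp only [mem_piAntidiag] at h
      have h1 := h.1
      rw [Fin.sum_univ_succ] at h1
      simp only [mem_sigma, HasAntidiagonal.mem_antidiagonal, mem_piAntidiag, Fin.tail]
      refine ⟨by omega, ?_, fun _ _ => mem_univ _⟩
      change ∑ i : Fin l.length, v i.succ = _
      omega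
    · rintro ⟨⟨p, q⟩, v⟩ h
      simp only [mem_sigma, HasAntidiagonal.mem_antidiagonal, mem_piAntidiag] at h ⊢
      have : a - p = q := by omega
      simp [this]
    · intro v h
      simp
    · rintro ⟨⟨p, q⟩, v⟩ h
      simp only [mem_sigma, HasAntidiagonal.mem_antidiagonal, mem_piAntidiag] at h
      simp only [List.length_cons]
      rw [← h.1, pow_add, Fin.prod_univ_succ, List.ofFn_succ]
      simp
      ring

theorem zetaRegCoeff_eq (a : ℕ) (k : List ℕ) : zetaRegCoeff a k = shiftCoeff k zetaReg a := by
  rw [zetaRegCoeff, shiftCoeff_eq_sum]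

/-! ### Laurent expansions of nested sums -/

/-- The Taylor series of `(c + X) ^ (-k)`. -/
noncomputable def invPowSeries (c : ℝ) (k : ℕ) : PowerSeries ℝ :=
  PowerSeries.mk fun p => (-1) ^ p * (Nat.choose (k - 1 + p) p : ℝ) * (c ^ (k + p))⁻¹

/-- Coefficientwise this is Pascal's rule for the binomials of the negative binomial series. -/
theorem add_X_mul_invPowSeries_succ {c : ℝ} (hc : c ≠ 0) (k : ℕ) :
    (PowerSeries.C c + PowerSeries.X) * invPowSeries c (k + 1 + 1) = invPowSeries c (k + 1) := by
  ext n
  rw [add_mul, map_add, PowerSeries.coeff_C_mul]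
  rcases n with _ | n
  · rw [PowerSeries.coeff_zero_X_mul]
    simp only [invPowSeries, PowerSeries.coeff_mk]
    simp
    field_simp
    ring
  · rw [PowerSeries.coeff_succ_X_mul]
    simp only [invPowSeries, PowerSeries.coeff_mk, Nat.add_sub_cancel]
    have h : (Nat.choose (k + 1 + (n + 1)) (n + 1) : ℝ) =
        Nat.choose (k + 1 + n) n + Nat.choose (k + (n + 1)) (n + 1) := by
      have : k + 1 + (n + 1) = (k + 1 + n) + 1 := by ring
      rw [this, Nat.choose_succ_succ]
      push_cast
      rw [show k + 1 + n = k + (n + 1) by ring]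
    rw [h]
    field_simp
    ring

theorem add_X_mul_invPowSeries_one {c : ℝ} (hc : c ≠ 0) :
    (PowerSeries.C c + PowerSeries.X) * invPowSeries c 1 = 1 := by
  ext n
  rw [add_mul, map_add, PowerSeries.coeff_C_mul]
  rcases n with _ | n
  · rw [PowerSeries.coeff_zero_X_mul]
    simp [invPowSeries, hc]
  · rw [PowerSeries.coeff_succ_X_mul]
    simp only [invPowSeries, PowerSeries.coeff_mk, PowerSeries.coeff_one]
    simp
    field_simp
    ring

theorem add_X_pow_mul_invPowSeries {c : ℝ} (hc : c ≠ 0) (k : ℕ) :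
    (PowerSeries.C c + PowerSeries.X) ^ (k + 1) * invPowSeries c (k + 1) = 1 := by
  induction k with
  | zero => rw [zero_add, pow_one, add_X_mul_invPowSeries_one hc]
  | succ k ih => rw [pow_succ, mul_assoc, add_X_mul_invPowSeries_succ hc, ih]

/-- The exponent must be positive: at k = 0 the truncated k - 1 would make every binomial 1, and the
series would not be the constant 1. -/
theorem coe_invPowSeries {c : ℝ} (hc : c ≠ 0) {k : ℕ} (hk : 1 ≤ k) :
    ((invPowSeries c k : PowerSeries ℝ) : ℝ⸨X⸩) =
      ((((PowerSeries.C c + PowerSeries.X : PowerSeries ℝ) : ℝ⸨X⸩)) ^ k)⁻¹ := by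
  obtain ⟨k, rfl⟩ := Nat.exists_eq_add_of_le' hk
  refine eq_inv_of_mul_eq_one_right ?_
  have := congrArg (fun F : PowerSeries ℝ => (F : ℝ⸨X⸩)) (add_X_pow_mul_invPowSeries hc k)
  simpa only [map_mul, map_pow, map_one] using this

/-- The point `c + X` of the field of Laurent series. -/
noncomputable def shiftPoint (c : ℝ) (a : ℕ) : ℝ⸨X⸩ :=
  ((((PowerSeries.C c + PowerSeries.X : PowerSeries ℝ) : ℝ⸨X⸩)) ^ a)⁻¹

/-- Expanding each (c + X)^(-a) with c ≠ 0 and collecting powers of X gives exactly the combination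
recorded by `shiftCoeff`. This is how Taylor coefficients at a pole become the numbers ζ_a. -/
theorem wsum_shiftPoint (cs : List ℝ) (hcs : ∀ c ∈ cs, c ≠ 0) {k : List ℕ} (hk : IsIndex k) :
    wsum (cs.map shiftPoint) k =
      ((PowerSeries.mk (shiftCoeff k (wsum (cs.map fun (c : ℝ) (a : ℕ) => (c ^ a)⁻¹))) :
        PowerSeries ℝ) : ℝ⸨X⸩) := by
  induction cs generalizing k with
  | nil =>
    rcases k with _ | ⟨a, l⟩
    · have : PowerSeries.mk (shiftCoeff [] (wsum ([].map fun (c : ℝ) (a : ℕ) => (c ^ a)⁻¹))) =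
          1 := by
        ext n
        simp [shiftCoeff, wsum_nil, PowerSeries.coeff_one]
      rw [this]
      simp [wsum_nil]
    · have : PowerSeries.mk (shiftCoeff (a :: l)
          (wsum ([].map fun (c : ℝ) (a : ℕ) => (c ^ a)⁻¹))) = 0 := by
        ext n
        simp [shiftCoeff_cons, wsum_empty, shiftCoeff_zero]
      rw [this]
      simp [wsum_empty]
  | cons c cs ih =>
    rcases k with _ | ⟨a, l⟩
    · have : PowerSeries.mk (shiftCoeff [] (wsum ((c :: cs).map
          fun (c : ℝ) (a : ℕ) => (c ^ a)⁻¹))) = 1 := by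
        ext n
        simp [shiftCoeff, wsum_nil, PowerSeries.coeff_one]
      rw [this]
      simp [wsum_nil]
    · have ihc : ∀ {k : List ℕ}, IsIndex k → _ := fun {k} hk =>
        ih (fun x hx => hcs x (by simp [hx])) (k := k) hk
      rw [List.map_cons, wsum_cons, ihc hk, ihc hk.of_cons, shiftPoint,
        ← coe_invPowSeries (hcs c (by simp)) (hk a (by simp)), ← map_mul, ← map_add]
      congr 1
      ext n
      rw [map_add, PowerSeries.coeff_mul]
      simp only [PowerSeries.coeff_mk, shiftCoeff_cons, List.map_cons, wsum_cons, shiftCoeff_add,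
        shiftCoeff_mul_left, mul_add, sum_add_distrib, invPowSeries]
      congr 1
      exact sum_congr rfl fun p _ => by ring

/-! ### Partial fractions -/

theorem shiftPoint_zero_pow (n : ℕ) : shiftPoint 0 n = HahnSeries.single (-(n : ℤ)) (1 : ℝ) := by
  rw [shiftPoint, map_zero, zero_add, HahnSeries.ofPowerSeries_X, HahnSeries.single_pow]
  simp

theorem shiftPoint_of_ne {c : ℝ} (hc : c ≠ 0) {n : ℕ} (hn : 1 ≤ n) :
    shiftPoint c n = ((invPowSeries c n : PowerSeries ℝ) : ℝ⸨X⸩) := (coe_invPowSeries hc hn).symm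

theorem coeff_neg_coe (F : PowerSeries ℝ) {n : ℕ} (hn : 1 ≤ n) :
    (F : ℝ⸨X⸩).coeff (-(n : ℤ)) = 0 := by
  rw [PowerSeries.coeff_coe, if_pos (by omega)]

theorem coeff_zero_coe (F : PowerSeries ℝ) :
    (F : ℝ⸨X⸩).coeff 0 = PowerSeries.coeff 0 F := by
  rw [PowerSeries.coeff_coe, if_neg (by omega)]
  rfl

theorem coe_add_X_ne_zero (c : ℝ) :
    (((PowerSeries.C c + PowerSeries.X : PowerSeries ℝ)) : ℝ⸨X⸩) ≠ 0 := by
  intro h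
  have h1 := congrArg (fun F : ℝ⸨X⸩ => F.coeff (1 : ℕ)) h
  simp only [LaurentSeries.coeff_coe_powerSeries] at h1
  simp [PowerSeries.coeff_one_X] at h1

/-- The family of the expansions of `(z + μ) ^ (-n)` at the points `-ν`. -/
noncomputable def pole (μ n : ℕ) : ℕ → ℝ⸨X⸩ := fun ν => shiftPoint ((μ : ℝ) - ν) n

theorem pole_zero (μ : ℕ) : pole μ 0 = 1 := by
  funext ν
  simp [pole, shiftPoint]

theorem pole_mul_self (μ n n' : ℕ) : pole μ n * pole μ n' = pole μ (n + n') := by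
  funext ν
  simp [pole, shiftPoint, pow_add, mul_comm]

/-- With x = z + μ and y = z + μ', the difference y - x is the constant μ' - μ at every expansion
point; multiplying by it lowers one of the two exponents in each term. -/
theorem pole_mul_pole {μ μ' : ℕ} (h : μ ≠ μ') (n n' : ℕ) :
    pole μ (n + 1) * pole μ' (n' + 1) = ((μ' : ℝ) - μ)⁻¹ •
      (pole μ (n + 1) * pole μ' n' - pole μ n * pole μ' (n' + 1)) := by
  have hd : ((μ' : ℝ) - μ) ≠ 0 := sub_ne_zero.2 (by exact_mod_cast h.symm)
  rw [eq_inv_smul_iff₀ hd]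
  funext ν
  simp only [pole, shiftPoint, Pi.smul_apply, Pi.mul_apply, Pi.sub_apply]
  have hx := coe_add_X_ne_zero ((μ : ℝ) - ν)
  have hy := coe_add_X_ne_zero ((μ' : ℝ) - ν)
  have hxy : HahnSeries.C ((μ' : ℝ) - μ) =
      (((PowerSeries.C ((μ' : ℝ) - ν) + PowerSeries.X : PowerSeries ℝ)) : ℝ⸨X⸩) -
      (((PowerSeries.C ((μ : ℝ) - ν) + PowerSeries.X : PowerSeries ℝ)) : ℝ⸨X⸩) := by
    rw [← map_sub, add_sub_add_right_eq_sub, ← map_sub, HahnSeries.ofPowerSeries_C]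
    congr 1
    ring
  rw [← HahnSeries.C_mul_eq_smul, hxy]
  generalize (((PowerSeries.C ((μ : ℝ) - ν) + PowerSeries.X : PowerSeries ℝ)) : ℝ⸨X⸩) = x at *
  generalize (((PowerSeries.C ((μ' : ℝ) - ν) + PowerSeries.X : PowerSeries ℝ)) : ℝ⸨X⸩) = y at *
  field_simp
  ring

/-- Proper rational functions with poles of order at most `K` at the first `M` points. -/
noncomputable def properSpan (M K : ℕ) : Submodule ℝ (ℕ → ℝ⸨X⸩) :=
  Submodule.span ℝ {f | ∃ μ n, μ < M ∧ 1 ≤ n ∧ n ≤ K ∧ f = pole μ n}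

/-- Rational functions as in `properSpan` whose residues sum to zero. -/
noncomputable def residueFreeSpan (M K : ℕ) : Submodule ℝ (ℕ → ℝ⸨X⸩) :=
  Submodule.span ℝ ({f | ∃ μ n, μ < M ∧ 2 ≤ n ∧ n ≤ K ∧ f = pole μ n} ∪
    {f | ∃ μ μ', μ < M ∧ μ' < M ∧ 1 ≤ K ∧ f = pole μ 1 - pole μ' 1})

theorem pole_mem_properSpan {M K μ n : ℕ} (hμ : μ < M) (hn : 1 ≤ n) (hK : n ≤ K) :
    pole μ n ∈ properSpan M K := Submodule.subset_span ⟨μ, n, hμ, hn, hK, rfl⟩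

theorem pole_mem_residueFreeSpan {M K μ n : ℕ} (hμ : μ < M) (hn : 2 ≤ n) (hK : n ≤ K) :
    pole μ n ∈ residueFreeSpan M K := Submodule.subset_span (Or.inl ⟨μ, n, hμ, hn, hK, rfl⟩)

theorem residueFreeSpan_le (M K : ℕ) : residueFreeSpan M K ≤ properSpan M K := by
  refine Submodule.span_le.2 ?_
  rintro f (⟨μ, n, hμ, hn, hK, rfl⟩ | ⟨μ, μ', hμ, hμ', hK, rfl⟩)
  · exact pole_mem_properSpan hμ (by omega) hK
  · exact Submodule.sub_mem _ (pole_mem_properSpan hμ le_rfl hK)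
      (pole_mem_properSpan hμ' le_rfl hK)

theorem properSpan_mono {M K K' : ℕ} (h : K ≤ K') : properSpan M K ≤ properSpan M K' := by
  refine Submodule.span_mono ?_
  rintro f ⟨μ, n, hμ, hn, hK, rfl⟩
  exact ⟨μ, n, hμ, hn, hK.trans h, rfl⟩

theorem residueFreeSpan_mono {M K K' : ℕ} (h : K ≤ K') :
    residueFreeSpan M K ≤ residueFreeSpan M K' := by
  refine Submodule.span_mono (Set.union_subset_union ?_ ?_)
  · rintro f ⟨μ, n, hμ, hn, hK, rfl⟩
    exact ⟨μ, n, hμ, hn, hK.trans h, rfl⟩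
  · rintro f ⟨μ, μ', hμ, hμ', hK, rfl⟩
    exact ⟨μ, μ', hμ, hμ', hK.trans h, rfl⟩

/-- Repeatedly lowering exponents ends either at a single pole of order at least 2 or, from two
simple poles, at a multiple of a difference of simple poles, whose residues cancel. Analytically,
the product is O(z^(-2)) at infinity. -/
theorem pole_mul_pole_mem {M μ μ' : ℕ} (hμ : μ < M) (hμ' : μ' < M) (n n' : ℕ) :
    pole μ (n + 1) * pole μ' (n' + 1) ∈ residueFreeSpan M (n + 1 + (n' + 1)) := by
  by_cases h : μ = μ'
  · subst h
    rw [pole_mul_self]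
    exact pole_mem_residueFreeSpan hμ (by omega) le_rfl
  · induction n generalizing n' with
    | zero =>
      induction n' with
      | zero =>
        rw [pole_mul_pole h, pole_zero, pole_zero, mul_one, one_mul]
        exact Submodule.smul_mem _ _
          (Submodule.subset_span (Or.inr ⟨μ, μ', hμ, hμ', by omega, rfl⟩))
      | succ n' ih =>
        rw [pole_mul_pole h, pole_zero, one_mul]
        exact Submodule.smul_mem _ _ (Submodule.sub_mem _
          (residueFreeSpan_mono (by omega) ih) (pole_mem_residueFreeSpan hμ' (by omega) (by omega)))
    | succ n ihn =>
      induction n' with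
      | zero =>
        rw [pole_mul_pole h, pole_zero, mul_one]
        exact Submodule.smul_mem _ _ (Submodule.sub_mem _
          (pole_mem_residueFreeSpan hμ (by omega) (by omega))
          (residueFreeSpan_mono (by omega) (ihn 0)))
      | succ n' ih =>
        rw [pole_mul_pole h]
        exact Submodule.smul_mem _ _ (Submodule.sub_mem _
          (residueFreeSpan_mono (by omega) ih) (residueFreeSpan_mono (by omega) (ihn (n' + 1))))

theorem mul_mem_residueFreeSpan {M K K' : ℕ} {f g : ℕ → ℝ⸨X⸩} (hf : f ∈ properSpan M K)
    (hg : g ∈ properSpan M K') : f * g ∈ residueFreeSpan M (K + K') := by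
  refine Submodule.span_induction (p := fun f _ => f * g ∈ residueFreeSpan M (K + K'))
    ?_ ?_ ?_ ?_ hf
  · rintro f ⟨μ, n, hμ, hn, hK, rfl⟩
    refine Submodule.span_induction
      (p := fun g _ => pole μ n * g ∈ residueFreeSpan M (K + K')) ?_ ?_ ?_ ?_ hg
    · rintro g ⟨μ', n', hμ', hn', hK', rfl⟩
      obtain ⟨n, rfl⟩ := Nat.exists_eq_add_of_le' hn
      obtain ⟨n', rfl⟩ := Nat.exists_eq_add_of_le' hn'
      exact residueFreeSpan_mono (by omega) (pole_mul_pole_mem hμ hμ' n n')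
    · rw [mul_zero]; exact Submodule.zero_mem _
    · intro x y _ _ hx hy
      rw [mul_add]; exact Submodule.add_mem _ hx hy
    · intro c x _ hx
      rw [show pole μ n * (c • x) = c • (pole μ n * x) by
        funext ν
        simp only [Pi.mul_apply, Pi.smul_apply, ← HahnSeries.C_mul_eq_smul]
        ring]
      exact Submodule.smul_mem _ _ hx
  · rw [zero_mul]; exact Submodule.zero_mem _
  · intro x y _ _ hx hy
    rw [add_mul]; exact Submodule.add_mem _ hx hy
  · intro c x _ hx
    rw [show c • x * g = c • (x * g) by
      funext ν
      simp only [Pi.mul_apply, Pi.smul_apply, ← HahnSeries.C_mul_eq_smul]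
      ring]
    exact Submodule.smul_mem _ _ hx

theorem wsum_mem_properSpan {M : ℕ} (μs : List ℕ) (hμ : ∀ μ ∈ μs, μ < M) (k : List ℕ)
    (hk : IsIndex k) (hk0 : k ≠ []) : wsum (μs.map pole) k ∈ properSpan M k.sum := by
  induction μs generalizing k with
  | nil =>
    rcases k with _ | ⟨a, l⟩
    · exact absurd rfl hk0
    · exact Submodule.zero_mem _
  | cons μ μs ih =>
    rcases k with _ | ⟨a, l⟩
    · exact absurd rfl hk0
    · have hμs : ∀ μ ∈ μs, μ < M := fun x hx => hμ x (by simp [hx])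
      have ha : 1 ≤ a := hk a (by simp)
      rw [List.map_cons, wsum_cons]
      refine Submodule.add_mem _ (ih hμs _ hk hk0) ?_
      by_cases hl : l = []
      · subst hl
        rw [wsum_nil, mul_one]
        exact pole_mem_properSpan (hμ μ (by simp)) ha (by simp)
      · rw [List.sum_cons]
        exact residueFreeSpan_le _ _ (mul_mem_residueFreeSpan
          (pole_mem_properSpan (hμ μ (by simp)) ha le_rfl) (ih hμs l hk.of_cons hl))

/-- Words with at least two letters give products of proper functions, and a one-letter word of
weight at least 2 gives poles of order at least 2; only the word `[1]` has to be excluded besides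
the empty one. -/
theorem wsum_mem_residueFreeSpan {M : ℕ} (μs : List ℕ) (hμ : ∀ μ ∈ μs, μ < M) (k : List ℕ)
    (hk : IsIndex k) (hk2 : 2 ≤ k.sum) : wsum (μs.map pole) k ∈ residueFreeSpan M k.sum := by
  induction μs with
  | nil =>
    rcases k with _ | ⟨a, l⟩
    · simp at hk2
    · exact Submodule.zero_mem _
  | cons μ μs ih =>
    rcases k with _ | ⟨a, l⟩
    · simp at hk2
    · have hμs : ∀ μ ∈ μs, μ < M := fun x hx => hμ x (by simp [hx])
      have ha : 1 ≤ a := hk a (by simp)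
      rw [List.map_cons, wsum_cons]
      refine Submodule.add_mem _ (ih hμs) ?_
      by_cases hl : l = []
      · subst hl
        rw [wsum_nil, mul_one]
        exact pole_mem_residueFreeSpan (hμ μ (by simp)) (by simpa using hk2) (by simp)
      · rw [List.sum_cons]
        exact mul_mem_residueFreeSpan (pole_mem_properSpan (hμ μ (by simp)) ha le_rfl)
          (wsum_mem_properSpan μs hμs l hk.of_cons hl)

theorem coeff_neg_pole (μ ν : ℕ) {n i : ℕ} (hn : 1 ≤ n) (hi : 1 ≤ i) :
    (pole μ n ν).coeff (-(i : ℤ)) = if ν = μ ∧ i = n then 1 else 0 := by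
  rw [pole]
  by_cases h : ν = μ
  · subst h
    rw [sub_self, shiftPoint_zero_pow, HahnSeries.coeff_single]
    simp
  · have : ((μ : ℝ) - ν) ≠ 0 := sub_ne_zero.2 (by exact_mod_cast Ne.symm h)
    rw [shiftPoint_of_ne this hn, coeff_neg_coe _ hi]
    simp [h]

theorem coeff_zero_pole (μ ν : ℕ) {n : ℕ} (hn : 1 ≤ n) :
    (pole μ n ν).coeff 0 = if μ = ν then 0 else (((μ : ℝ) - ν) ^ n)⁻¹ := by
  rw [pole]
  split_ifs with h
  · subst h
    rw [sub_self, shiftPoint_zero_pow, HahnSeries.coeff_single]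
    rw [if_neg (by omega)]
  · have : ((μ : ℝ) - ν) ≠ 0 := sub_ne_zero.2 (by exact_mod_cast h)
    rw [shiftPoint_of_ne this hn, coeff_zero_coe]
    simp [invPowSeries]

/-- The constant term of a proper rational function at a pole in terms of its principal parts. -/
theorem coeff_zero_of_mem_properSpan {M K N : ℕ} {f : ℕ → ℝ⸨X⸩} (hf : f ∈ properSpan M K) :
    (f N).coeff 0 = ∑ ν ∈ (range M).erase N, ∑ n ∈ Icc 1 K,
      (f ν).coeff (-(n : ℤ)) * (((ν : ℝ) - N) ^ n)⁻¹ := by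
  refine Submodule.span_induction (p := fun f _ => (f N).coeff 0 =
    ∑ ν ∈ (range M).erase N, ∑ n ∈ Icc 1 K, (f ν).coeff (-(n : ℤ)) * (((ν : ℝ) - N) ^ n)⁻¹)
    ?_ ?_ ?_ ?_ hf
  · rintro f ⟨μ, n, hμ, hn, hK, rfl⟩
    rw [coeff_zero_pole _ _ hn]
    have e : ∀ ν ∈ (range M).erase N, ∑ i ∈ Icc 1 K,
        (pole μ n ν).coeff (-(i : ℤ)) * (((ν : ℝ) - N) ^ i)⁻¹ =
        if ν = μ then (((ν : ℝ) - N) ^ n)⁻¹ else 0 := by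
      intro ν _
      rw [sum_eq_single n]
      · rw [coeff_neg_pole _ _ hn hn]
        split_ifs <;> simp_all
      · intro i hi hin
        rw [coeff_neg_pole _ _ hn (mem_Icc.1 hi).1, if_neg (fun h => hin h.2), zero_mul]
      · intro h
        exact absurd (mem_Icc.2 ⟨hn, hK⟩) h
    rw [sum_congr rfl e, sum_ite_eq']
    by_cases h : μ = N
    · simp [h]
    · rw [if_neg h, if_pos (by simp [h, hμ])]
  · simp
  · intro x y _ _ hx hy
    simp only [Pi.add_apply, HahnSeries.coeff_add, add_mul, sum_add_distrib, hx, hy]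
  · intro c x _ hx
    simp only [Pi.smul_apply, HahnSeries.coeff_smul, smul_eq_mul, hx, mul_sum, mul_assoc]

theorem sum_residues_of_mem_residueFreeSpan {M K : ℕ} {f : ℕ → ℝ⸨X⸩}
    (hf : f ∈ residueFreeSpan M K) : ∑ ν ∈ range M, (f ν).coeff (-((1 : ℕ) : ℤ)) = 0 := by
  refine Submodule.span_induction (p := fun f _ =>
    ∑ ν ∈ range M, (f ν).coeff (-((1 : ℕ) : ℤ)) = 0) ?_ ?_ ?_ ?_ hf
  · rintro f (⟨μ, n, hμ, hn, hK, rfl⟩ | ⟨μ, μ', hμ, hμ', hK, rfl⟩)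
    · refine sum_eq_zero fun ν _ => ?_
      rw [coeff_neg_pole _ _ (by omega) le_rfl, if_neg (by omega)]
    · simp only [Pi.sub_apply, HahnSeries.coeff_sub, sum_sub_distrib,
        coeff_neg_pole _ _ le_rfl le_rfl]
      simp [hμ, hμ']
  · simp
  · intro x y _ _ hx hy
    simp only [Pi.add_apply, HahnSeries.coeff_add, sum_add_distrib, hx, hy, add_zero]
  · intro c x _ hx
    simp only [Pi.smul_apply, HahnSeries.coeff_smul, smul_eq_mul, ← mul_sum, hx, mul_zero]

/-! ### Principal parts of nested sums -/

/-- The coefficient of `z ^ (-n)` in the part of a two-sided nested sum where one of the summation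
variables vanishes; `L` and `R` are the sums over negative and positive points. -/
noncomputable def polar (L R : List ℕ → ℝ) (n : ℕ) (k : List ℕ) : ℝ :=
  ∑ j ∈ range k.length, if n ≤ k.getD j 0 then ∑ p ∈ antidiagonal (k.getD j 0 - n),
    shiftCoeff (k.take j) L p.1 * shiftCoeff (k.drop (j + 1)) R p.2 else 0

theorem coeff_mul_pole_mul (F G : PowerSeries ℝ) (a n : ℕ) :
    ((F : ℝ⸨X⸩) * shiftPoint 0 a * (G : ℝ⸨X⸩)).coeff (-(n : ℤ)) =
      if n ≤ a then ∑ p ∈ antidiagonal (a - n), PowerSeries.coeff p.1 F * PowerSeries.coeff p.2 G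
      else 0 := by
  have e : (F : ℝ⸨X⸩) * shiftPoint 0 a * (G : ℝ⸨X⸩) =
      HahnSeries.single (-(a : ℤ)) (1 : ℝ) * ((F * G : PowerSeries ℝ) : ℝ⸨X⸩) := by
    rw [shiftPoint_zero_pow, map_mul]
    ring
  rw [e, HahnSeries.coeff_single_mul, one_mul, PowerSeries.coeff_coe]
  split_ifs with h1 h2 h2
  · omega
  · rfl
  · rw [← PowerSeries.coeff_mul]
    congr 2
    omega
  · omega

/-- Seen from -ν, the points are -ν, …, -1, then 0, then 1, …, M - 1 - ν. -/
theorem pole_range_split {M ν : ℕ} (hν : ν < M) :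
    (List.range M).map (fun μ : ℕ => shiftPoint ((μ : ℝ) - ν)) =
      ((List.range ν).map fun i : ℕ => (i : ℝ) - ν).map shiftPoint ++ shiftPoint 0 ::
        ((List.range (M - 1 - ν)).map fun i : ℕ => ((0 + 1 + i : ℕ) : ℝ)).map shiftPoint := by
  obtain ⟨B, rfl⟩ : ∃ B, M = ν + (B + 1) := ⟨M - 1 - ν, by omega⟩
  rw [List.range_add, List.map_append, List.range_succ_eq_map, List.map_cons, List.map_cons,
    List.map_map, List.map_map, List.map_map, List.map_map,
    show ν + (B + 1) - 1 - ν = B by omega]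
  congr 2
  · simp
  · refine List.map_congr_left fun i _ => ?_
    simp only [Function.comp_apply]
    congr 1
    push_cast
    ring

/-- At most one summation variable can occupy the point 0. If none does, the contribution is a power
series with constant term the convolution; if the j-th does, it is X^(-k_j) times two power series,
collected in `polar`. -/
theorem coeff_wsum_pole {M ν : ℕ} (hν : ν < M) {k : List ℕ} (hk : IsIndex k) (n : ℕ) :
    (wsum ((List.range M).map pole) k ν).coeff (-(n : ℤ)) =
      (if n = 0 then conv (signRev (trunc ν 0)) (trunc (M - 1 - ν) 0) k else 0) +
        polar (signRev (trunc ν 0)) (trunc (M - 1 - ν) 0) n k := by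
  have h1 : wsum ((List.range M).map pole) k ν =
      wsum ((List.range M).map fun μ : ℕ => shiftPoint ((μ : ℝ) - ν)) k := by
    have := map_wsum (Pi.evalRingHom (fun _ : ℕ => ℝ⸨X⸩) ν) ((List.range M).map pole) k
    rw [List.map_map] at this
    exact this
  have hL : ∀ c ∈ (List.range ν).map fun i : ℕ => (i : ℝ) - ν, c ≠ 0 := by
    intro c hc
    obtain ⟨i, hi, rfl⟩ := List.mem_map.1 hc
    rw [List.mem_range] at hi
    exact sub_ne_zero.2 (by exact_mod_cast hi.ne)
  have hR : ∀ c ∈ (List.range (M - 1 - ν)).map fun i : ℕ => ((0 + 1 + i : ℕ) : ℝ), c ≠ 0 := by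
    intro c hc
    obtain ⟨i, hi, rfl⟩ := List.mem_map.1 hc
    exact_mod_cast (by omega : 0 + 1 + i ≠ 0)
  have eL : wsum (((List.range ν).map fun i : ℕ => (i : ℝ) - ν).map
      fun (c : ℝ) (a : ℕ) => (c ^ a)⁻¹) = signRev (trunc ν 0) := by
    funext w
    rw [← wsum_neg_eq_signRev, List.map_map]
    rfl
  have eR : wsum (((List.range (M - 1 - ν)).map fun i : ℕ => ((0 + 1 + i : ℕ) : ℝ)).map
      fun (c : ℝ) (a : ℕ) => (c ^ a)⁻¹) = trunc (M - 1 - ν) 0 := by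
    funext w
    rw [trunc_eq_wsum, List.map_map]
    rfl
  have coeff_sum : ∀ (s : Finset ℕ) (F : ℕ → ℝ⸨X⸩) (i : ℤ),
      (∑ j ∈ s, F j).coeff i = ∑ j ∈ s, (F j).coeff i := by
    intro s F i
    induction s using Finset.induction_on with
    | empty => simp
    | insert a s ha ih => rw [sum_insert ha, sum_insert ha, HahnSeries.coeff_add, ih]
  rw [h1, pole_range_split hν, wsum_split, HahnSeries.coeff_add, coeff_sum, polar]
  congr 1
  · rw [conv, coeff_sum]
    split_ifs with h
    · rw [conv]
      refine sum_congr rfl fun p _ => ?_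
      rw [wsum_shiftPoint _ hL (hk.take p), wsum_shiftPoint _ hR (hk.drop p), ← map_mul, h,
        Nat.cast_zero, neg_zero, coeff_zero_coe, eL, eR, PowerSeries.coeff_mul]
      simp [shiftCoeff_zero_right]
    · refine sum_eq_zero fun p _ => ?_
      rw [wsum_shiftPoint _ hL (hk.take p), wsum_shiftPoint _ hR (hk.drop p), ← map_mul,
        coeff_neg_coe _ (by omega)]
  · refine sum_congr rfl fun j _ => ?_
    rw [wsum_shiftPoint _ hL (hk.take j), wsum_shiftPoint _ hR (hk.drop (j + 1)),
      coeff_mul_pole_mul, eL, eR]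
    simp only [PowerSeries.coeff_mk]

/-- The partial fraction decomposition of a truncated two-sided nested sum, evaluated at a pole. -/
theorem conv_add_polar_zero {M N K : ℕ} (hN : N < M) {k : List ℕ} (hk : IsIndex k) (hk0 : k ≠ [])
    (hK : k.sum ≤ K) :
    conv (signRev (trunc N 0)) (trunc (M - 1 - N) 0) k +
      polar (signRev (trunc N 0)) (trunc (M - 1 - N) 0) 0 k =
    ∑ ν ∈ (range M).erase N, ∑ n ∈ Icc 1 K,
      polar (signRev (trunc ν 0)) (trunc (M - 1 - ν) 0) n k * (((ν : ℝ) - N) ^ n)⁻¹ := by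
  have h := coeff_zero_of_mem_properSpan (N := N) (properSpan_mono hK
    (wsum_mem_properSpan (M := M) (List.range M) (fun μ hμ => List.mem_range.1 hμ) k hk hk0))
  have h0 := coeff_wsum_pole hN hk 0
  rw [Nat.cast_zero, neg_zero, if_pos rfl] at h0
  rw [← h0, h]
  refine sum_congr rfl fun ν hν => sum_congr rfl fun n hn => ?_
  rw [coeff_wsum_pole (mem_range.1 (mem_of_mem_erase hν)) hk n,
    if_neg (by have := (mem_Icc.1 hn).1; omega), zero_add]

theorem sum_polar_one (M : ℕ) {k : List ℕ} (hk : IsIndex k) (hk2 : 2 ≤ k.sum) :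
    ∑ ν ∈ range M, polar (signRev (trunc ν 0)) (trunc (M - 1 - ν) 0) 1 k = 0 := by
  rw [← sum_residues_of_mem_residueFreeSpan (wsum_mem_residueFreeSpan (M := M) (List.range M)
    (fun μ hμ => List.mem_range.1 hμ) k hk hk2)]
  refine sum_congr rfl fun ν hν => ?_
  rw [coeff_wsum_pole (mem_range.1 hν) hk 1, if_neg one_ne_zero, zero_add]

/-! ### Regularized two-sided sums -/

/-- The exponential acts on the left of the distinguished letter, and by `shiftCoeff_conv` it
commutes with the Taylor shift there. What remains is exchanging the cut position p ≤ j with j. -/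
theorem polar_conv_expOne (h : ℝ) (X S : List ℕ → ℝ) (n : ℕ) {k : List ℕ} (hk : IsIndex k) :
    polar (conv (expOne h) X) S n k = conv (expOne h) (polar X S n) k := by
  have e1 : ∀ j ∈ range k.length, (if n ≤ k.getD j 0 then
      ∑ q ∈ antidiagonal (k.getD j 0 - n), shiftCoeff (k.take j) (conv (expOne h) X) q.1 *
        shiftCoeff (k.drop (j + 1)) S q.2 else 0) =
      ∑ p ∈ range (j + 1), expOne h (k.take p) * (if n ≤ k.getD j 0 then
        ∑ q ∈ antidiagonal (k.getD j 0 - n), shiftCoeff ((k.take j).drop p) X q.1 *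
          shiftCoeff (k.drop (j + 1)) S q.2 else 0) := by
    intro j hj
    rw [mem_range] at hj
    split_ifs with hn
    · simp only [mul_sum]
      rw [sum_comm]
      refine sum_congr rfl fun q _ => ?_
      rw [shiftCoeff_conv (fun w hw => expOne_ne h hw) X (hk.take j), conv, List.length_take,
        min_eq_left hj.le, sum_mul]
      refine sum_congr rfl fun p hp => ?_
      rw [mem_range] at hp
      rw [List.take_take, min_eq_left (by omega), mul_assoc]
    · simp
  have e2 : ∀ p ∈ range (k.length + 1), expOne h (k.take p) * polar X S n (k.drop p) =
      ∑ j ∈ Ico p k.length, expOne h (k.take p) * (if n ≤ k.getD j 0 then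
        ∑ q ∈ antidiagonal (k.getD j 0 - n), shiftCoeff ((k.take j).drop p) X q.1 *
          shiftCoeff (k.drop (j + 1)) S q.2 else 0) := by
    intro p _
    rw [polar, mul_sum, sum_Ico_eq_sum_range, List.length_drop]
    refine sum_congr rfl fun j _ => ?_
    have h1 : (k.drop p).getD j 0 = k.getD (p + j) 0 := by simp [List.getD_eq_getElem?_getD]
    rw [h1, List.drop_take, List.drop_drop, Nat.add_sub_cancel_left, ← add_assoc]
  rw [polar, sum_congr rfl e1, conv, sum_congr rfl e2]
  refine sum_comm' fun j p => ?_
  simp only [mem_range, mem_Ico]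
  omega

/-- The values of `signRev` at the regularized truncated sums. -/
noncomputable def regNeg (A : ℕ) : List ℕ → ℝ := signRev (regTrunc A)

/-- The sign reversal turns `expOne` of -H_A into `expOne` of H_A. Thus `expOne h` regularizes the
pole with A negative points exactly when h = H_A, and otherwise leaves the exponential of h - H_A.
-/
theorem conv_expOne_signRev_trunc (h : ℝ) (A : ℕ) :
    conv (expOne h) (signRev (trunc A 0)) = conv (expOne (h - harmonic A)) (regNeg A) := by
  have e : regNeg A = conv (expOne (harmonic A)) (signRev (trunc A 0)) := by
    funext k
    rw [regNeg, regTrunc, signRev_conv]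
    refine conv_congr_left _ _ fun p => ?_
    rw [signRev_expOne, neg_neg]
  have e' : conv (expOne (h - harmonic A)) (expOne (harmonic A)) = expOne h := by
    funext k
    rw [conv_expOne, sub_add_cancel]
  funext k
  rw [e, ← conv_assoc, e']

theorem conv_expOne_polar (h : ℝ) (A : ℕ) (S : List ℕ → ℝ) (n : ℕ) {k : List ℕ} (hk : IsIndex k) :
    conv (expOne h) (polar (signRev (trunc A 0)) S n) k =
      conv (expOne (h - harmonic A)) (polar (regNeg A) S n) k := by
  rw [← polar_conv_expOne h _ _ _ hk, ← polar_conv_expOne _ _ _ _ hk, conv_expOne_signRev_trunc]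

theorem expOne_eq_zero_of_admissible (h : ℝ) {k : List ℕ} (hk : IsAdmissible k) (hk0 : k ≠ []) :
    expOne h k = 0 := by
  rcases admissible_cases hk with rfl | ⟨l, a, rfl, _, ha⟩
  · exact absurd rfl hk0
  · exact expOne_ne h ⟨a, by simp, by omega⟩

theorem two_le_sum_of_admissible {k : List ℕ} (hk : IsAdmissible k) (hk0 : k ≠ []) :
    2 ≤ k.sum := by
  rcases admissible_cases hk with rfl | ⟨l, a, rfl, _, ha⟩
  · exact absurd rfl hk0
  · simp
    omega

theorem sum_drop_le (k : List ℕ) (p : ℕ) : (k.drop p).sum ≤ k.sum := by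
  rw [← List.sum_take_add_sum_drop k p]
  omega

/-- The identities to be regularized fail on the empty word; the term in which the suffix is empty
drops out because `expOne` vanishes on `k` itself. -/
theorem conv_expOne_congr {h : ℝ} {f g : List ℕ → ℝ} {k : List ℕ} (hk : IsAdmissible k)
    (hk0 : k ≠ []) (hfg : ∀ p < k.length, f (k.drop p) = g (k.drop p)) :
    conv (expOne h) f k = conv (expOne h) g k := by
  rw [conv, conv]
  refine sum_congr rfl fun p hp => ?_
  rw [mem_range] at hp
  by_cases h : p = k.length
  · rw [h, List.take_length, expOne_eq_zero_of_admissible _ hk hk0, zero_mul, zero_mul]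
  · rw [hfg p (by omega)]

/-- The regularized partial fraction decomposition at the middle of the range. -/
theorem regNeg_partial_fraction (N : ℕ) {K : ℕ} {k : List ℕ} (hk : IsAdmissible k) (hk0 : k ≠ [])
    (hK : k.sum ≤ K) :
    conv (regNeg N) (trunc N 0) k + polar (regNeg N) (trunc N 0) 0 k =
    ∑ ν ∈ (range (2 * N + 1)).erase N, ∑ n ∈ Icc 1 K,
      conv (expOne (harmonic N - harmonic ν)) (polar (regNeg ν) (trunc (2 * N - ν) 0) n) k *
        (((ν : ℝ) - N) ^ n)⁻¹ := by
  set h : ℝ := (harmonic N : ℝ) with hh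
  -- With M = 2N + 1 the pole N has N points on either side, which makes the later sum over ν ≠ N
  -- symmetric.
  have hM : ∀ ν, 2 * N + 1 - 1 - ν = 2 * N - ν := fun ν => by omega
  have hMN : 2 * N - N = N := by omega
  have e0 : conv (expOne h) (signRev (trunc N 0)) = regNeg N := by
    funext w
    rw [conv_expOne_signRev_trunc, hh, sub_self, conv_expOne_zero]
  have key : conv (expOne h) (fun w => conv (signRev (trunc N 0)) (trunc N 0) w +
      polar (signRev (trunc N 0)) (trunc N 0) 0 w) k =
      conv (expOne h) (fun w => ∑ ν ∈ (range (2 * N + 1)).erase N, ∑ n ∈ Icc 1 K,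
      polar (signRev (trunc ν 0)) (trunc (2 * N - ν) 0) n w * (((ν : ℝ) - N) ^ n)⁻¹) k := by
    refine conv_expOne_congr hk hk0 fun p hp => ?_
    have := conv_add_polar_zero (M := 2 * N + 1) (N := N) (K := K) (by omega) (hk.1.drop p)
      (by simp; omega) ((sum_drop_le k p).trans hK)
    simpa only [hM, hMN] using this
  have eL : conv (expOne h) (fun w => conv (signRev (trunc N 0)) (trunc N 0) w +
      polar (signRev (trunc N 0)) (trunc N 0) 0 w) k =
      conv (regNeg N) (trunc N 0) k + polar (regNeg N) (trunc N 0) 0 k := by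
    rw [← e0, polar_conv_expOne h _ _ _ hk.1, conv_assoc]
    simp only [conv, mul_add, sum_add_distrib]
  rw [← eL, key]
  simp only [← conv_expOne_polar h _ _ _ hk.1]
  simp only [conv, mul_sum, sum_mul]
  rw [sum_comm]
  refine sum_congr rfl fun ν _ => ?_
  rw [sum_comm]
  exact sum_congr rfl fun n _ => sum_congr rfl fun p _ => by ring

theorem sum_regNeg_polar_one (N : ℕ) {k : List ℕ} (hk : IsAdmissible k) (hk0 : k ≠ []) :
    ∑ ν ∈ range (2 * N + 1),
      conv (expOne (harmonic N - harmonic ν)) (polar (regNeg ν) (trunc (2 * N - ν) 0) 1) k = 0 := by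
  have key : conv (expOne (harmonic N)) (fun w => ∑ ν ∈ range (2 * N + 1),
      polar (signRev (trunc ν 0)) (trunc (2 * N - ν) 0) 1 w) k =
      conv (expOne (harmonic N)) (fun _ => 0) k := by
    refine conv_expOne_congr hk hk0 fun p hp => ?_
    have h0 : k.drop p ≠ [] := by simp; omega
    exact sum_polar_one (2 * N + 1) (hk.1.drop p) (two_le_sum_of_admissible (hk.drop p) h0)
  simp only [← conv_expOne_polar (harmonic N : ℝ) _ _ _ hk.1]
  have e : conv (expOne (harmonic N : ℝ)) (fun _ => (0 : ℝ)) k = 0 := by simp [conv]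
  rw [e] at key
  rw [← key]
  simp only [conv, mul_sum]
  rw [sum_comm]

/-! ### Rates of convergence -/

/-- Convergence with rate the inverse square root in both variables. -/
def BiRate (u : ℕ → ℕ → ℝ) (l : ℝ) : Prop :=
  ∃ C, 0 ≤ C ∧ ∀ A B : ℕ, |u A B - l| ≤ C * (1 / √((A : ℝ) + 1) + 1 / √((B : ℝ) + 1))

theorem one_div_sqrt_le_one (A : ℕ) : 1 / √((A : ℝ) + 1) ≤ 1 := by
  rw [div_le_one (by positivity), Real.one_le_sqrt]
  linarith [A.cast_nonneg (α := ℝ)]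

theorem BiRate.of_left {f : ℕ → ℝ} {l : ℝ}
    (h : ∃ C, ∀ N : ℕ, |f N - l| ≤ C / √((N : ℝ) + 1)) : BiRate (fun A _ => f A) l := by
  obtain ⟨C, hC⟩ := h
  refine ⟨|C|, abs_nonneg _, fun A B => (hC A).trans ?_⟩
  rw [div_eq_mul_one_div]
  have h1 : 0 ≤ 1 / √((A : ℝ) + 1) := by positivity
  have h2 : 0 ≤ 1 / √((B : ℝ) + 1) := by positivity
  exact mul_le_mul (le_abs_self _) (by linarith) h1 (abs_nonneg _)

theorem BiRate.swap {u : ℕ → ℕ → ℝ} {l : ℝ} (h : BiRate u l) : BiRate (fun A B => u B A) l := by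
  obtain ⟨C, h0, hC⟩ := h
  exact ⟨C, h0, fun A B => (hC B A).trans_eq (by rw [add_comm])⟩

theorem BiRate.zero : BiRate (fun _ _ => 0) 0 := ⟨0, le_rfl, fun A B => by simp⟩

theorem BiRate.add {u v : ℕ → ℕ → ℝ} {l m : ℝ} (hu : BiRate u l) (hv : BiRate v m) :
    BiRate (fun A B => u A B + v A B) (l + m) := by
  obtain ⟨C, h0, hC⟩ := hu
  obtain ⟨D, h0', hD⟩ := hv
  refine ⟨C + D, by positivity, fun A B => ?_⟩
  rw [add_sub_add_comm, add_mul]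
  exact (abs_add_le _ _).trans (add_le_add (hC A B) (hD A B))

theorem BiRate.sum {ι : Type*} (s : Finset ι) {u : ι → ℕ → ℕ → ℝ} {l : ι → ℝ}
    (h : ∀ i ∈ s, BiRate (u i) (l i)) :
    BiRate (fun A B => ∑ i ∈ s, u i A B) (∑ i ∈ s, l i) := by
  classical
  induction s using Finset.induction_on with
  | empty => simpa using BiRate.zero
  | insert a s ha ih =>
    simp only [sum_insert ha]
    exact (h a (by simp)).add (ih fun i hi => h i (by simp [hi]))

theorem BiRate.mul {u v : ℕ → ℕ → ℝ} {l m : ℝ} (hu : BiRate u l) (hv : BiRate v m) :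
    BiRate (fun A B => u A B * v A B) (l * m) := by
  obtain ⟨C, h0, hC⟩ := hu
  obtain ⟨D, h0', hD⟩ := hv
  refine ⟨2 * C * D + |l| * D + C * |m|, by positivity, fun A B => ?_⟩
  set ε := 1 / √((A : ℝ) + 1) + 1 / √((B : ℝ) + 1) with hε
  have hε0 : 0 ≤ ε := by positivity
  -- This bounds one factor of the product of the two errors, so that the quadratic term is again of
  -- order ε.
  have hε2 : ε ≤ 2 := by linarith [one_div_sqrt_le_one A, one_div_sqrt_le_one B]
  have e : u A B * v A B - l * m =
      (u A B - l) * (v A B - m) + l * (v A B - m) + (u A B - l) * m := by ring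
  have h1 : |(u A B - l) * (v A B - m)| ≤ (C * 2) * (D * ε) := by
    rw [abs_mul]
    exact mul_le_mul ((hC A B).trans (by gcongr)) (hD A B) (abs_nonneg _) (by positivity)
  have h2 : |l * (v A B - m)| ≤ |l| * (D * ε) := by
    rw [abs_mul]
    exact mul_le_mul_of_nonneg_left (hD A B) (abs_nonneg _)
  have h3 : |(u A B - l) * m| ≤ (C * ε) * |m| := by
    rw [abs_mul]
    exact mul_le_mul_of_nonneg_right (hC A B) (abs_nonneg _)
  rw [e]
  refine (abs_add_three _ _ _).trans ((add_le_add (add_le_add h1 h2) h3).trans_eq ?_)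
  ring

theorem BiRate.tendsto {u : ℕ → ℕ → ℝ} {l : ℝ} (h : BiRate u l) :
    Tendsto (fun N => u N N) atTop (𝓝 l) := by
  obtain ⟨C, h0, hC⟩ := h
  rw [tendsto_iff_norm_sub_tendsto_zero]
  have h1 : Tendsto (fun N : ℕ => 1 / √((N : ℝ) + 1)) atTop (𝓝 0) := by
    have : Tendsto (fun N : ℕ => √((N : ℝ) + 1)) atTop atTop :=
      Real.tendsto_sqrt_atTop.comp (tendsto_natCast_atTop_atTop.atTop_add tendsto_const_nhds)
    simp only [one_div]
    exact this.inv_tendsto_atTop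
  have h2 := (h1.add h1).const_mul C
  rw [add_zero, mul_zero] at h2
  exact squeeze_zero (fun _ => norm_nonneg _) (fun N => hC N N) h2

theorem abs_signRev_sub (f g : List ℕ → ℝ) (k : List ℕ) :
    |signRev f k - signRev g k| = |f k.reverse - g k.reverse| := by
  rw [signRev, signRev, ← mul_sub, abs_mul, abs_pow, abs_neg, abs_one, one_pow, one_mul]

theorem biRate_shiftCoeff_regNeg {k : List ℕ} (hk : IsIndex k) (a : ℕ) :
    BiRate (fun A _ => shiftCoeff k (regNeg A) a) (shiftCoeff k (signRev zetaReg) a) := by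
  refine BiRate.of_left (shiftCoeff_sub_le k regNeg (signRev zetaReg) a fun w hw => ?_)
  simp only [regNeg, abs_signRev_sub]
  exact regTrunc_sub_zetaReg_le (hk.of_forall₂ hw).reverse

theorem biRate_shiftCoeff_trunc {k : List ℕ} (hk : IsAdmissible k) (a : ℕ) :
    BiRate (fun _ B => shiftCoeff k (trunc B 0) a) (shiftCoeff k zetaReg a) := by
  refine BiRate.swap (u := fun B _ => shiftCoeff k (trunc B 0) a)
    (BiRate.of_left (shiftCoeff_sub_le k (fun B => trunc B 0) zetaReg a fun w hw => ?_))
  have hw' := hk.of_forall₂ hw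
  rw [isStuffleRegularization_zetaReg.eq_zeta w hw']
  exact trunc_sub_zeta_le hw'

/-- Only the prefixes need regularizing: every suffix of an admissible word is empty or admissible.
-/
theorem biRate_polar {k : List ℕ} (hk : IsAdmissible k) (n : ℕ) :
    BiRate (fun A B => polar (regNeg A) (trunc B 0) n k)
      (polar (signRev zetaReg) zetaReg n k) := by
  simp only [polar]
  refine BiRate.sum _ fun j _ => ?_
  split_ifs
  · exact BiRate.sum _ fun p _ => (biRate_shiftCoeff_regNeg (hk.1.take j) p.1).mul
      (biRate_shiftCoeff_trunc (hk.drop (j + 1)) p.2)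
  · exact BiRate.zero

theorem biRate_conv {k : List ℕ} (hk : IsAdmissible k) :
    BiRate (fun A B => conv (regNeg A) (trunc B 0) k) (conv (signRev zetaReg) zetaReg k) := by
  simp only [conv]
  refine BiRate.sum _ fun p _ => ?_
  have h1 := biRate_shiftCoeff_regNeg (hk.1.take p) 0
  have h2 := biRate_shiftCoeff_trunc (hk.drop p) 0
  simp only [shiftCoeff_zero_right] at h1 h2
  exact h1.mul h2

/-! ### Error estimates -/

theorem harmonic_nonneg_real (n : ℕ) : (0 : ℝ) ≤ harmonic n := by
  rw [← trunc_one_eq]; exact trunc_nonneg _ _ _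

theorem harmonic_mono_real : Monotone fun n => (harmonic n : ℝ) := by
  apply monotone_nat_of_le_succ
  intro n
  rw [harmonic_succ]
  push_cast
  have : (0 : ℝ) ≤ ((n : ℝ) + 1)⁻¹ := by positivity
  linarith

theorem harmonic_add_sub_le (n m : ℕ) :
    (harmonic (n + m) : ℝ) - harmonic n ≤ m / ((n : ℝ) + 1) := by
  induction m with
  | zero => simp
  | succ m ih =>
    rw [← add_assoc, harmonic_succ]
    push_cast
    have h : ((n : ℝ) + m + 1)⁻¹ ≤ 1 / ((n : ℝ) + 1) := by
      rw [← one_div]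
      apply one_div_le_one_div_of_le (by positivity)
      linarith [m.cast_nonneg (α := ℝ)]
    rw [add_div]
    linarith

/-- The points at distance `m` from `N`. -/
def AtDist (N m ν : ℕ) : Prop := ν = N + m ∨ ν + m = N

theorem AtDist.rate_le {N m ν : ℕ} (h : AtDist N m ν) (hm : m ≤ N) :
    1 / √((ν : ℝ) + 1) + 1 / √(((2 * N - ν : ℕ) : ℝ) + 1) ≤ 2 * (1 / √(((N - m : ℕ) : ℝ) + 1)) := by
  have key : ∀ a : ℕ, N - m ≤ a → 1 / √((a : ℝ) + 1) ≤ 1 / √(((N - m : ℕ) : ℝ) + 1) := by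
    intro a ha
    apply one_div_le_one_div_of_le (by positivity)
    apply Real.sqrt_le_sqrt
    have : ((N - m : ℕ) : ℝ) ≤ a := by exact_mod_cast ha
    linarith
  have h1 := key ν (by rcases h with h | h <;> omega)
  have h2 := key (2 * N - ν) (by rcases h with h | h <;> omega)
  linarith

theorem AtDist.abs_harmonic_sub_le {N m ν : ℕ} (h : AtDist N m ν) (hm : m ≤ N) :
    |(harmonic N : ℝ) - harmonic ν| ≤ m * (1 / √(((N - m : ℕ) : ℝ) + 1)) := by
  have hs : ((N - m : ℕ) : ℝ) + 1 = √(((N - m : ℕ) : ℝ) + 1) * √(((N - m : ℕ) : ℝ) + 1) :=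
    (Real.mul_self_sqrt (by positivity)).symm
  have h1 : (1 : ℝ) ≤ √(((N - m : ℕ) : ℝ) + 1) := by
    rw [Real.one_le_sqrt]
    linarith [(N - m).cast_nonneg (α := ℝ)]
  have h2 : 1 / (((N - m : ℕ) : ℝ) + 1) ≤ 1 / √(((N - m : ℕ) : ℝ) + 1) := by
    apply one_div_le_one_div_of_le (by positivity)
    calc √(((N - m : ℕ) : ℝ) + 1) ≤ √(((N - m : ℕ) : ℝ) + 1) * √(((N - m : ℕ) : ℝ) + 1) :=
          le_mul_of_one_le_left (by positivity) h1
      _ = _ := hs.symm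
  have h3 : ∀ a : ℕ, N - m ≤ a → (m : ℝ) / ((a : ℝ) + 1) ≤
      m * (1 / √(((N - m : ℕ) : ℝ) + 1)) := by
    intro a ha
    rw [div_eq_mul_one_div]
    refine mul_le_mul_of_nonneg_left (le_trans ?_ h2) (by positivity)
    apply one_div_le_one_div_of_le (by positivity)
    have : ((N - m : ℕ) : ℝ) ≤ a := by exact_mod_cast ha
    linarith
  rcases h with rfl | rfl
  · rw [abs_sub_comm, abs_of_nonneg (sub_nonneg.2 (harmonic_mono_real (Nat.le_add_right N m)))]
    exact (harmonic_add_sub_le N m).trans (h3 N (by omega))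
  · rw [abs_of_nonneg (sub_nonneg.2 (harmonic_mono_real (Nat.le_add_right ν m)))]
    exact (harmonic_add_sub_le ν m).trans (h3 ν (by omega))

theorem one_add_abs_harmonic_sub_le {N ν : ℕ} (h : ν ≤ 2 * N) :
    1 + |(harmonic N : ℝ) - harmonic ν| ≤ 1 + harmonic (2 * N) := by
  have h1 := harmonic_mono_real h
  have h2 := harmonic_mono_real (show N ≤ 2 * N by omega)
  simp only at h1 h2
  have h3 := harmonic_nonneg_real N
  have h4 := harmonic_nonneg_real ν
  gcongr
  rw [abs_le]
  constructor <;> linarith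

theorem abs_expOne_le (x : ℝ) (k : List ℕ) : |expOne x k| ≤ |x| ^ k.length := by
  rw [expOne]
  split_ifs
  · rw [abs_div, abs_pow, Nat.abs_cast]
    apply div_le_self (by positivity)
    exact_mod_cast Nat.one_le_iff_ne_zero.2 (Nat.factorial_ne_zero _)
  · simp

theorem abs_expOne_le_pow {x : ℝ} {k : List ℕ} {L : ℕ} (hL : k.length ≤ L) :
    |expOne x k| ≤ (1 + |x|) ^ L := by
  refine (abs_expOne_le x k).trans ?_
  have := abs_nonneg x
  exact (pow_le_pow_left₀ this (by linarith) _).trans (pow_le_pow_right₀ (by linarith) hL)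

theorem abs_expOne_le_mul_pow {x : ℝ} {k : List ℕ} {L : ℕ} (hk : k ≠ []) (hL : k.length ≤ L) :
    |expOne x k| ≤ |x| * (1 + |x|) ^ L := by
  refine (abs_expOne_le x k).trans ?_
  obtain ⟨n, hn⟩ := Nat.exists_eq_succ_of_ne_zero (List.length_pos_iff.2 hk).ne'
  have := abs_nonneg x
  rw [hn, pow_succ']
  refine mul_le_mul_of_nonneg_left ?_ this
  exact (pow_le_pow_left₀ this (by linarith) _).trans (pow_le_pow_right₀ (by linarith) (by omega))

theorem conv_eq_add_sum (f g : List ℕ → ℝ) (k : List ℕ) :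
    conv f g k = f [] * g k + ∑ p ∈ range k.length, f (k.take (p + 1)) * g (k.drop (p + 1)) := by
  rw [conv, sum_range_succ', add_comm]
  simp

/-- The coefficients of the principal parts of the regularized two-sided sums. -/
noncomputable def regPolar (N ν n : ℕ) (k : List ℕ) : ℝ :=
  conv (expOne (harmonic N - harmonic ν)) (polar (regNeg ν) (trunc (2 * N - ν) 0) n) k

/-- The limits of `regPolar`. -/
noncomputable def zetaPolar (n : ℕ) (k : List ℕ) : ℝ := polar (signRev zetaReg) zetaReg n k

/-- The term with empty prefix converges at the known rate. Every other term contains `expOne` on a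
nonempty word, hence a factor |H_N - H_ν|, of size at most m/√(N - m + 1). The extra m is harmless
only against poles of order at least 2. -/
theorem regPolar_sub_le (n : ℕ) {k : List ℕ} (hk : IsAdmissible k) :
    ∃ C, 0 ≤ C ∧ ∀ N m ν, 1 ≤ m → m ≤ N → AtDist N m ν → |regPolar N ν n k - zetaPolar n k| ≤
      C * (1 + (harmonic (2 * N) : ℝ)) ^ k.length * (m * (1 / √(((N - m : ℕ) : ℝ) + 1))) := by
  have hr := fun p => biRate_polar (hk.drop p) n
  choose C hC0 hC using hr
  refine ⟨2 * C 0 + ∑ p ∈ range k.length,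
    (|zetaPolar n (k.drop (p + 1))| + 2 * C (p + 1)), ?_, ?_⟩
  · refine add_nonneg (by linarith [hC0 0]) (sum_nonneg fun p _ => ?_)
    have := hC0 (p + 1)
    positivity
  intro N m ν hm1 hm hν
  set ε := 1 / √(((N - m : ℕ) : ℝ) + 1) with hε
  have hε0 : 0 ≤ ε := by positivity
  have hε1 : ε ≤ 1 := one_div_sqrt_le_one (N - m)
  set x := (harmonic N : ℝ) - harmonic ν with hx
  have hxm : |x| ≤ m * ε := hν.abs_harmonic_sub_le hm
  have hx1 : 1 + |x| ≤ 1 + harmonic (2 * N) :=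
    one_add_abs_harmonic_sub_le (by rcases hν with h | h <;> omega)
  set P := (1 + (harmonic (2 * N) : ℝ)) ^ k.length with hP
  have hP1 : 1 ≤ P := one_le_pow₀ (by linarith [harmonic_nonneg_real (2 * N)])
  have hxP : (1 + |x|) ^ k.length ≤ P := pow_le_pow_left₀ (by positivity) hx1 _
  have hm' : (1 : ℝ) ≤ m := by exact_mod_cast hm1
  have hrate : ∀ p, |polar (regNeg ν) (trunc (2 * N - ν) 0) n (k.drop p) -
      zetaPolar n (k.drop p)| ≤ 2 * C p * ε := by
    intro p
    refine (hC p ν (2 * N - ν)).trans ?_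
    have := mul_le_mul_of_nonneg_left (hν.rate_le hm) (hC0 p)
    linarith
  rw [regPolar, conv_eq_add_sum, expOne_nil, one_mul, add_sub_right_comm, mul_assoc, add_mul]
  refine (abs_add_le _ _).trans (add_le_add ?_ ?_)
  · have h := hrate 0
    rw [List.drop_zero] at h
    refine h.trans (mul_le_mul_of_nonneg_left ?_ (by linarith [hC0 0]))
    calc ε ≤ m * ε := le_mul_of_one_le_left hε0 hm'
      _ ≤ P * (m * ε) := le_mul_of_one_le_left (by positivity) hP1
  · rw [sum_mul]
    refine (abs_sum_le_sum_abs _ _).trans (sum_le_sum fun p hp => ?_)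
    rw [mem_range] at hp
    rw [abs_mul, mul_comm]
    refine mul_le_mul ?_ ?_ (abs_nonneg _) (by have := hC0 (p + 1); positivity)
    · have h := hrate (p + 1)
      have h2 := abs_add_le (polar (regNeg ν) (trunc (2 * N - ν) 0) n (k.drop (p + 1)) -
        zetaPolar n (k.drop (p + 1))) (zetaPolar n (k.drop (p + 1)))
      rw [sub_add_cancel] at h2
      have h3 : 2 * C (p + 1) * ε ≤ 2 * C (p + 1) :=
        mul_le_of_le_one_right (by linarith [hC0 (p + 1)]) hε1
      linarith
    · calc |expOne x (k.take (p + 1))| ≤ |x| * (1 + |x|) ^ k.length :=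
            abs_expOne_le_mul_pow (by
              intro h
              rcases List.take_eq_nil_iff.1 h with h | h
              · omega
              · simp [h] at hp) (by simp)
        _ ≤ (m * ε) * P := mul_le_mul hxm hxP (by positivity) (by positivity)
        _ = P * (m * ε) := mul_comm _ _

/-- When the limits at proper suffixes vanish, those terms are small by themselves, so |H_N - H_ν|
need not supply the smallness and the factor m disappears. This is the version needed for simple
poles. -/
theorem regPolar_sub_le_of_vanish (n : ℕ) {k : List ℕ} (hk : IsAdmissible k)
    (hv : ∀ p, 1 ≤ p → zetaPolar n (k.drop p) = 0) :
    ∃ C, 0 ≤ C ∧ ∀ N m ν, m ≤ N → AtDist N m ν → |regPolar N ν n k - zetaPolar n k| ≤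
      C * (1 + (harmonic (2 * N) : ℝ)) ^ k.length * (1 / √(((N - m : ℕ) : ℝ) + 1)) := by
  have hr := fun p => biRate_polar (hk.drop p) n
  choose C hC0 hC using hr
  refine ⟨2 * C 0 + ∑ p ∈ range k.length, 2 * C (p + 1), ?_, ?_⟩
  · exact add_nonneg (by linarith [hC0 0]) (sum_nonneg fun p _ => by linarith [hC0 (p + 1)])
  intro N m ν hm hν
  set ε := 1 / √(((N - m : ℕ) : ℝ) + 1) with hε
  have hε0 : 0 ≤ ε := by positivity
  set x := (harmonic N : ℝ) - harmonic ν with hx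
  have hx1 : 1 + |x| ≤ 1 + harmonic (2 * N) :=
    one_add_abs_harmonic_sub_le (by rcases hν with h | h <;> omega)
  set P := (1 + (harmonic (2 * N) : ℝ)) ^ k.length with hP
  have hP1 : 1 ≤ P := one_le_pow₀ (by linarith [harmonic_nonneg_real (2 * N)])
  have hxP : (1 + |x|) ^ k.length ≤ P := pow_le_pow_left₀ (by positivity) hx1 _
  have hrate : ∀ p, |polar (regNeg ν) (trunc (2 * N - ν) 0) n (k.drop p) -
      zetaPolar n (k.drop p)| ≤ 2 * C p * ε := by
    intro p
    refine (hC p ν (2 * N - ν)).trans ?_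
    have := mul_le_mul_of_nonneg_left (hν.rate_le hm) (hC0 p)
    linarith
  rw [regPolar, conv_eq_add_sum, expOne_nil, one_mul, add_sub_right_comm, mul_assoc, add_mul]
  refine (abs_add_le _ _).trans (add_le_add ?_ ?_)
  · have h := hrate 0
    rw [List.drop_zero] at h
    refine h.trans (mul_le_mul_of_nonneg_left ?_ (by linarith [hC0 0]))
    exact le_mul_of_one_le_left hε0 hP1
  · rw [sum_mul]
    refine (abs_sum_le_sum_abs _ _).trans (sum_le_sum fun p hp => ?_)
    rw [abs_mul]
    have h := hrate (p + 1)
    rw [hv (p + 1) (by omega), sub_zero] at h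
    calc |expOne x (k.take (p + 1))| * _ ≤ P * (2 * C (p + 1) * ε) :=
          mul_le_mul ((abs_expOne_le_pow (by simp)).trans hxP) h (abs_nonneg _) (by positivity)
      _ = 2 * C (p + 1) * (P * ε) := by ring

/-! ### Symmetric sums and elementary estimates -/

theorem sum_range_symm (N : ℕ) (f : ℕ → ℝ) : ∑ ν ∈ range (2 * N + 1), f ν =
    f N + ∑ m ∈ range N, (f (N + (m + 1)) + f (N - (m + 1))) := by
  rw [show 2 * N + 1 = N + (1 + N) by ring, sum_range_add, sum_range_add,
    ← sum_range_reflect f N, sum_add_distrib]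
  have h1 : ∑ m ∈ range N, f (N - 1 - m) = ∑ m ∈ range N, f (N - (m + 1)) :=
    sum_congr rfl fun m _ => by congr 1; omega
  have h2 : ∑ m ∈ range N, f (N + (1 + m)) = ∑ m ∈ range N, f (N + (m + 1)) :=
    sum_congr rfl fun m _ => by rw [add_comm 1 m]
  rw [h1, h2]
  simp
  ring

theorem sum_erase_symm (N : ℕ) (f : ℕ → ℝ) : ∑ ν ∈ (range (2 * N + 1)).erase N, f ν =
    ∑ m ∈ range N, (f (N + (m + 1)) + f (N - (m + 1))) := by
  have h := add_sum_erase (range (2 * N + 1)) f (mem_range.2 (show N < 2 * N + 1 by omega))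
  rw [sum_range_symm] at h
  linarith

theorem sum_one_div_sqrt_le (N : ℕ) :
    ∑ m ∈ range N, 1 / √(((N - (m + 1) : ℕ) : ℝ) + 1) ≤ √((N : ℝ) + 1) * harmonic N := by
  have e : ∑ m ∈ range N, 1 / √(((N - (m + 1) : ℕ) : ℝ) + 1) =
      ∑ m ∈ range N, 1 / √((m : ℝ) + 1) := by
    rw [← sum_range_reflect (fun m : ℕ => 1 / √((m : ℝ) + 1))]
    refine sum_congr rfl fun m _ => ?_
    rw [show N - (m + 1) = N - 1 - m by omega]
  rw [e, harmonic]
  push_cast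
  rw [mul_sum]
  refine sum_le_sum fun m hm => ?_
  have hm' : (m : ℝ) ≤ N := by exact_mod_cast (mem_range.1 hm).le
  have hs : ((m : ℝ) + 1) = √((m : ℝ) + 1) * √((m : ℝ) + 1) :=
    (Real.mul_self_sqrt (by positivity)).symm
  rw [← div_eq_mul_inv, div_le_div_iff₀ (by positivity) (by positivity), one_mul]
  calc (m : ℝ) + 1 = √((m : ℝ) + 1) * √((m : ℝ) + 1) := hs
    _ ≤ _ := by gcongr

/-- Put a = m + 1 and b = N - m, so a + b = N + 1 and 1/a + 1/b = (N + 1)/(ab). Since √b ≤ √(N + 1),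
the term 1/(a√b) is at most (1/a + 1/b)/√(N + 1), and both sums are harmonic. -/
theorem sum_one_div_mul_sqrt_le (N : ℕ) :
    ∑ m ∈ range N, 1 / ((m : ℝ) + 1) * (1 / √(((N - (m + 1) : ℕ) : ℝ) + 1)) ≤
      2 * harmonic N / √((N : ℝ) + 1) := by
  have hterm : ∀ m ∈ range N, 1 / ((m : ℝ) + 1) * (1 / √(((N - (m + 1) : ℕ) : ℝ) + 1)) ≤
      (1 / ((m : ℝ) + 1) + 1 / (((N - 1 - m : ℕ) : ℝ) + 1)) / √((N : ℝ) + 1) := by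
    intro m hm
    rw [mem_range] at hm
    obtain ⟨r, rfl⟩ : ∃ r, N = m + 1 + r := ⟨N - (m + 1), by omega⟩
    rw [show m + 1 + r - (m + 1) = r by omega, show m + 1 + r - 1 - m = r by omega]
    push_cast
    have hm0 : (0 : ℝ) < (m : ℝ) + 1 := by positivity
    have hr0 : (0 : ℝ) < (r : ℝ) + 1 := by positivity
    have e : (1 / ((m : ℝ) + 1) + 1 / ((r : ℝ) + 1)) =
        1 / ((m : ℝ) + 1) * (1 / ((r : ℝ) + 1)) * ((m : ℝ) + 1 + r + 1) := by
      field_simp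
      ring
    have hs : ((m : ℝ) + 1 + r + 1) / √((m : ℝ) + 1 + r + 1) = √((m : ℝ) + 1 + r + 1) :=
      Real.div_sqrt
    have hs2 : 1 / √((r : ℝ) + 1) = 1 / ((r : ℝ) + 1) * √((r : ℝ) + 1) := by
      rw [one_div_mul_eq_div, Real.sqrt_div_self']
    rw [e, mul_div_assoc, hs, hs2, mul_assoc]
    gcongr
    linarith
  refine (sum_le_sum hterm).trans_eq ?_
  rw [← sum_div, sum_add_distrib, sum_range_reflect (fun m : ℕ => 1 / ((m : ℝ) + 1))]
  have : ∑ m ∈ range N, 1 / ((m : ℝ) + 1) = harmonic N := by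
    rw [harmonic]
    push_cast
    simp
  rw [this]
  ring

theorem tendsto_polylog_div_sqrt (C : ℝ) (p : ℕ) :
    Tendsto (fun N : ℕ => C * (1 + (harmonic (2 * N) : ℝ)) ^ p / √((N : ℝ) + 1)) atTop (𝓝 0) := by
  obtain ⟨D, hD0, hD⟩ := pow_one_add_harmonic_le p
  have h1 : Tendsto (fun N : ℕ => |C| * (2 * D) * ((N : ℝ) + 1) ^ (-(1 / 4) : ℝ)) atTop (𝓝 0) := by
    have := (tendsto_rpow_neg_atTop (show (0 : ℝ) < 1 / 4 by norm_num)).comp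
      (tendsto_natCast_atTop_atTop.atTop_add (tendsto_const_nhds (x := (1 : ℝ))))
    simpa using this.const_mul (|C| * (2 * D))
  refine squeeze_zero_norm (fun N => ?_) h1
  have hh := harmonic_nonneg_real (2 * N)
  have hN : (0 : ℝ) < (N : ℝ) + 1 := by positivity
  rw [Real.norm_eq_abs, abs_div, abs_mul, abs_of_nonneg (by positivity : 0 ≤
    (1 + (harmonic (2 * N) : ℝ)) ^ p), abs_of_nonneg (Real.sqrt_nonneg _), mul_div_assoc, mul_assoc]
  refine mul_le_mul_of_nonneg_left ?_ (abs_nonneg _)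
  rw [div_le_iff₀ (by positivity)]
  calc (1 + (harmonic (2 * N) : ℝ)) ^ p ≤ D * (((2 * N : ℕ) : ℝ) + 1) ^ (1 / 4 : ℝ) := hD _
    _ ≤ D * (2 * ((N : ℝ) + 1)) ^ (1 / 4 : ℝ) := by
        gcongr
        push_cast
        linarith
    _ = D * (2 ^ (1 / 4 : ℝ) * ((N : ℝ) + 1) ^ (1 / 4 : ℝ)) := by
        rw [Real.mul_rpow (by norm_num) hN.le]
    _ ≤ D * (2 * ((N : ℝ) + 1) ^ (1 / 4 : ℝ)) := by
        gcongr
        calc (2 : ℝ) ^ (1 / 4 : ℝ) ≤ 2 ^ (1 : ℝ) :=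
              Real.rpow_le_rpow_of_exponent_le (by norm_num) (by norm_num)
          _ = 2 := Real.rpow_one 2
    _ = 2 * D * ((N : ℝ) + 1) ^ (-(1 / 4) : ℝ) * √((N : ℝ) + 1) := by
        rw [Real.sqrt_eq_rpow, mul_assoc (2 * D), ← Real.rpow_add hN]
        norm_num
        ring

/-! ### The limit of the partial fraction decomposition -/

/-- The sum of the residues vanishes. -/
theorem zetaPolar_one_eq_zero {k : List ℕ} (hk : IsAdmissible k) : zetaPolar 1 k = 0 := by
  induction hn : k.length using Nat.strong_induction_on generalizing k with
  | _ n ih =>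
    subst hn
    by_cases hk0 : k = []
    · subst hk0
      simp [zetaPolar, polar]
    have hlen : 0 < k.length := List.length_pos_iff.2 hk0
    -- Proper suffixes are shorter, so the induction on the length supplies the vanishing that the
    -- sharper estimate requires.
    obtain ⟨C, hC0, hC⟩ := regPolar_sub_le_of_vanish 1 hk fun p hp =>
      ih (k.drop p).length (by simp; omega) (hk.drop p) rfl
    set Z := zetaPolar 1 k with hZ
    -- The 2N + 1 residues sum to zero and each is Z up to its error, so (2N + 1)|Z| is at most the
    -- total error, of order √N times powers of a harmonic number. Summing the errors accounts for
    -- the additional power of 1 + H_(2N).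
    have hbound : ∀ N : ℕ, |Z| ≤
        2 * C * (1 + (harmonic (2 * N) : ℝ)) ^ (k.length + 1) / √((N : ℝ) + 1) := by
      intro N
      have h0 : ∑ ν ∈ range (2 * N + 1), regPolar N ν 1 k = 0 := sum_regNeg_polar_one N hk hk0
      set P := (1 + (harmonic (2 * N) : ℝ)) ^ k.length with hP
      have hh := harmonic_nonneg_real (2 * N)
      have hP0 : 0 ≤ P := by positivity
      have h1 : ∑ ν ∈ range (2 * N + 1), (regPolar N ν 1 k - Z) = -((2 * N + 1 : ℕ) * Z) := by
        rw [sum_sub_distrib, h0]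
        simp
      have h2 : |((2 * N + 1 : ℕ) : ℝ) * Z| ≤ C * P * (2 * √((N : ℝ) + 1) *
          (1 + harmonic (2 * N))) := by
        rw [← abs_neg, ← h1, sum_range_symm]
        have hc := hC N 0 N (by omega) (Or.inl rfl)
        have hs : (1 : ℝ) ≤ √((N : ℝ) + 1) := by
          rw [Real.one_le_sqrt]
          linarith [N.cast_nonneg (α := ℝ)]
        have hc' : |regPolar N N 1 k - Z| ≤ C * P * √((N : ℝ) + 1) := by
          refine hc.trans (mul_le_mul_of_nonneg_left ?_ (by positivity))
          exact (one_div_sqrt_le_one (N - 0)).trans hs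
        have hm : ∀ m ∈ range N, |regPolar N (N + (m + 1)) 1 k - Z +
            (regPolar N (N - (m + 1)) 1 k - Z)| ≤
            2 * (C * P) * (1 / √(((N - (m + 1) : ℕ) : ℝ) + 1)) := by
          intro m hm
          rw [mem_range] at hm
          have ha := hC N (m + 1) (N + (m + 1)) hm (Or.inl rfl)
          have hb := hC N (m + 1) (N - (m + 1)) hm (Or.inr (by omega))
          exact (abs_add_le _ _).trans ((add_le_add ha hb).trans_eq (by ring))
        have hsum := (abs_sum_le_sum_abs _ _).trans (sum_le_sum hm)
        rw [← mul_sum] at hsum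
        have hsum2 := hsum.trans
          (mul_le_mul_of_nonneg_left (sum_one_div_sqrt_le N) (by positivity))
        have hH := harmonic_mono_real (show N ≤ 2 * N by omega)
        simp only at hH
        have h4 : 2 * (C * P) * (√((N : ℝ) + 1) * harmonic N) ≤
            2 * (C * P) * (√((N : ℝ) + 1) * harmonic (2 * N)) := by gcongr
        have h5 : 0 ≤ C * P * √((N : ℝ) + 1) := by positivity
        refine (abs_add_le _ _).trans ?_
        linarith
      rw [abs_mul, Nat.abs_cast] at h2
      have h3 : √((N : ℝ) + 1) * √((N : ℝ) + 1) * |Z| ≤ ((2 * N + 1 : ℕ) : ℝ) * |Z| := by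
        rw [Real.mul_self_sqrt (by positivity)]
        refine mul_le_mul_of_nonneg_right ?_ (abs_nonneg _)
        push_cast
        linarith [N.cast_nonneg (α := ℝ)]
      rw [le_div_iff₀ (by positivity), pow_succ, ← hP]
      have hs0 : 0 < √((N : ℝ) + 1) := by positivity
      refine le_of_mul_le_mul_left ?_ hs0
      calc √((N : ℝ) + 1) * (|Z| * √((N : ℝ) + 1))
          = √((N : ℝ) + 1) * √((N : ℝ) + 1) * |Z| := by ring
        _ ≤ _ := h3.trans h2
        _ = _ := by ring
    have := ge_of_tendsto' (tendsto_polylog_div_sqrt (2 * C) (k.length + 1)) hbound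
    exact abs_eq_zero.1 (le_antisymm this (abs_nonneg _))

/-- The limit of the symmetric sums `∑_{0 < |m| ≤ N} m ^ (-n)`. -/
noncomputable def evenZeta (n : ℕ) : ℝ := if Even n then 2 * ∑' m : ℕ, 1 / (m : ℝ) ^ n else 0

theorem tendsto_symm_sum {n : ℕ} (hn : 1 ≤ n) :
    Tendsto (fun N => ∑ m ∈ range N, ((((m : ℝ) + 1) ^ n)⁻¹ + ((-((m : ℝ) + 1)) ^ n)⁻¹)) atTop
      (𝓝 (evenZeta n)) := by
  rw [evenZeta]
  split_ifs with h
  · have hs : Summable fun m : ℕ => 1 / (m : ℝ) ^ n := by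
      refine Real.summable_one_div_nat_pow.2 ?_
      obtain ⟨r, rfl⟩ := h
      omega
    have ht := ((hs.hasSum.tendsto_sum_nat).comp (tendsto_add_atTop_nat 1)).const_mul 2
    refine ht.congr fun N => ?_
    simp only [Function.comp_apply]
    rw [sum_range_succ', Nat.cast_zero, zero_pow (by omega), div_zero, add_zero, mul_sum]
    refine sum_congr rfl fun m _ => ?_
    rw [h.neg_pow]
    push_cast
    ring
  · have ho : Odd n := Nat.not_even_iff_odd.1 h
    simp only [ho.neg_pow, inv_neg, add_neg_cancel, sum_const_zero]
    exact tendsto_const_nhds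

/-- Limit of `regNeg_partial_fraction`: replacing each coefficient by its limit leaves the symmetric
sums of (ν - N)^(-n), and the replacement error tends to zero. -/
theorem conv_add_zetaPolar_zero {K : ℕ} {k : List ℕ} (hk : IsAdmissible k) (hk0 : k ≠ [])
    (hK : k.sum ≤ K) :
    conv (signRev zetaReg) zetaReg k + zetaPolar 0 k =
      ∑ n ∈ Icc 1 K, evenZeta n * zetaPolar n k := by
  have hL := ((biRate_conv hk).add (biRate_polar hk 0)).tendsto
  have hR : Tendsto (fun N => ∑ n ∈ Icc 1 K,
      (∑ m ∈ range N, ((((m : ℝ) + 1) ^ n)⁻¹ + ((-((m : ℝ) + 1)) ^ n)⁻¹)) * zetaPolar n k) atTop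
      (𝓝 (∑ n ∈ Icc 1 K, evenZeta n * zetaPolar n k)) :=
    tendsto_finsetSum _ fun n hn => (tendsto_symm_sum (mem_Icc.1 hn).1).mul_const _
  have hE : ∀ n ∈ Icc 1 K, Tendsto (fun N => ∑ m ∈ range N,
      ((regPolar N (N + (m + 1)) n k - zetaPolar n k) * (((m : ℝ) + 1) ^ n)⁻¹ +
        (regPolar N (N - (m + 1)) n k - zetaPolar n k) * ((-((m : ℝ) + 1)) ^ n)⁻¹)) atTop
      (𝓝 0) := by
    intro n hn
    obtain ⟨C, hC0, hC⟩ : ∃ C, 0 ≤ C ∧ ∀ N m ν, m < N → AtDist N (m + 1) ν →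
        |regPolar N ν n k - zetaPolar n k| * (((m : ℝ) + 1) ^ n)⁻¹ ≤
          C * (1 + (harmonic (2 * N) : ℝ)) ^ k.length *
            (1 / ((m : ℝ) + 1) * (1 / √(((N - (m + 1) : ℕ) : ℝ) + 1))) := by
      -- For n = 1 the error must come without a factor m, which the vanishing of all `zetaPolar 1`
      -- provides. For n ≥ 2 the factor m is absorbed, since m · m^(-n) ≤ 1/m.
      by_cases hn1 : n = 1
      · subst hn1
        obtain ⟨C, hC0, hC⟩ := regPolar_sub_le_of_vanish 1 hk fun p _ =>
          zetaPolar_one_eq_zero (hk.drop p)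
        refine ⟨C, hC0, fun N m ν hm hν => ?_⟩
        have h := mul_le_mul_of_nonneg_right (hC N (m + 1) ν hm hν)
          (show 0 ≤ (((m : ℝ) + 1) ^ 1)⁻¹ by positivity)
        refine h.trans_eq ?_
        rw [pow_one]
        ring
      · obtain ⟨C, hC0, hC⟩ := regPolar_sub_le n hk
        refine ⟨C, hC0, fun N m ν hm hν => ?_⟩
        have h := mul_le_mul_of_nonneg_right (hC N (m + 1) ν (by omega) hm hν)
          (show 0 ≤ (((m : ℝ) + 1) ^ n)⁻¹ by positivity)
        refine h.trans ?_
        obtain ⟨r, rfl⟩ : ∃ r, n = r + 2 := ⟨n - 2, by have := (mem_Icc.1 hn).1; omega⟩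
        have hm0 : (1 : ℝ) ≤ (m : ℝ) + 1 := by linarith [m.cast_nonneg (α := ℝ)]
        have hle : ((m : ℝ) + 1) * (((m : ℝ) + 1) ^ (r + 2))⁻¹ ≤ 1 / ((m : ℝ) + 1) := by
          have h1 : (((m : ℝ) + 1) ^ r)⁻¹ ≤ 1 := inv_le_one_of_one_le₀ (one_le_pow₀ hm0)
          have e : ((m : ℝ) + 1) * (((m : ℝ) + 1) ^ (r + 2))⁻¹ =
              1 / ((m : ℝ) + 1) * (((m : ℝ) + 1) ^ r)⁻¹ := by
            rw [pow_add]
            field_simp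
          rw [e]
          exact mul_le_of_le_one_right (by positivity) h1
        have hh := harmonic_nonneg_real (2 * N)
        push_cast
        calc _ = C * (1 + (harmonic (2 * N) : ℝ)) ^ k.length *
              (((m : ℝ) + 1) * (((m : ℝ) + 1) ^ (r + 2))⁻¹ *
                (1 / √(((N - (m + 1) : ℕ) : ℝ) + 1))) := by ring
          _ ≤ _ := by gcongr
    -- In 4C, one factor 2 counts the two points at each distance from N and the other comes from
    -- `sum_one_div_mul_sqrt_le`.
    refine squeeze_zero_norm (fun N => ?_) (tendsto_polylog_div_sqrt (4 * C) (k.length + 1))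
    have hh := harmonic_nonneg_real (2 * N)
    have hterm : ∀ m ∈ range N,
        |(regPolar N (N + (m + 1)) n k - zetaPolar n k) * (((m : ℝ) + 1) ^ n)⁻¹ +
        (regPolar N (N - (m + 1)) n k - zetaPolar n k) * ((-((m : ℝ) + 1)) ^ n)⁻¹| ≤
        2 * (C * (1 + (harmonic (2 * N) : ℝ)) ^ k.length) *
          (1 / ((m : ℝ) + 1) * (1 / √(((N - (m + 1) : ℕ) : ℝ) + 1))) := by
      intro m hm
      rw [mem_range] at hm
      have ha := hC N m (N + (m + 1)) hm (Or.inl rfl)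
      have hb := hC N m (N - (m + 1)) hm (Or.inr (by omega))
      have e1 : |(((m : ℝ) + 1) ^ n)⁻¹| = (((m : ℝ) + 1) ^ n)⁻¹ := abs_of_nonneg (by positivity)
      have e2 : |((-((m : ℝ) + 1)) ^ n)⁻¹| = (((m : ℝ) + 1) ^ n)⁻¹ := by
        rw [abs_inv, abs_pow, abs_neg, abs_of_nonneg (by positivity)]
      refine (abs_add_le _ _).trans ?_
      rw [abs_mul, abs_mul, e1, e2]
      exact (add_le_add ha hb).trans_eq (by ring)
    rw [Real.norm_eq_abs]
    refine (abs_sum_le_sum_abs _ _).trans ((sum_le_sum hterm).trans ?_)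
    rw [← mul_sum]
    refine (mul_le_mul_of_nonneg_left (sum_one_div_mul_sqrt_le N) (by positivity)).trans ?_
    rw [mul_div_assoc', pow_succ]
    refine div_le_div_of_nonneg_right ?_ (Real.sqrt_nonneg _)
    have hH := harmonic_mono_real (show N ≤ 2 * N by omega)
    simp only at hH
    have h5 : 0 ≤ C * (1 + (harmonic (2 * N) : ℝ)) ^ k.length := by positivity
    have h6 := mul_le_mul_of_nonneg_left (show (harmonic N : ℝ) ≤ 1 + harmonic (2 * N) by linarith)
      h5
    linarith
  have hE' := tendsto_finsetSum _ hE
  rw [sum_const_zero] at hE'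
  have hRE := hR.add hE'
  rw [add_zero] at hRE
  refine tendsto_nhds_unique hL (hRE.congr fun N => ?_)
  rw [regNeg_partial_fraction N hk hk0 hK, sum_erase_symm, ← sum_add_distrib]
  simp only [sum_mul, ← sum_add_distrib]
  rw [sum_comm]
  refine sum_congr rfl fun m hm => sum_congr rfl fun n _ => ?_
  have hm' : m + 1 ≤ N := mem_range.1 hm
  have e1 : (((N + (m + 1) : ℕ) : ℝ) - N) = (m : ℝ) + 1 := by push_cast; ring
  have e2 : (((N - (m + 1) : ℕ) : ℝ) - N) = -((m : ℝ) + 1) := by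
    rw [Nat.cast_sub hm']; push_cast; ring
  rw [e1, e2]
  simp only [regPolar]
  ring

/-- The coefficients of the cotangent series. -/
noncomputable def cotCoeff (m : ℕ) : ℝ :=
  (-1) ^ m * ((2 * Real.pi) ^ (2 * m) / ((2 * m).factorial : ℝ) * (bernoulli (2 * m) : ℝ))

theorem evenZeta_two_mul {m : ℕ} (hm : m ≠ 0) : evenZeta (2 * m) = -cotCoeff m := by
  rw [evenZeta, if_pos (even_two_mul m), (hasSum_zeta_nat hm).tsum_eq, cotCoeff, mul_pow, pow_succ]
  obtain ⟨r, rfl⟩ := Nat.exists_eq_succ_of_ne_zero hm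
  rw [show 2 * r.succ - 1 = 2 * r + 1 by omega, show 2 * r.succ = 2 * r + 1 + 1 by omega,
    pow_succ (2 : ℝ) (2 * r + 1)]
  ring

theorem evenZeta_odd (m : ℕ) : evenZeta (2 * m + 1) = 0 := by
  rw [evenZeta, if_neg]
  simp

/-- The parity relation between products of two zeta values. -/
theorem conv_add_sum_cotCoeff {L : ℕ} {k : List ℕ} (hk : IsAdmissible k) (hk0 : k ≠ [])
    (hL : k.sum ≤ 2 * L) :
    conv (signRev zetaReg) zetaReg k +
      ∑ m ∈ range (L + 1), cotCoeff m * zetaPolar (2 * m) k = 0 := by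
  have h := conv_add_zetaPolar_zero hk hk0 hL
  have e : ∀ L : ℕ, ∑ n ∈ Icc 1 (2 * L), evenZeta n * zetaPolar n k =
      -∑ m ∈ range L, cotCoeff (m + 1) * zetaPolar (2 * (m + 1)) k := by
    intro L
    induction L with
    | zero => simp
    | succ L ih =>
      rw [show 2 * (L + 1) = 2 * L + 1 + 1 by ring, sum_Icc_succ_top (by omega),
        sum_Icc_succ_top (by omega), ih, evenZeta_odd,
        show 2 * L + 1 + 1 = 2 * (L + 1) by ring, evenZeta_two_mul (by omega), sum_range_succ]
      ring
  rw [e] at h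
  rw [sum_range_succ', mul_zero]
  -- The constant term `zetaPolar 0` thus becomes the summand m = 0 of the cotangent sum.
  have h0 : cotCoeff 0 = 1 := by simp [cotCoeff]
  rw [h0, one_mul]
  linarith

/-! ### The antipode relation -/

/-- The sum of `f` over a stuffle product. -/
noncomputable def stuffleSum (f : List ℕ → ℝ) (u v : List ℕ) : ℝ := ((stuffle u v).map f).sum

theorem stuffleSum_nil_left (f : List ℕ → ℝ) (v : List ℕ) : stuffleSum f [] v = f v := by
  simp [stuffleSum, stuffle]

theorem stuffleSum_nil_right (f : List ℕ → ℝ) (u : List ℕ) : stuffleSum f u [] = f u := by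
  simp [stuffleSum, stuffle_nil_right]

theorem stuffleSum_cons (f : List ℕ → ℝ) (a b : ℕ) (u v : List ℕ) :
    stuffleSum f (a :: u) (b :: v) = stuffleSum (fun w => f (a :: w)) u (b :: v) +
      stuffleSum (fun w => f (b :: w)) (a :: u) v + stuffleSum (fun w => f ((a + b) :: w)) u v := by
  simp [stuffleSum, stuffle, Function.comp_def, add_assoc]

theorem stuffleSum_snoc (f : List ℕ → ℝ) (a b : ℕ) : ∀ u v : List ℕ,
    stuffleSum f (u ++ [a]) (v ++ [b]) = stuffleSum (fun w => f (w ++ [a])) u (v ++ [b]) +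
      stuffleSum (fun w => f (w ++ [b])) (u ++ [a]) v +
      stuffleSum (fun w => f (w ++ [a + b])) u v
  | [], [] => by
      simp [stuffleSum_cons, stuffleSum_nil_left, stuffleSum_nil_right]
      ring
  | c :: u, [] => by
      have h := stuffleSum_snoc (fun w => f (c :: w)) a b u []
      simp only [List.nil_append, List.cons_append, stuffleSum_cons, stuffleSum_nil_right] at h ⊢
      rw [h]
      ring
  | [], d :: v => by
      have h := stuffleSum_snoc (fun w => f (d :: w)) a b [] v
      simp only [List.nil_append, List.cons_append, stuffleSum_cons, stuffleSum_nil_left] at h ⊢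
      rw [h]
      ring
  | c :: u, d :: v => by
      have h1 := stuffleSum_snoc (fun w => f (c :: w)) a b u (d :: v)
      have h2 := stuffleSum_snoc (fun w => f (d :: w)) a b (c :: u) v
      have h3 := stuffleSum_snoc (fun w => f ((c + d) :: w)) a b u v
      simp only [List.cons_append, stuffleSum_cons] at h1 h2 h3 ⊢
      rw [h1, h2, h3]
      ring
termination_by u v => u.length + v.length

/-- The product defined from the first letters satisfies the same recursion from the last letters
(`stuffleSum_snoc`), so it commutes with reversal. -/
theorem stuffleSum_reverse (f : List ℕ → ℝ) : ∀ u v : List ℕ,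
    stuffleSum f u v = stuffleSum (fun w => f w.reverse) u.reverse v.reverse
  | [], v => by simp [stuffleSum_nil_left]
  | a :: u, [] => by simp [stuffleSum_nil_right]
  | a :: u, b :: v => by
      have h1 := stuffleSum_reverse (fun w => f (a :: w)) u (b :: v)
      have h2 := stuffleSum_reverse (fun w => f (b :: w)) (a :: u) v
      have h3 := stuffleSum_reverse (fun w => f ((a + b) :: w)) u v
      rw [stuffleSum_cons, h1, h2, h3]
      simp only [List.reverse_cons]
      rw [stuffleSum_snoc]
      simp
termination_by u v => u.length + v.length

/-! ### Mergings of words -/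

/-- Adds `b` to the first letter of a word. -/
def headAdd (b : ℕ) : List ℕ → List ℕ
  | [] => []
  | a :: l => (b + a) :: l

theorem mergingsAux_add (b c : ℕ) (l : List ℕ) :
    mergingsAux (b + c) l = (mergingsAux c l).map (headAdd b) := by
  induction l generalizing c with
  | nil => simp [mergingsAux, headAdd]
  | cons e l ih =>
    rw [mergingsAux, mergingsAux, add_assoc, ih]
    simp [headAdd, Function.comp_def]

theorem ne_nil_of_mem_mergingsAux {c : ℕ} {l x : List ℕ} (h : x ∈ mergingsAux c l) : x ≠ [] := by
  induction l generalizing c with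
  | nil => simp [mergingsAux] at h; simp [h]
  | cons e l ih =>
    simp only [mergingsAux, List.mem_append, List.mem_map] at h
    rcases h with ⟨y, _, rfl⟩ | h
    · simp
    · exact ih h

theorem isIndex_of_mem_mergingsAux {c : ℕ} {l x : List ℕ} (hc : 1 ≤ c) (hl : IsIndex l)
    (h : x ∈ mergingsAux c l) : IsIndex x := by
  induction l generalizing c x with
  | nil =>
    simp only [mergingsAux, List.mem_singleton] at h
    subst h
    intro y hy
    simp at hy
    omega
  | cons e l ih =>
    have he : 1 ≤ e := hl e (by simp)
    simp only [mergingsAux, List.mem_append, List.mem_map] at h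
    rcases h with ⟨y, hy, rfl⟩ | h
    · intro z hz
      rcases List.mem_cons.1 hz with rfl | hz
      · exact hc
      · exact ih he hl.of_cons hy z hz
    · exact ih (by omega) hl.of_cons h

theorem isIndex_of_mem_mergings {k x : List ℕ} (hk : IsIndex k) (h : x ∈ mergings k) :
    IsIndex x := by
  rcases k with _ | ⟨c, l⟩
  · simp only [mergings, List.mem_singleton] at h
    rw [h]
    exact hk
  · exact isIndex_of_mem_mergingsAux (hk c (by simp)) hk.of_cons h

/-- The sum of `f` over all mergings of a word. -/
noncomputable def mergeSum (f : List ℕ → ℝ) (k : List ℕ) : ℝ := ((mergings k).map f).sum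

theorem mergeSum_congr {f g : List ℕ → ℝ} {k : List ℕ} (h : ∀ x ∈ mergings k, f x = g x) :
    mergeSum f k = mergeSum g k := by
  rw [mergeSum, mergeSum, List.map_congr_left h]

theorem mergeSum_nil (f : List ℕ → ℝ) : mergeSum f [] = f [] := by simp [mergeSum, mergings]

theorem mergeSum_single (f : List ℕ → ℝ) (c : ℕ) : mergeSum f [c] = f [c] := by
  simp [mergeSum, mergings, mergingsAux]

theorem mergeSum_cons_cons (f : List ℕ → ℝ) (b c : ℕ) (l : List ℕ) :
    mergeSum f (b :: c :: l) = mergeSum (fun x => f (b :: x) + f (headAdd b x)) (c :: l) := by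
  simp only [mergeSum, mergings, mergingsAux, mergingsAux_add b c l, List.map_append, List.map_map,
    List.sum_append, List.sum_map_add]
  rfl

theorem mergeSum_add (f g : List ℕ → ℝ) (k : List ℕ) :
    mergeSum (fun x => f x + g x) k = mergeSum f k + mergeSum g k := by
  simp only [mergeSum, List.sum_map_add]

theorem mergeSum_cons_congr {f g : List ℕ → ℝ} {c : ℕ} {l : List ℕ}
    (h : ∀ e x, f (e :: x) = g (e :: x)) : mergeSum f (c :: l) = mergeSum g (c :: l) := by
  refine mergeSum_congr fun x hx => ?_
  rcases x with _ | ⟨e, x⟩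
  · exact absurd rfl (ne_nil_of_mem_mergingsAux hx)
  · exact h e x

theorem headAdd_append (b : ℕ) {x : List ℕ} (hx : x ≠ []) (y : List ℕ) :
    headAdd b (x ++ y) = headAdd b x ++ y := by
  rcases x with _ | ⟨a, x⟩
  · exact absurd rfl hx
  · rfl

theorem mergeSum_snoc (f : List ℕ → ℝ) (c b : ℕ) (l : List ℕ) :
    mergeSum f (c :: l ++ [b]) =
      mergeSum (fun x => f (x ++ [b]) + f (headAdd b x.reverse).reverse) (c :: l) := by
  induction l generalizing f c with
  | nil =>
    rw [List.cons_append, List.nil_append, mergeSum_cons_cons, mergeSum_single, mergeSum_single]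
    simp [headAdd, add_comm]
  | cons e l ih =>
    rw [List.cons_append, List.cons_append, mergeSum_cons_cons, ← List.cons_append, ih,
      mergeSum_cons_cons]
    refine mergeSum_cons_congr fun a x => ?_
    have h1 : (headAdd b ((c :: a :: x).reverse)).reverse =
        c :: (headAdd b (a :: x).reverse).reverse := by
      rw [List.reverse_cons (a := c), headAdd_append b (by simp)]
      simp
    have h2 : headAdd c (headAdd b (a :: x).reverse).reverse =
        (headAdd b (headAdd c (a :: x)).reverse).reverse := by
      rcases List.eq_nil_or_concat x with rfl | ⟨y, z, rfl⟩
      · simp [headAdd]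
        ring
      · simp [headAdd]
    rw [h1, h2]
    simp only [List.cons_append, headAdd]
    ring

theorem mergeSum_reverse (f : List ℕ → ℝ) (k : List ℕ) :
    mergeSum f k.reverse = mergeSum (fun x => f x.reverse) k := by
  induction k generalizing f with
  | nil => simp [mergeSum_nil]
  | cons c l ih =>
    rcases l with _ | ⟨d, l⟩
    · simp [mergeSum_single]
    · rw [mergeSum_cons_cons, List.reverse_cons]
      obtain ⟨e, m, hm⟩ : ∃ e m, (d :: l).reverse = e :: m :=
        List.exists_cons_of_ne_nil (by simp)
      rw [hm, mergeSum_snoc, ← hm, ih]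
      refine mergeSum_cons_congr fun a x => ?_
      simp

/-- The part of a stuffle product where the first letter comes from the left factor alone. -/
noncomputable def leftHeadSum (f : List ℕ → ℝ) (v : List ℕ) : List ℕ → ℝ
  | [] => 0
  | e :: x => stuffleSum (fun w => f (e :: w)) x v

/-- In the term q = 0, sort words by the origin of their first letter. Those starting in the merged
word alone cancel against all terms q ≥ 1, by induction with `b` moved into `v`. Those starting with
`b`, alone or added to the next letter, are the two ways of attaching `b` to a merging. -/
theorem sum_stuffle_mergings_aux (f : List ℕ → ℝ) (l : List ℕ) (b : ℕ) (v : List ℕ) :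
    ∑ q ∈ range (l.length + 1), (-1 : ℝ) ^ q *
      mergeSum (fun x => stuffleSum f x ((l.take q).reverse ++ b :: v)) (l.drop q) =
    mergeSum (leftHeadSum f v) (b :: l) := by
  induction l generalizing b v with
  | nil => simp [mergeSum_nil, mergeSum_single, stuffleSum_nil_left, leftHeadSum]
  | cons c l ih =>
    rw [List.length_cons, sum_range_succ']
    have e : ∑ q ∈ range (l.length + 1), (-1 : ℝ) ^ (q + 1) * mergeSum
        (fun x => stuffleSum f x (((c :: l).take (q + 1)).reverse ++ b :: v))
          ((c :: l).drop (q + 1)) =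
        -∑ q ∈ range (l.length + 1), (-1 : ℝ) ^ q *
      mergeSum (fun x => stuffleSum f x ((l.take q).reverse ++ c :: b :: v)) (l.drop q) := by
      rw [← sum_neg_distrib]
      refine sum_congr rfl fun q _ => ?_
      rw [pow_succ]
      simp
    rw [e, ih, mergeSum_cons_cons]
    simp only [pow_zero, one_mul, List.take_zero, List.reverse_nil, List.nil_append,
      List.drop_zero]
    rw [neg_add_eq_iff_eq_add, ← mergeSum_add]
    refine mergeSum_cons_congr fun a x => ?_
    rw [stuffleSum_cons]
    simp only [leftHeadSum, headAdd, add_comm b a]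
    ring

theorem sum_stuffle_mergings (f : List ℕ → ℝ) {l : List ℕ} (hl : l ≠ []) :
    ∑ q ∈ range (l.length + 1), (-1 : ℝ) ^ q *
      mergeSum (fun x => stuffleSum f x (l.take q).reverse) (l.drop q) = 0 := by
  rcases l with _ | ⟨c, l⟩
  · exact absurd rfl hl
  · rw [List.length_cons, sum_range_succ']
    have e : ∑ q ∈ range (l.length + 1), (-1 : ℝ) ^ (q + 1) * mergeSum
        (fun x => stuffleSum f x ((c :: l).take (q + 1)).reverse) ((c :: l).drop (q + 1)) =
        -∑ q ∈ range (l.length + 1), (-1 : ℝ) ^ q *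
      mergeSum (fun x => stuffleSum f x ((l.take q).reverse ++ c :: [])) (l.drop q) := by
      rw [← sum_neg_distrib]
      refine sum_congr rfl fun q _ => ?_
      rw [pow_succ]
      simp
    rw [e, sum_stuffle_mergings_aux]
    simp only [pow_zero, one_mul, List.take_zero, List.reverse_nil, List.drop_zero]
    rw [neg_add_eq_zero]
    refine mergeSum_cons_congr fun a x => ?_
    simp only [leftHeadSum, stuffleSum_nil_right]

theorem zetaStarReg_eq (k : List ℕ) : zetaStarReg k = mergeSum zetaReg k := rfl

/-- Multiplicativity of ζ^* turns the antipode identity `sum_stuffle_mergings` into one between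
products. It is applied to the reversed word and summed in the opposite order, so that the mergings
fall on prefixes of `k`. -/
theorem sum_zetaStarReg_mul {k : List ℕ} (hk : IsIndex k) (hk0 : k ≠ []) :
    ∑ p ∈ range (k.length + 1), (-1 : ℝ) ^ p *
      (zetaStarReg (k.take p) * zetaReg (k.drop p).reverse) = 0 := by
  have h := sum_stuffle_mergings (fun w => zetaReg w.reverse) (l := k.reverse) (by simpa using hk0)
  rw [List.length_reverse, ← sum_range_reflect] at h
  have e : ∀ p ∈ range (k.length + 1), (-1 : ℝ) ^ (k.length + 1 - 1 - p) *
      mergeSum (fun x => stuffleSum (fun w => zetaReg w.reverse) x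
        (k.reverse.take (k.length + 1 - 1 - p)).reverse)
        (k.reverse.drop (k.length + 1 - 1 - p)) =
      (-1) ^ k.length * ((-1 : ℝ) ^ p *
        (zetaStarReg (k.take p) * zetaReg (k.drop p).reverse)) := by
    intro p hp
    have hp' : p ≤ k.length := by simpa [Nat.lt_succ_iff] using hp
    obtain ⟨r, hr⟩ := Nat.exists_eq_add_of_le hp'
    have hq : k.length + 1 - 1 - p = k.length - p := by omega
    have h1 : k.reverse.take (k.length - p) = (k.drop p).reverse := by
      rw [List.take_reverse]
      congr 2
      omega
    have h2 : k.reverse.drop (k.length - p) = (k.take p).reverse := by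
      rw [List.drop_reverse]
      congr 2
      omega
    rw [hq, h1, h2, List.reverse_reverse, mergeSum_reverse]
    have h3 : mergeSum (fun x => stuffleSum (fun w => zetaReg w.reverse) x.reverse (k.drop p))
        (k.take p) = mergeSum (fun x => zetaReg (k.drop p).reverse * zetaReg x) (k.take p) := by
      refine mergeSum_congr fun x hx => ?_
      have h4 := stuffleSum_reverse zetaReg x (k.drop p).reverse
      rw [List.reverse_reverse] at h4
      rw [← h4, stuffleSum, ← isStuffleRegularization_zetaReg.mul _ _
        (isIndex_of_mem_mergings (hk.take p) hx) (hk.drop p).reverse, mul_comm]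
    have h5 : mergeSum (fun x => zetaReg (k.drop p).reverse * zetaReg x) (k.take p) =
        zetaReg (k.drop p).reverse * zetaStarReg (k.take p) := by
      rw [zetaStarReg_eq, mergeSum, mergeSum, List.sum_map_mul_left]
    have h6 : (-1 : ℝ) ^ k.length * (-1) ^ p = (-1) ^ (k.length - p) := by
      rw [hr, Nat.add_sub_cancel_left, ← pow_add, show p + r + p = p + p + r by ring, pow_add,
        (Even.add_self p).neg_one_pow, one_mul]
    rw [h3, h5, ← h6]
    ring
  rw [sum_congr rfl e, ← mul_sum] at h
  exact (mul_eq_zero.1 h).resolve_left (pow_ne_zero _ (by norm_num))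

theorem zetaReg_nil : zetaReg [] = 1 := by
  have h : IsAdmissible [] := ⟨by intro x hx; simp at hx, by simp⟩
  rw [isStuffleRegularization_zetaReg.eq_zeta _ h]
  refine tendsto_nhds_unique (tendsto_trunc h) ?_
  simp [trunc_nil]

/-- The parity theorem for a word of odd total parity. -/
theorem zetaReg_parity {w : List ℕ} (hw : IsAdmissible w) (hw0 : w ≠ [])
    (hodd : Odd (w.length + w.sum)) :
    zetaReg w = -zetaStarReg w - ∑ i ∈ range w.length, (-1 : ℝ) ^ (i + (w.take i).sum) *
      zetaStarReg (w.take i) * ∑ m ∈ range (w.sum + 1), cotCoeff m * zetaPolar (2 * m) (w.drop i) := by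
  -- `F` is the convolution inverse of `signRev zetaReg`; the depth sign comes from the antipode and
  -- the weight sign from `signRev`.
  set F : List ℕ → ℝ := fun u => (-1) ^ (u.length + u.sum) * zetaStarReg u with hF
  have hFY : ∀ u, IsIndex u → conv F (signRev zetaReg) u = if u = [] then 1 else 0 := by
    intro u hu
    split_ifs with h
    · subst h
      simp [conv_nil, hF, zetaStarReg_eq, mergeSum_nil, signRev, zetaReg_nil]
    · have e : conv F (signRev zetaReg) u = (-1) ^ u.sum *
          ∑ p ∈ range (u.length + 1), (-1 : ℝ) ^ p *
            (zetaStarReg (u.take p) * zetaReg (u.drop p).reverse) := by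
        rw [conv, mul_sum]
        refine sum_congr rfl fun p hp => ?_
        have hp' : p ≤ u.length := by simpa [Nat.lt_succ_iff] using hp
        have h : u.sum = (u.take p).sum + (u.drop p).sum := by rw [List.sum_take_add_sum_drop]
        simp only [hF, signRev]
        rw [List.length_take, min_eq_left hp', h, pow_add, pow_add]
        ring
      rw [e, sum_zetaStarReg_mul hu h, mul_zero]
  have h1 : conv (conv F (signRev zetaReg)) zetaReg w = zetaReg w := by
    rw [conv, sum_range_succ', sum_eq_zero]
    · rw [List.take_zero, hFY [] (by intro x hx; simp at hx)]
      simp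
    · intro p hp
      rw [mem_range] at hp
      rw [hFY _ (hw.1.take _), if_neg, zero_mul]
      intro h
      rcases List.take_eq_nil_iff.1 h with h | h
      · omega
      · exact hw0 h
  have h2 : conv F (conv (signRev zetaReg) zetaReg) w = -zetaStarReg w -
      ∑ i ∈ range w.length, (-1 : ℝ) ^ (i + (w.take i).sum) *
      zetaStarReg (w.take i) * ∑ m ∈ range (w.sum + 1), cotCoeff m * zetaPolar (2 * m) (w.drop i) := by
    rw [conv, sum_range_succ, List.take_length, List.drop_length, conv_nil, zetaReg_nil, mul_one,
      sub_eq_neg_add]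
    congr 1
    · rw [← sum_neg_distrib]
      refine sum_congr rfl fun i hi => ?_
      rw [mem_range] at hi
      have h3 := conv_add_sum_cotCoeff (L := w.sum) (hw.drop i) (by simp; omega)
        ((sum_drop_le w i).trans (by omega))
      rw [eq_neg_of_add_eq_zero_left h3]
      simp only [hF, List.length_take, min_eq_left hi.le]
      ring
    -- The cut with empty suffix contributes F(w), and odd depth plus weight makes this -ζ^⋆(w).
    -- Parity enters nowhere else in this argument.
    · simp [hF, hodd.neg_one_pow, signRev, zetaReg_nil]
  rw [← h2, ← conv_assoc, h1]

/-! ### Segments and the final form of the relation -/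

theorem length_seg (k : ℕ → ℕ) (p q : ℕ) : (seg k p q).length = q + 1 - p := by simp [seg]

theorem take_drop_seg (k : ℕ → ℕ) {d i n : ℕ} (h : i + n ≤ d) :
    ((seg k 1 d).drop i).take n = seg k (i + 1) (i + n) := by
  refine List.ext_getElem (by simp [seg]; omega) fun j _ _ => ?_
  simp only [seg, List.getElem_take, List.getElem_drop, List.getElem_map, List.getElem_range']
  congr 1
  omega

theorem take_seg (k : ℕ → ℕ) {d i : ℕ} (h : i ≤ d) : (seg k 1 d).take i = seg k 1 i := by
  have := take_drop_seg k (d := d) (i := 0) (n := i) (by omega)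
  simpa using this

theorem drop_seg (k : ℕ → ℕ) (d i : ℕ) : (seg k 1 d).drop i = seg k (i + 1) d := by
  rw [seg, seg, ← List.map_drop, List.drop_range']
  congr 2
  · omega
  · omega

theorem getD_seg (k : ℕ → ℕ) {p q j : ℕ} (h : p + j ≤ q) : (seg k p q).getD j 0 = k (p + j) := by
  rw [seg, List.getD_eq_getElem _ _ (by simp; omega)]
  simp

theorem sum_seg (k : ℕ → ℕ) (p q : ℕ) : (seg k p q).sum = ∑ t ∈ Icc p q, k t := by
  rfl

theorem sum_filter_triple {κ L : ℕ} (hL : κ ≤ L) (G : ℕ → ℕ → ℕ → ℝ) :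
    ∑ m ∈ range (L + 1), (if 2 * m ≤ κ then
      ∑ q ∈ antidiagonal (κ - 2 * m), G q.1 m q.2 else 0) =
    ∑ p ∈ (range (κ + 1) ×ˢ range (κ + 1) ×ˢ range (κ + 1)).filter
      (fun p : ℕ × ℕ × ℕ => p.1 + 2 * p.2.1 + p.2.2 = κ), G p.1 p.2.1 p.2.2 := by
  rw [← sum_filter, sum_sigma']
  refine sum_bij' (fun x _ => (x.2.1, x.1, x.2.2)) (fun p _ => ⟨p.2.1, (p.1, p.2.2)⟩)
    ?_ ?_ ?_ ?_ ?_
  · rintro ⟨m, a, b⟩ h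
    simp only [mem_sigma, mem_filter, mem_range, HasAntidiagonal.mem_antidiagonal, mem_product]
      at h ⊢
    omega
  · rintro ⟨a, m, b⟩ h
    simp only [mem_sigma, mem_filter, mem_range, HasAntidiagonal.mem_antidiagonal, mem_product]
      at h ⊢
    omega
  · rintro ⟨m, a, b⟩ _
    rfl
  · rintro ⟨a, m, b⟩ _
    rfl
  · rintro ⟨m, a, b⟩ _
    rfl

theorem sum_cotCoeff_zetaPolar (k : ℕ → ℕ) {d i L : ℕ} (hi : i < d)
    (hL : ∀ j ∈ Icc 1 d, k j ≤ L) :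
    (-1 : ℝ) ^ (i + (seg k 1 i).sum) * ∑ m ∈ range (L + 1),
      cotCoeff m * zetaPolar (2 * m) (seg k (i + 1) d) =
    2 * ∑ j ∈ Icc (i + 1) d,
      ∑ p ∈ (range (k j + 1) ×ˢ range (k j + 1) ×ˢ range (k j + 1)).filter
        (fun p : ℕ × ℕ × ℕ => p.1 + 2 * p.2.1 + p.2.2 = k j),
        (-1 : ℝ) ^ (p.2.1 + i + p.2.2 + ∑ t ∈ Icc 1 j, k t) *
          ((2 * Real.pi) ^ (2 * p.2.1) / (2 * (Nat.factorial (2 * p.2.1) : ℝ)) *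
            (bernoulli (2 * p.2.1) : ℝ)) *
          (zetaRegCoeff p.1 (seg k (i + 1) (j - 1)).reverse *
            zetaRegCoeff p.2.2 (seg k (j + 1) d)) := by
  have e : ∀ m ∈ range (L + 1), cotCoeff m * zetaPolar (2 * m) (seg k (i + 1) d) =
      ∑ j ∈ Icc (i + 1) d, if 2 * m ≤ k j then ∑ q ∈ antidiagonal (k j - 2 * m),
        cotCoeff m * ((-1) ^ ((seg k (i + 1) (j - 1)).sum + q.1) *
          zetaRegCoeff q.1 (seg k (i + 1) (j - 1)).reverse * zetaRegCoeff q.2 (seg k (j + 1) d))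
        else 0 := by
    intro m _
    rw [zetaPolar, polar, length_seg, mul_sum, ← Finset.Ico_add_one_right_eq_Icc, sum_Ico_eq_sum_range]
    refine sum_congr (by congr 1) fun j hj => ?_
    rw [mem_range] at hj
    have h1 : (seg k (i + 1) d).take j = seg k (i + 1) (i + 1 + j - 1) := by
      rw [← drop_seg, take_drop_seg k (by omega)]
      congr 1
      omega
    have h2 : (seg k (i + 1) d).drop (j + 1) = seg k (i + 1 + j + 1) d := by
      rw [← drop_seg, List.drop_drop, drop_seg]
      congr 1
      omega
    rw [getD_seg k (by omega), h1, h2]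
    split_ifs
    · rw [mul_sum]
      refine sum_congr rfl fun q _ => ?_
      rw [shiftCoeff_signRev, zetaRegCoeff_eq, zetaRegCoeff_eq]
    · rw [mul_zero]
  rw [sum_congr rfl e, sum_comm, mul_sum, mul_sum]
  refine sum_congr rfl fun j hj => ?_
  rw [mem_Icc] at hj
  have hkj : k j ≤ L := hL j (mem_Icc.2 ⟨by omega, hj.2⟩)
  rw [sum_filter_triple hkj fun a m b => cotCoeff m *
    ((-1) ^ ((seg k (i + 1) (j - 1)).sum + a) *
      zetaRegCoeff a (seg k (i + 1) (j - 1)).reverse * zetaRegCoeff b (seg k (j + 1) d)),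
    mul_sum, mul_sum]
  refine sum_congr rfl fun p hp => ?_
  rw [mem_filter] at hp
  have hs : ∑ t ∈ Icc 1 j, k t = (seg k 1 i).sum + (seg k (i + 1) (j - 1)).sum + k j := by
    obtain ⟨r, rfl⟩ : ∃ r, j = r + 1 := ⟨j - 1, by omega⟩
    rw [sum_Icc_succ_top (by omega), ← sum_seg, Nat.add_sub_cancel]
    congr 1
    rw [← List.sum_take_add_sum_drop (seg k 1 r) i, take_seg k (by omega), drop_seg]
  -- Substituting k_j = a + 2m + b, the exponents of the two signs differ by the even number 2(m +
  -- b).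
  have hsign : (-1 : ℝ) ^ (p.2.1 + i + p.2.2 + ∑ t ∈ Icc 1 j, k t) =
      (-1) ^ (i + (seg k 1 i).sum) * ((-1) ^ p.2.1 *
        (-1) ^ ((seg k (i + 1) (j - 1)).sum + p.1)) := by
    rw [hs, ← hp.2, ← pow_add, ← pow_add]
    rw [show p.2.1 + i + p.2.2 + ((seg k 1 i).sum + (seg k (i + 1) (j - 1)).sum +
      (p.1 + 2 * p.2.1 + p.2.2)) = i + (seg k 1 i).sum + (p.2.1 +
        ((seg k (i + 1) (j - 1)).sum + p.1)) + 2 * (p.2.1 + p.2.2) by ring,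
      pow_add _ _ (2 * _), pow_mul]
    norm_num
  rw [hsign, cotCoeff]
  have : ((2 * p.2.1).factorial : ℝ) ≠ 0 := by positivity
  field_simp

end MZV

/-! ### Assembly of the explicit formula -/

theorem theorem1p2 (d : ℕ) (hd : 1 ≤ d) (k : ℕ → ℕ)
    (hk : ∀ j ∈ Finset.Icc 1 d, 1 ≤ k j) (hkd : 2 ≤ k d)
    (hparity : ¬ (∑ j ∈ Finset.Icc 1 d, k j) ≡ d [MOD 2]) :
    MZV.zeta (MZV.seg k 1 d) =
      (MZV.zeta (MZV.seg k 1 d) - MZV.zetaStarReg (MZV.seg k 1 d)) / 2 -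
        ∑ j ∈ Finset.Icc 1 d, ∑ i ∈ Finset.range j,
          ∑ p ∈ (Finset.range (k j + 1) ×ˢ Finset.range (k j + 1) ×ˢ Finset.range (k j + 1)).filter
              (fun p : ℕ × ℕ × ℕ => p.1 + 2 * p.2.1 + p.2.2 = k j),
            (-1 : ℝ) ^ (p.2.1 + i + p.2.2 + ∑ t ∈ Finset.Icc 1 j, k t) *
              ((2 * Real.pi) ^ (2 * p.2.1) / (2 * (Nat.factorial (2 * p.2.1) : ℝ)) *
                (bernoulli (2 * p.2.1) : ℝ)) *
              (MZV.zetaStarReg (MZV.seg k 1 i) *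
                MZV.zetaRegCoeff p.1 (MZV.seg k (i + 1) (j - 1)).reverse *
                MZV.zetaRegCoeff p.2.2 (MZV.seg k (j + 1) d)) := by
  set w := MZV.seg k 1 d with hw
  have hlen : w.length = d := by rw [hw, MZV.length_seg]; omega
  have hw0 : w ≠ [] := by
    intro h
    rw [h] at hlen
    simp at hlen
    omega
  have hsnoc : w = MZV.seg k 1 (d - 1) ++ [k d] := by
    have h := List.take_append_drop (d - 1) w
    rw [hw, MZV.take_seg k (by omega), MZV.drop_seg] at h
    rw [hw, ← h, show d - 1 + 1 = d by omega]
    simp [MZV.seg]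
  have hwa : MZV.IsAdmissible w := by
    constructor
    · intro x hx
      rw [hw, MZV.seg, List.mem_map] at hx
      obtain ⟨j, hj, rfl⟩ := hx
      rw [List.mem_range'_1] at hj
      exact hk j (Finset.mem_Icc.2 (by omega))
    · rw [hsnoc]
      simpa using hkd
  have hsum : w.sum = ∑ j ∈ Finset.Icc 1 d, k j := MZV.sum_seg k 1 d
  have hodd : Odd (w.length + w.sum) := by
    rw [hlen, hsum, Nat.odd_iff]
    unfold Nat.ModEq at hparity
    omega
  have hL : ∀ j ∈ Finset.Icc 1 d, k j ≤ w.sum := fun j hj => by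
    rw [hsum]
    exact Finset.single_le_sum (fun _ _ => Nat.zero_le _) hj
  have h := MZV.zetaReg_parity hwa hw0 hodd
  rw [MZV.isStuffleRegularization_zetaReg.eq_zeta w hwa, hlen] at h
  have hterm : ∀ i ∈ Finset.range d, (-1 : ℝ) ^ (i + (w.take i).sum) *
      MZV.zetaStarReg (w.take i) *
        ∑ m ∈ Finset.range (w.sum + 1), MZV.cotCoeff m * MZV.zetaPolar (2 * m) (w.drop i) =
      2 * ∑ j ∈ Finset.Icc (i + 1) d,
        ∑ p ∈ (Finset.range (k j + 1) ×ˢ Finset.range (k j + 1) ×ˢ Finset.range (k j + 1)).filter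
          (fun p : ℕ × ℕ × ℕ => p.1 + 2 * p.2.1 + p.2.2 = k j),
          (-1 : ℝ) ^ (p.2.1 + i + p.2.2 + ∑ t ∈ Finset.Icc 1 j, k t) *
            ((2 * Real.pi) ^ (2 * p.2.1) / (2 * (Nat.factorial (2 * p.2.1) : ℝ)) *
              (bernoulli (2 * p.2.1) : ℝ)) *
            (MZV.zetaStarReg (MZV.seg k 1 i) *
              MZV.zetaRegCoeff p.1 (MZV.seg k (i + 1) (j - 1)).reverse *
              MZV.zetaRegCoeff p.2.2 (MZV.seg k (j + 1) d)) := by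
    intro i hi
    rw [Finset.mem_range] at hi
    have h1 := MZV.sum_cotCoeff_zetaPolar k hi hL
    rw [hw, MZV.take_seg k hi.le, MZV.drop_seg, ← hw, mul_right_comm, h1, mul_assoc,
      Finset.sum_mul]
    congr 1
    refine Finset.sum_congr rfl fun j _ => ?_
    rw [Finset.sum_mul]
    exact Finset.sum_congr rfl fun p _ => by ring
  rw [Finset.sum_congr rfl hterm, ← Finset.mul_sum] at h
  have hcomm := Finset.sum_comm' (s := Finset.range d) (t := fun i => Finset.Icc (i + 1) d)
    (t' := Finset.Icc 1 d) (s' := fun j => Finset.range j) (f := fun i j =>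
      ∑ p ∈ (Finset.range (k j + 1) ×ˢ Finset.range (k j + 1) ×ˢ Finset.range (k j + 1)).filter
          (fun p : ℕ × ℕ × ℕ => p.1 + 2 * p.2.1 + p.2.2 = k j),
          (-1 : ℝ) ^ (p.2.1 + i + p.2.2 + ∑ t ∈ Finset.Icc 1 j, k t) *
            ((2 * Real.pi) ^ (2 * p.2.1) / (2 * (Nat.factorial (2 * p.2.1) : ℝ)) *
              (bernoulli (2 * p.2.1) : ℝ)) *
            (MZV.zetaStarReg (MZV.seg k 1 i) *
              MZV.zetaRegCoeff p.1 (MZV.seg k (i + 1) (j - 1)).reverse *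
              MZV.zetaRegCoeff p.2.2 (MZV.seg k (j + 1) d)))
    (by
      intro i j
      simp only [Finset.mem_range, Finset.mem_Icc]
      omega)
  rw [hcomm] at h
  -- The relation reads ζ = -ζ^⋆ - 2S with S the triple sum; halving it and adding ζ/2 gives the
  -- stated form.
  linarith
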